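/- Let $X_1,X_2,\dots$ be i.i.d. random vectors in $\mathbb{R}^d$, $d\ge 1$, with Lebesgue density $f_0$, let $\theta_0=\mathbb{E}[f_0(X_1)]$ be the average density, and suppose that $\sigma_0^2=\mathbb{V}[2\{f_0(X_1)-\theta_0\}]>0$. For a kernel $K:\mathbb{R}^d\to\mathbb{R}$ and a bandwidth $h>0$ put $K_h(x)=h^{-d}K(x/h)$. Let $h_n>0$ be a bandwidth sequence, let $c>0$ with $c\neq1$, and let $B_n\in\{2,\dots,n\}$ ($n\ge2$) be a non-random sequence of integers. Define the estimators of $\theta_0$ $$\hat\theta_n^{AD}=\hat\theta_n^{AD}(h_n),\qquad \hat\theta_n^{AD}(h)=\frac1{n^2}\sum_{1\le i,j\le n}K_h(X_i-X_j),$$ $$\hat\theta_n^{AD\text{-}BC}=\hat\theta_n^{AD}-\frac{K(0)}{nh_n^d},\qquad \hat\theta_n^{AD\text{-}GJ}=\frac{1}{1-c^d}\hat\theta_n^{AD}-\frac{c^d}{1-c^d}\hat\theta_n^{AD}(ch_n),$$ $$\hat\theta_n^{AD\text{-}LO}=\frac1n\sum_{1\le i,j\le n}w_{ij,n}K_{h_n}(X_i-X_j),\qquad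 w_{ij,n}=\frac{\mathbf 1(\lceil iB_n/n\rceil\neq\lceil jB_n/n\rceil)}{\sum_{1\le k\le n}\mathbf 1(\lceil iB_n/n\rceil\neq\lceil kB_n/n\rceil)}.$$ An estimator $\hat\theta_n=\hat\theta_n(X_1,\dots,X_n)$ is called bootstrap consistent if, with $X_{1,n}^*,\dots,X_{n,n}^*$ denoting (conditionally on the data) an i.i.d. sample from the empirical distribution of $X_1,\dots,X_n$, with $\hat\theta_n^*=\hat\theta_n(X_{1,n}^*,\dots,X_{n,n}^*)$, and with $\mathbb{P}_n^*$ the conditional probability given the data, $$\sup_{t\in\mathbb{R}}\left|\mathbb{P}[\sqrt n(\hat\theta_n-\theta_0)\le t]-\mathbb{P}_n^*[\sqrt n(\hat\theta_n^*-\hat\theta_n)\le t]\right|\to 0\quad\text{in probability as }n\to\infty.$$ Assume: Condition D: for some $s>d/4$ with $2s\notin\mathbb{N}$, $f_0$ is bounded and belongs to the Besov space $B^s_{2\infty}(\mathbb{R}^d)$. Condition K: for some real $P>d/2$, $K$ is even and bounded with $\int_{\mathbb{R}^d}|K(u)|(1+\|u\|_1^P)\,du<\infty$, $\int_{\mathbb{R}^d}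 K(u)\,du=1$, and $\int_{\mathbb{R}^d} u^lK(u)\,du=0$ for every multi-index $l\in\mathbb{Z}_+^d$ with $0<\|l\|_1<P$. Put $S=\min(P/2,s)$. (i) If Condition B holds, i.e. $nh_n^{4S}\to0$ and $nh_n^d\to\infty$ as $n\to\infty$, then $\hat\theta_n^{AD}$ and $\hat\theta_n^{AD\text{-}GJ}$ are bootstrap consistent. (ii) If Condition B$^+$ holds, i.e. $nh_n^{4S}\to0$ and $nh_n^{2d}\to\infty$ as $n\to\infty$, then $\hat\theta_n^{AD\text{-}BC}$ and $\hat\theta_n^{AD\text{-}LO}$ are bootstrap consistent. -/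

import Mathlib

open MeasureTheory ProbabilityTheory Filter Topology
open scoped ENNReal

noncomputable section

namespace AvgDensity

/-- Euclidean space of dimension `d`. -/
abbrev E (d : ℕ) : Type := EuclideanSpace ℝ (Fin d)

variable {d : ℕ}

/-! ### The model -/

/-- The measure on `ℝ^d` with Lebesgue density `f₀`. -/
def densityLaw (f₀ : E d → ℝ) : Measure (E d) :=
  volume.withDensity fun x => ENNReal.ofReal (f₀ x)

/-- The average density `θ₀ = 𝔼[f₀(X)]`, where `X` has density `f₀`. -/
def avgDensity (f₀ : E d → ℝ) : ℝ := ∫ x, f₀ x ∂(densityLaw f₀)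

/-- The efficient influence function `L₀(x) = 2 (f₀(x) - θ₀)`. -/
def influence (f₀ : E d → ℝ) (x : E d) : ℝ := 2 * (f₀ x - avgDensity f₀)

/-- The variance bound `σ₀² = 𝕍[L₀(X)]`, where `X` has density `f₀`. -/
def varianceBound (f₀ : E d → ℝ) : ℝ := Var[influence f₀; densityLaw f₀]

/-- `X 0, X 1, …` are independent random vectors, each with Lebesgue density `f₀`. -/
structure IsIIDSample {Ω : Type*} [MeasurableSpace Ω] (μ : Measure Ω)
    (X : ℕ → Ω → E d) (f₀ : E d → ℝ) : Prop where
  measurable_density : Measurable f₀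
  density_nonneg : ∀ x, 0 ≤ f₀ x
  measurable : ∀ i, Measurable (X i)
  indep : iIndepFun X μ
  law : ∀ i, μ.map (X i) = densityLaw f₀

/-! ### The conditions -/

/-- The Besov space `B^s_{2∞}(ℝ^d)`, `s > 0`, through the `L²` modulus of smoothness:
`f ∈ L²` and `‖Δ_y^r f‖_{L²} ≤ C |y|^s` for all increments `y`, where `Δ_y^r` is the `r`-fold
forward difference and `r = ⌊s⌋ + 1` is the least integer that exceeds `s`. -/
def MemBesovTwoInfty (s : ℝ) (f : E d → ℝ) : Prop :=
  MemLp f 2 volume ∧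
    ∃ C : ℝ, ∀ y : E d,
      eLpNorm ((fwdDiff y)^[⌊s⌋₊ + 1] f) 2 volume ≤ ENNReal.ofReal (C * ‖y‖ ^ s)

/-- The condition on the density. -/
structure ConditionD (f₀ : E d → ℝ) (s : ℝ) : Prop where
  smooth : (d : ℝ) / 4 < s
  two_mul_not_nat : ∀ m : ℕ, 2 * s ≠ m
  bounded : ∃ M : ℝ, ∀ x, |f₀ x| ≤ M
  besov : MemBesovTwoInfty s f₀

/-- The condition on the kernel; `P` is its order. -/
structure ConditionK (K : E d → ℝ) (P : ℝ) : Prop where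
  order : (d : ℝ) / 2 < P
  measurable : Measurable K
  even : ∀ u, K (-u) = K u
  bounded : ∃ M : ℝ, ∀ u, |K u| ≤ M
  integrable : Integrable (fun u : E d => |K u| * (1 + (∑ i, |u i|) ^ P)) volume
  integral_one : ∫ u, K u = 1
  moments : ∀ l : Fin d → ℕ, 0 < ∑ i, l i → ((∑ i, l i : ℕ) : ℝ) < P →
    ∫ u : E d, (∏ i, u i ^ l i) * K u = 0

/-- The exponent `S = min (P/2, s)`. -/
def expS (P s : ℝ) : ℝ := min (P / 2) s

/-- `n h_n^{4S} → 0` and `n h_n^d → ∞`. -/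
structure ConditionB (d : ℕ) (P s : ℝ) (h : ℕ → ℝ) : Prop where
  upper : Tendsto (fun n : ℕ => (n : ℝ) * h n ^ (4 * expS P s)) atTop (𝓝 0)
  lower : Tendsto (fun n : ℕ => (n : ℝ) * h n ^ d) atTop atTop

/-- `n h_n^{4S} → 0` and `n h_n^{2d} → ∞`. -/
structure ConditionBPlus (d : ℕ) (P s : ℝ) (h : ℕ → ℝ) : Prop where
  upper : Tendsto (fun n : ℕ => (n : ℝ) * h n ^ (4 * expS P s)) atTop (𝓝 0)
  lower : Tendsto (fun n : ℕ => (n : ℝ) * h n ^ (2 * d)) atTop atTop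

/-! ### The estimators, as functions of a sample `x : Fin n → ℝ^d` -/

/-- The scaled kernel `h^{-d} K(x / h)`. -/
def scaledKernel (K : E d → ℝ) (h : ℝ) (x : E d) : ℝ := 1 / h ^ d * K (h⁻¹ • x)

/-- The kernel density estimator. -/
def kde (K : E d → ℝ) (h : ℝ) {n : ℕ} (x : Fin n → E d) (y : E d) : ℝ :=
  1 / (n : ℝ) * ∑ j, scaledKernel K h (y - x j)

/-- The plug-in estimator with bandwidth `h`. -/
def thetaAD (K : E d → ℝ) (h : ℝ) {n : ℕ} (x : Fin n → E d) : ℝ :=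
  1 / (n : ℝ) * ∑ i, kde K h x (x i)

/-- The bias-corrected estimator. -/
def thetaBC (K : E d → ℝ) (h : ℝ) {n : ℕ} (x : Fin n → E d) : ℝ :=
  thetaAD K h x - K 0 / (n * h ^ d)

/-- The generalized jackknife estimator, which combines the bandwidths `h` and `c h`. -/
def thetaGJ (K : E d → ℝ) (c h : ℝ) {n : ℕ} (x : Fin n → E d) : ℝ :=
  1 / (1 - c ^ d) * thetaAD K h x - c ^ d / (1 - c ^ d) * thetaAD K (c * h) x

/-- The block `⌈i B / n⌉` of the `i`-th observation, `1 ≤ i ≤ n`. The element `i` of `Fin n`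
stands for the observation with number `i + 1`. -/
def block (B : ℕ) {n : ℕ} (i : Fin n) : ℕ := ⌈((i : ℕ) + 1 : ℝ) * B / n⌉₊

/-- The leave-out weights `w_{ij,n}`. -/
def leaveOutWeight (B : ℕ) {n : ℕ} (i j : Fin n) : ℝ :=
  (if block B i ≠ block B j then 1 else 0) /
    ∑ k : Fin n, (if block B i ≠ block B k then 1 else 0)

/-- The leave-out density estimator for the `i`-th observation, with `B` blocks. -/
def kdeLO (K : E d → ℝ) (B : ℕ) (h : ℝ) {n : ℕ} (x : Fin n → E d) (i : Fin n) (y : E d) : ℝ :=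
  ∑ j, leaveOutWeight B i j * scaledKernel K h (y - x j)

/-- The leave-out estimator with `B` blocks. -/
def thetaLO (K : E d → ℝ) (B : ℕ) (h : ℝ) {n : ℕ} (x : Fin n → E d) : ℝ :=
  1 / (n : ℝ) * ∑ i, kdeLO K B h x i (x i)

/-! ### The bootstrap -/

/-- The empirical distribution of a sample. -/
def empirical {n : ℕ} (x : Fin n → E d) : Measure (E d) :=
  (n : ℝ≥0∞)⁻¹ • ∑ i, Measure.dirac (x i)

/-- The bootstrap distribution given the data `x`: the law of `n` independent draws from the
empirical distribution of `x`. -/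
def bootstrapLaw {n : ℕ} (x : Fin n → E d) : Measure (Fin n → E d) :=
  Measure.pi fun _ : Fin n => empirical x

/-- The first `n` observations. -/
def sample {Ω : Type*} (X : ℕ → Ω → E d) (n : ℕ) (ω : Ω) : Fin n → E d := fun i => X i ω

/-- The Kolmogorov distance between the law of `√n (θ̂_n - θ₀)` and the bootstrap law, given the
data `X_1(ω), …, X_n(ω)`, of `√n (θ̂*_n - θ̂_n)`. -/
def bootstrapDist {Ω : Type*} [MeasurableSpace Ω] (μ : Measure Ω) (X : ℕ → Ω → E d) (θ₀ : ℝ)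
    (T : (n : ℕ) → (Fin n → E d) → ℝ) (n : ℕ) (ω : Ω) : ℝ :=
  ⨆ t : ℝ, |μ.real {ω' | √(n : ℝ) * (T n (sample X n ω') - θ₀) ≤ t} -
    (bootstrapLaw (sample X n ω)).real {y | √(n : ℝ) * (T n y - T n (sample X n ω)) ≤ t}|

/-- Bootstrap consistency of the estimators `T n`: the Kolmogorov distance is `o_ℙ(1)`. -/
def BootstrapConsistent {Ω : Type*} [MeasurableSpace Ω] (μ : Measure Ω) (X : ℕ → Ω → E d)
    (θ₀ : ℝ) (T : (n : ℕ) → (Fin n → E d) → ℝ) : Prop :=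
  TendstoInMeasure μ (bootstrapDist μ X θ₀ T) atTop fun _ => 0

end AvgDensity

end

/-! Each estimator is a constant `κ n` plus a pair sum `∑ a i j * k (x i, x j)` with the symmetric
kernel `k (x, y) = K_h (x - y)`. The weights vanish on the diagonal, are `O(1/n²)`, and have row
plus column sums within `O(1/n²)` of `2/n`. The jackknife is the plug-in estimator for another
kernel that satisfies Condition K and vanishes at `0`. So one theorem about pair sums,
`RegularProblem.bootstrapConsistent`, gives all four claims.

The engine is a Hoeffding projection valid for every probability law `G`, be it the true law or an
empirical one. Replacing the centred and scaled pair sum by the normalized sum of `2 (f - ∫ f dG)`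
costs, in mean square, a multiple of `(1/n) ∫∫ k²` plus the squared `L²(G)` distance between `x ↦ ∫
k (x, y) dG(y)` and `f` (`integral_projectionError_sq_le`). Under the true law the first term is
`O(1/(n h^d))`, and the second vanishes because kernel smoothing converges in `L²`. Under the
empirical law the two terms add up to `empiricalError`, whose expectation tends to zero. The linear
part involves the same bounded function `f` in both worlds, and a central limit theorem uniform over
all laws with nearly the right variance (`exists_uniform_clt`) covers both. For data outside an
event of vanishing probability the bootstrap argument is therefore deterministic.

It remains to compare centrings. In the true world the bias of the pair sum is `∫ f (K_h * f) - ∫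
f²`. The autocorrelation of `f` is the Fourier transform of the measure with density `|𝓕 f|²`, so
the bias is the integral of `K(u) (cos (2π h ⟨u, ξ⟩) - 1)`. The vanishing moments of `K` turn `cos -
1` into a Taylor remainder, and Besov regularity bounds the measure dyadically with exponent `2s`.
The result is `O(h^{2S})` (`BoundedDensity.exists_bias_bound`), hence `o(n^{-1/2})` by the bandwidth
condition. The exponent is twice the smoothness because the functional is quadratic in `f`.

In the bootstrap world two draws may coincide, so the mean of the pair sum contains the diagonal
`K(0)/(n h^d)`. The plug-in estimator has this same constant as its `κ n`: the bootstrap reproduces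
its bias, however large compared with `n^{-1/2}`, and both laws approach the same shifted normal
law. For the bias-corrected and leave-out estimators `κ n = 0`, so the diagonal itself must be
`o(n^{-1/2})`, which is `n h^{2d} → ∞`. -/

open scoped FourierTransform SchwartzMap RealInnerProductSpace

namespace AvgDensity

/-! ### Plancherel's theorem and the spectral measure -/

/-- Plancherel's theorem on `L¹ ∩ L²`. -/
theorem eLpNorm_fourier_eq {V : Type*} [NormedAddCommGroup V] [InnerProductSpace ℝ V]
    [FiniteDimensional ℝ V] [MeasurableSpace V] [BorelSpace V] {g : V → ℂ}
    (hg : Integrable g volume) (hg2 : MemLp g 2 volume) :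
    eLpNorm (𝓕 g) 2 volume = eLpNorm g 2 volume := by
  set G : Lp ℂ 2 (volume : Measure V) := hg2.toLp g with hG
  have hcont : Continuous (𝓕 g) :=
    VectorFourier.fourierIntegral_continuous Real.continuous_fourierChar
      (by exact continuous_inner) hg
  -- The transform on `Lp` is an extension by density and has to be identified with the integral.
  -- Testing against smooth compactly supported functions suffices: there the distributional
  -- transform and Fubini's flip formula both give `∫ 𝓕 ψ • g`.
  have hae : ∀ᵐ ξ ∂(volume : Measure V), (𝓕 G : Lp ℂ 2 (volume : Measure V)) ξ = 𝓕 g ξ := by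
    apply ae_eq_of_integral_contDiff_smul_eq
    · exact (Lp.memLp (𝓕 G)).locallyIntegrable (by norm_num)
    · exact hcont.locallyIntegrable
    · intro φ hφ hφc
      have h1 : HasCompactSupport (fun x => (φ x : ℂ)) :=
        hφc.comp_left (g := fun r : ℝ => (r : ℂ)) (by simp)
      have h2 : ContDiff ℝ ((⊤ : ℕ∞) : WithTop ℕ∞) (fun x => (φ x : ℂ)) :=
        Complex.ofRealCLM.contDiff.comp hφ
      set ψ : 𝓢(V, ℂ) := h1.toSchwartzMap h2 with hψ
      have hψφ : ∀ x, ψ x = (φ x : ℂ) := fun x => rfl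
      have key := congrArg (fun T : 𝓢'(V, ℂ) => T ψ) (Lp.fourier_toTemperedDistribution_eq G)
      simp only [TemperedDistribution.fourier_apply, Lp.toTemperedDistribution_apply] at key
      have e1 : ∫ x, φ x • (𝓕 G : Lp ℂ 2 (volume : Measure V)) x
          = ∫ x, ψ x • (𝓕 G : Lp ℂ 2 (volume : Measure V)) x := by
        refine integral_congr_ae (Eventually.of_forall fun x => ?_)
        simp [hψφ]
      have e2 : ∫ x, φ x • 𝓕 g x = ∫ x, ψ x • 𝓕 g x := by
        refine integral_congr_ae (Eventually.of_forall fun x => ?_)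
        simp [hψφ]
      rw [e1, e2, ← key]
      have flip := VectorFourier.integral_fourierIntegral_smul_eq_flip (e := Real.fourierChar)
        (μ := (volume : Measure V)) (ν := (volume : Measure V)) (L := innerₗ V)
        (f := (ψ : V → ℂ)) (g := g) Real.continuous_fourierChar (by exact continuous_inner)
        ψ.integrable hg
      rw [flip_innerₗ] at flip
      have e3 : ∫ x, (𝓕 ψ) x • G x = ∫ x, (𝓕 (ψ : V → ℂ)) x • g x := by
        refine integral_congr_ae ?_
        filter_upwards [hg2.coeFn_toLp] with x hx
        rw [hG, hx, SchwartzMap.fourier_coe]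
      rw [e3]
      exact flip
  rw [← eLpNorm_congr_ae hae]
  have h := Lp.norm_fourier_eq G
  rw [Lp.norm_def, Lp.norm_def,
    ENNReal.toReal_eq_toReal_iff' (Lp.eLpNorm_ne_top _) (Lp.eLpNorm_ne_top _)] at h
  rw [h, hG, eLpNorm_congr_ae hg2.coeFn_toLp]

/-- The modulus `|e^{2πix} - 1|`. -/
noncomputable def chordLength (x : ℝ) : ℝ := ‖Complex.exp ((2 * Real.pi * x : ℝ) * Complex.I) - 1‖

theorem continuous_chordLength : Continuous chordLength := by
  unfold chordLength; fun_prop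

variable {d : ℕ}

/-- The spectral measure of `f`, with density the squared modulus of the Fourier transform. -/
noncomputable def spectralMeasure (f : E d → ℝ) : Measure (E d) :=
  volume.withDensity fun ξ => ‖𝓕 (fun x => (f x : ℂ)) ξ‖ₑ ^ 2

theorem fourier_shift_sub {g : E d → ℂ} (hg : Integrable g volume) (y ξ : E d) :
    𝓕 (fun x => g (x + y) - g x) ξ
      = (Complex.exp ((2 * Real.pi * ⟪y, ξ⟫ : ℝ) * Complex.I) - 1) * 𝓕 g ξ := by
  have h1 : 𝓕 (fun x => g (x + y)) ξ
      = Complex.exp ((2 * Real.pi * ⟪y, ξ⟫ : ℝ) * Complex.I) * 𝓕 g ξ := by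
    have := congrFun (VectorFourier.fourierIntegral_comp_add_right Real.fourierChar
      (volume : Measure (E d)) (innerₗ (E d)) g y) ξ
    refine this.trans ?_
    rw [Circle.smul_def, Real.fourierChar_apply, smul_eq_mul]
    rfl
  have hgy : Integrable (fun x => g (x + y)) volume := hg.comp_add_right y
  have hint : ∀ {k : E d → ℂ}, Integrable k volume →
      Integrable (fun v => Complex.exp (((-2 * Real.pi * ⟪v, ξ⟫ : ℝ) : ℂ) * Complex.I) • k v) := by
    intro k hk
    simp only [smul_eq_mul]
    refine Integrable.bdd_mul (c := 1) hk (by fun_prop) (Eventually.of_forall fun x => ?_)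
    rw [Complex.norm_exp_ofReal_mul_I]
  rw [sub_mul, one_mul, ← h1]
  simp only [Real.fourier_eq', smul_sub]
  exact integral_sub (hint hgy) (hint hg)

theorem ofReal_fwdDiff_iterate_integrable {f : E d → ℝ} (hf : Integrable f volume)
    (hf2 : MemLp f 2 volume) (y : E d) (r : ℕ) :
    Integrable ((fwdDiff y)^[r] f) volume ∧ MemLp ((fwdDiff y)^[r] f) 2 volume ∧
      ∀ ξ, 𝓕 (fun x => (((fwdDiff y)^[r] f x : ℝ) : ℂ)) ξ
        = (Complex.exp ((2 * Real.pi * ⟪y, ξ⟫ : ℝ) * Complex.I) - 1) ^ r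
          * 𝓕 (fun x => (f x : ℂ)) ξ := by
  induction r with
  | zero => simp [hf, hf2]
  | succ r ih =>
    obtain ⟨h1, h2, h3⟩ := ih
    rw [Function.iterate_succ']
    have hmp : MeasurePreserving (fun x : E d => x + y) volume volume :=
      measurePreserving_add_right volume y
    refine ⟨(h1.comp_add_right y).sub h1, (h2.comp_measurePreserving hmp).sub h2, fun ξ => ?_⟩
    have := fourier_shift_sub (g := fun x => (((fwdDiff y)^[r] f x : ℝ) : ℂ)) h1.ofReal y ξ
    simp only [Function.comp_apply, fwdDiff, Complex.ofReal_sub] at this ⊢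
    rw [this, h3 ξ]
    ring

/-- The `L²` norm of an iterated difference in terms of the spectral measure. -/
theorem lintegral_chordLength_pow {f : E d → ℝ} (hf : Integrable f volume)
    (hf2 : MemLp f 2 volume) (y : E d) (r : ℕ) :
    ∫⁻ ξ, ENNReal.ofReal (chordLength ⟪y, ξ⟫ ^ (2 * r)) ∂(spectralMeasure f)
      = eLpNorm ((fwdDiff y)^[r] f) 2 volume ^ 2 := by
  obtain ⟨h1, h2, h3⟩ := ofReal_fwdDiff_iterate_integrable hf hf2 y r
  have hP := eLpNorm_fourier_eq (g := fun x => (((fwdDiff y)^[r] f x : ℝ) : ℂ)) h1.ofReal h2.ofReal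
  have hR : eLpNorm (fun x => (((fwdDiff y)^[r] f x : ℝ) : ℂ)) 2 volume
      = eLpNorm ((fwdDiff y)^[r] f) 2 volume :=
    eLpNorm_congr_norm_ae (Eventually.of_forall fun x => by simp)
  have hcont : Continuous (𝓕 (fun x => (f x : ℂ))) :=
    VectorFourier.fourierIntegral_continuous Real.continuous_fourierChar
      (by exact continuous_inner) hf.ofReal
  rw [← hR, ← hP, eLpNorm_eq_lintegral_rpow_enorm_toReal (by norm_num) (by norm_num), spectralMeasure,
    lintegral_withDensity_eq_lintegral_mul _ (by fun_prop)
      (by have := continuous_chordLength; fun_prop)]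
  simp only [ENNReal.toReal_ofNat]
  rw [← ENNReal.rpow_natCast, ← ENNReal.rpow_mul]
  norm_num
  refine lintegral_congr fun ξ => ?_
  rw [h3, enorm_mul, mul_pow, mul_comm, chordLength, pow_mul', ENNReal.ofReal_pow (by positivity),
    ENNReal.ofReal_pow (by positivity), ofReal_norm, enorm_pow]

theorem spectralMeasure_univ {f : E d → ℝ} (hf : Integrable f volume) (hf2 : MemLp f 2 volume) :
    spectralMeasure f Set.univ = eLpNorm f 2 volume ^ 2 := by
  simpa using lintegral_chordLength_pow hf hf2 0 0

theorem isFiniteMeasure_spectralMeasure {f : E d → ℝ} (hf : Integrable f volume)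
    (hf2 : MemLp f 2 volume) : IsFiniteMeasure (spectralMeasure f) := by
  refine ⟨?_⟩
  rw [spectralMeasure_univ hf hf2]
  exact ENNReal.pow_lt_top hf2.2

end AvgDensity

namespace AvgDensity

variable {d : ℕ}

/-! ### Moments of the spectral measure -/

/-- The chord is `2 |sin (πx)|`, and Jordan's inequality `sin t ≥ 2t/π` on `[0, π/2]` makes it at
least `4 |x|`. -/
theorem one_le_chordLength {x : ℝ} (h1 : 1 / 4 ≤ |x|) (h2 : |x| ≤ 1 / 2) : 1 ≤ chordLength x := by
  have hpi := Real.pi_pos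
  have e : chordLength x = 2 * |Real.sin (Real.pi * x)| := by
    rw [chordLength, mul_comm, Complex.norm_exp_I_mul_ofReal_sub_one, norm_mul, Real.norm_eq_abs,
      Real.norm_eq_abs, abs_two]
    ring_nf
  have e2 : |Real.sin (Real.pi * x)| = |Real.sin (Real.pi * |x|)| := by
    rcases abs_cases x with ⟨h, _⟩ | ⟨h, _⟩ <;> rw [h]
    rw [mul_neg, Real.sin_neg, abs_neg]
  have h3 : 2 / Real.pi * (Real.pi * |x|) ≤ Real.sin (Real.pi * |x|) :=
    Real.mul_le_sin (by positivity) (by nlinarith)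
  have h4 : 2 / Real.pi * (Real.pi * |x|) = 2 * |x| := by field_simp
  rw [e, e2]
  linarith [le_abs_self (Real.sin (Real.pi * |x|))]

/-- Finite measures on `ℝ^d` whose integrals of `|e^{2πi⟨y,ξ⟩} - 1|^N` are `O(|y|^α)`. -/
def ChordMomentBound (ν : Measure (E d)) (α C : ℝ) (N : ℕ) : Prop :=
  ∀ y : E d, ∫⁻ ξ, ENNReal.ofReal (chordLength ⟪y, ξ⟫ ^ N) ∂ν ≤ ENNReal.ofReal (C * ‖y‖ ^ α)

/-- On the shell `1/4 ≤ |a k * ⟪u, ξ⟫| ≤ 1/2` the chord for the increment `a k • u` is at least `1`.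
A weight `w k` on that shell therefore costs at most `w k * C * (a k * ‖u‖) ^ α`. The shells cover
the set where `φ` is positive, and `haw` makes the costs a geometric series. -/
theorem lintegral_le_of_dyadic {ν : Measure (E d)} {α C ρ A b : ℝ} {N : ℕ}
    (hν : ChordMomentBound ν α C N) (hC : 0 ≤ C) (hρ : 0 ≤ ρ) (hρ1 : ρ < 1) (hA : 0 ≤ A)
    (a w : ℕ → ℝ) (ha : ∀ k, 0 < a k) (hw : ∀ k, 0 ≤ w k)
    (haw : ∀ k, w k * a k ^ α = A * ρ ^ k)
    (φ : ℝ → ℝ) (hφ0 : ∀ x, (φ x ≤ 0) ∨ ∃ k, 1 / 4 ≤ |a k * x| ∧ |a k * x| ≤ 1 / 2 ∧ φ x ≤ w k)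
    (hb : b = C * A * (1 - ρ)⁻¹) (u : E d) :
    ∫⁻ ξ, ENNReal.ofReal (φ ⟪u, ξ⟫) ∂ν ≤ ENNReal.ofReal (b * ‖u‖ ^ α) := by
  have hpt : ∀ ξ : E d, ENNReal.ofReal (φ ⟪u, ξ⟫)
      ≤ ∑' k : ℕ, ENNReal.ofReal (w k) * ENNReal.ofReal (chordLength ⟪a k • u, ξ⟫ ^ N) := by
    intro ξ
    rcases hφ0 ⟪u, ξ⟫ with h | ⟨k, h1, h2, h3⟩
    · simp [ENNReal.ofReal_of_nonpos h]
    · refine le_trans ?_ (ENNReal.le_tsum k)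
      rw [← ENNReal.ofReal_mul (hw k)]
      apply ENNReal.ofReal_le_ofReal
      rw [real_inner_smul_left]
      have := one_le_pow₀ (one_le_chordLength h1 h2) (n := N)
      nlinarith [hw k]
  have hm : ∀ k, Measurable fun ξ : E d =>
      ENNReal.ofReal (w k) * ENNReal.ofReal (chordLength ⟪a k • u, ξ⟫ ^ N) := by
    intro k
    have := continuous_chordLength.measurable
    fun_prop
  refine (lintegral_mono hpt).trans ?_
  rw [lintegral_tsum fun k => (hm k).aemeasurable]
  have hk : ∀ k, ∫⁻ ξ, ENNReal.ofReal (w k) * ENNReal.ofReal (chordLength ⟪a k • u, ξ⟫ ^ N) ∂ν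
      ≤ ENNReal.ofReal (C * A * ‖u‖ ^ α * ρ ^ k) := by
    intro k
    rw [lintegral_const_mul' _ _ ENNReal.ofReal_ne_top]
    refine (mul_le_mul_right (hν (a k • u)) _).trans ?_
    rw [← ENNReal.ofReal_mul (hw k), norm_smul, Real.norm_of_nonneg (ha k).le,
      Real.mul_rpow (ha k).le (norm_nonneg _)]
    apply ENNReal.ofReal_le_ofReal
    apply le_of_eq
    linear_combination (C * ‖u‖ ^ α) * haw k
  refine (ENNReal.tsum_le_tsum hk).trans ?_
  rw [← ENNReal.ofReal_tsum_of_nonneg (fun k => by positivity)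
    ((summable_geometric_of_lt_one hρ hρ1).mul_left _), tsum_mul_left,
    tsum_geometric_of_lt_one hρ hρ1, hb]
  apply ENNReal.ofReal_le_ofReal
  apply le_of_eq
  ring

/-- Dyadic shells `2^k ≤ |⟪u, ξ⟫| < 2^(k+1)`: the factor `2^(-k)/4` brings a shell into the chord
window, the integrand is at most `2^((k+1)p)`, and the costs have ratio `2^(p-α) < 1`. -/
theorem exists_high_moment_bound {ν : Measure (E d)} {α C p : ℝ} {N : ℕ}
    (hν : ChordMomentBound ν α C N) (hC : 0 ≤ C) (hp : 0 ≤ p) (hpα : p < α) :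
    ∃ b : ℝ, 0 ≤ b ∧ ∀ u : E d,
      ∫⁻ ξ, ENNReal.ofReal (if 1 ≤ |⟪u, ξ⟫| then |⟪u, ξ⟫| ^ p else 0) ∂ν
        ≤ ENNReal.ofReal (b * ‖u‖ ^ α) := by
  have hρ1 : (2 : ℝ) ^ (p - α) < 1 := Real.rpow_lt_one_of_one_lt_of_neg (by norm_num) (by linarith)
  refine ⟨C * (2 ^ p * (1 / 4) ^ α) * (1 - 2 ^ (p - α))⁻¹, ?_, fun u => ?_⟩
  · have : 0 ≤ (1 - (2 : ℝ) ^ (p - α))⁻¹ := inv_nonneg.2 (by linarith)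
    positivity
  refine lintegral_le_of_dyadic hν hC (ρ := 2 ^ (p - α)) (A := 2 ^ p * (1 / 4) ^ α)
    (by positivity) hρ1 (by positivity) (fun k => 1 / 4 * ((2 : ℝ) ^ k)⁻¹)
    (fun k => ((2 : ℝ) ^ (k + 1)) ^ p) (fun k => by positivity) (fun k => by positivity)
    (fun k => ?_) (fun x => if 1 ≤ |x| then |x| ^ p else 0) (fun x => ?_) rfl u
  · rw [Real.mul_rpow (by norm_num) (by positivity), pow_succ,
      Real.mul_rpow (by positivity) (by norm_num), ← Real.rpow_natCast, ← Real.rpow_natCast,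
      ← Real.rpow_neg (by norm_num), ← Real.rpow_mul (by norm_num), ← Real.rpow_mul (by norm_num),
      ← Real.rpow_mul (by norm_num), sub_mul, Real.rpow_sub (by norm_num), neg_mul,
      Real.rpow_neg (by norm_num), mul_comm p, mul_comm α]
    field_simp
  · by_cases hx : 1 ≤ |x|
    · obtain ⟨k, hk1, hk2⟩ := exists_nat_pow_near hx one_lt_two
      have h2k : (0 : ℝ) < 2 ^ k := by positivity
      right
      refine ⟨k, ?_, ?_, ?_⟩
      · rw [abs_mul, abs_of_pos (by positivity)]
        field_simp
        linarith
      · rw [abs_mul, abs_of_pos (by positivity)]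
        rw [pow_succ] at hk2
        field_simp
        linarith
      · simp only [hx, if_true]
        exact Real.rpow_le_rpow (abs_nonneg _) hk2.le hp
    · simp [hx]

/-- The mirror image near zero, with shells `2^(-k-1) < |⟪u, ξ⟫| ≤ 2^(-k)`, factors `2^k/2` and
ratio `2^(α-p) < 1`. -/
theorem exists_low_moment_bound {ν : Measure (E d)} {α C p : ℝ} {N : ℕ}
    (hν : ChordMomentBound ν α C N) (hC : 0 ≤ C) (hp : 0 < p) (hpα : α < p) :
    ∃ b : ℝ, 0 ≤ b ∧ ∀ u : E d,
      ∫⁻ ξ, ENNReal.ofReal (if 1 ≤ |⟪u, ξ⟫| then 0 else |⟪u, ξ⟫| ^ p) ∂ν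
        ≤ ENNReal.ofReal (b * ‖u‖ ^ α) := by
  have hρ1 : (2 : ℝ) ^ (α - p) < 1 := Real.rpow_lt_one_of_one_lt_of_neg (by norm_num) (by linarith)
  refine ⟨C * (1 / 2) ^ α * (1 - 2 ^ (α - p))⁻¹, ?_, fun u => ?_⟩
  · have : 0 ≤ (1 - (2 : ℝ) ^ (α - p))⁻¹ := inv_nonneg.2 (by linarith)
    positivity
  refine lintegral_le_of_dyadic hν hC (ρ := 2 ^ (α - p)) (A := (1 / 2) ^ α)
    (by positivity) hρ1 (by positivity) (fun k => 1 / 2 * (2 : ℝ) ^ k)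
    (fun k => (((2 : ℝ) ^ k)⁻¹) ^ p) (fun k => by positivity) (fun k => by positivity)
    (fun k => ?_) (fun x => if 1 ≤ |x| then 0 else |x| ^ p) (fun x => ?_) rfl u
  · rw [Real.mul_rpow (by norm_num) (by positivity), ← Real.rpow_natCast, ← Real.rpow_natCast,
      ← Real.rpow_neg (by norm_num), ← Real.rpow_mul (by norm_num), ← Real.rpow_mul (by norm_num),
      ← Real.rpow_mul (by norm_num), sub_mul, Real.rpow_sub (by norm_num), neg_mul,
      Real.rpow_neg (by norm_num), mul_comm p, mul_comm α]
    field_simp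
  · by_cases hx : 1 ≤ |x|
    · simp [hx]
    · rcases eq_or_ne x 0 with rfl | hx0
      · left; simp [Real.zero_rpow hp.ne']
      have hx1 : |x| < 1 := not_le.1 hx
      obtain ⟨k, hk1, hk2⟩ := exists_nat_pow_near_of_lt_one (y := (1 / 2 : ℝ)) (abs_pos.2 hx0) hx1.le
        (by norm_num) (by norm_num)
      have h2k : (0 : ℝ) < 2 ^ k := by positivity
      rw [one_div, inv_pow] at hk1 hk2
      rw [pow_succ, mul_inv] at hk1
      have k1 : 1 < |x| * 2 ^ k * 2 := by
        have := mul_lt_mul_of_pos_right hk1 (show (0:ℝ) < 2 ^ k * 2 by positivity)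
        calc (1 : ℝ) = (2 ^ k)⁻¹ * 2⁻¹ * (2 ^ k * 2) := by field_simp
          _ < _ := this
          _ = _ := by ring
      have k2 : |x| * 2 ^ k ≤ 1 := by
        have := mul_le_mul_of_nonneg_right hk2 h2k.le
        rwa [inv_mul_cancel₀ h2k.ne'] at this
      right
      refine ⟨k, ?_, ?_, ?_⟩
      · rw [abs_mul, abs_of_pos (by positivity)]
        linarith
      · rw [abs_mul, abs_of_pos (by positivity)]
        linarith
      · simp only [hx, if_false]
        exact Real.rpow_le_rpow (abs_nonneg _) hk2 hp.le

/-- A function that is `O(|x|^m)` and `O(|x|^{m+1})`, composed with `ξ ↦ ⟨u,ξ⟩`, has an integral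
of order `|u|^Q` for `m < Q ≤ m + 1` when `Q` does not exceed the order of the chord moments. -/
theorem exists_remainder_bound {ν : Measure (E d)} [IsFiniteMeasure ν] {α C Q A : ℝ} {N m : ℕ}
    (hν : ChordMomentBound ν α C N) (hC : 0 ≤ C) (hmQ : m < Q) (hQm : Q ≤ m + 1)
    (hQα : Q < α ∨ Q = α ∧ Q < m + 1) (hA : 0 ≤ A) (ψ : ℝ → ℝ)
    (h1 : ∀ x, |ψ x| ≤ A * |x| ^ m) (h2 : ∀ x, |ψ x| ≤ A * |x| ^ (m + 1)) :
    ∃ b : ℝ, 0 ≤ b ∧ ∀ u : E d,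
      ∫⁻ ξ, ENNReal.ofReal |ψ ⟪u, ξ⟫| ∂ν ≤ ENNReal.ofReal (b * ‖u‖ ^ Q) := by
  have hQ0 : 0 < Q := lt_of_le_of_lt (Nat.cast_nonneg m) hmQ
  have hmeas : ∀ (u : E d) (p : ℝ), Measurable fun ξ : E d =>
      ENNReal.ofReal (if 1 ≤ |⟪u, ξ⟫| then |⟪u, ξ⟫| ^ p else 0) := by
    intro u p
    refine ENNReal.measurable_ofReal.comp (Measurable.ite ?_ (by fun_prop) (by fun_prop))
    exact measurableSet_le (by fun_prop) (by fun_prop)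
  rcases hQα with hlt | ⟨rfl, hlt⟩
  -- Below the critical order the `Q`-th moment along a unit vector is finite. Interpolating `h1`
  -- and `h2` gives `|ψ x| ≤ A * |x| ^ Q`, and `‖u‖ ^ Q` scales out.
  · obtain ⟨b, hb0, hb⟩ := exists_high_moment_bound hν hC hQ0.le hlt
    have hψQ : ∀ x, |ψ x| ≤ A * |x| ^ Q := by
      intro x
      rcases le_or_gt 1 |x| with hx | hx
      · refine (h1 x).trans (mul_le_mul_of_nonneg_left ?_ hA)
        rw [← Real.rpow_natCast]
        exact Real.rpow_le_rpow_of_exponent_le hx hmQ.le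
      · rcases eq_or_ne x 0 with rfl | hx0
        · have := h2 0
          simp only [abs_zero, ne_eq, Nat.add_eq_zero_iff, one_ne_zero, and_false,
            not_false_eq_true, zero_pow, mul_zero] at this
          simpa [Real.zero_rpow hQ0.ne'] using this
        · refine (h2 x).trans (mul_le_mul_of_nonneg_left ?_ hA)
          rw [← Real.rpow_natCast]
          exact Real.rpow_le_rpow_of_exponent_ge (abs_pos.2 hx0) hx.le (by push_cast; exact hQm)
    refine ⟨A * (ν.real Set.univ + b), by positivity, fun u => ?_⟩
    rcases eq_or_ne u 0 with rfl | hu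
    · have h0 : |ψ 0| ≤ 0 := by simpa [Real.zero_rpow hQ0.ne'] using hψQ 0
      simp [ENNReal.ofReal_of_nonpos h0, Real.zero_rpow hQ0.ne']
    · have hu0 : 0 < ‖u‖ := norm_pos_iff.2 hu
      set e : E d := ‖u‖⁻¹ • u with he
      have hen : ‖e‖ = 1 := by rw [he, norm_smul, norm_inv, norm_norm, inv_mul_cancel₀ hu0.ne']
      have hue : ∀ ξ : E d, ⟪u, ξ⟫ = ‖u‖ * ⟪e, ξ⟫ := by
        intro ξ
        rw [he, real_inner_smul_left, ← mul_assoc, mul_inv_cancel₀ hu0.ne', one_mul]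
      have hpt : ∀ ξ : E d, ENNReal.ofReal |ψ ⟪u, ξ⟫| ≤ ENNReal.ofReal (A * ‖u‖ ^ Q) *
          (1 + ENNReal.ofReal (if 1 ≤ |⟪e, ξ⟫| then |⟪e, ξ⟫| ^ Q else 0)) := by
        intro ξ
        have hnn : (0 : ℝ) ≤ if 1 ≤ |⟪e, ξ⟫| then |⟪e, ξ⟫| ^ Q else 0 := by
          split_ifs <;> positivity
        rw [← ENNReal.ofReal_one, ← ENNReal.ofReal_add zero_le_one hnn,
          ← ENNReal.ofReal_mul (by positivity)]
        apply ENNReal.ofReal_le_ofReal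
        refine (hψQ _).trans ?_
        rw [hue, abs_mul, abs_of_pos hu0, Real.mul_rpow hu0.le (abs_nonneg _), ← mul_assoc]
        refine mul_le_mul_of_nonneg_left ?_ (by positivity)
        split_ifs with h
        · linarith
        · rw [add_zero]
          exact Real.rpow_le_one (abs_nonneg _) (not_le.1 h).le hQ0.le
      refine (lintegral_mono hpt).trans ?_
      rw [lintegral_const_mul' _ _ ENNReal.ofReal_ne_top, lintegral_add_left (by fun_prop),
        lintegral_const, one_mul, ← ofReal_measureReal]
      refine (mul_le_mul_right (add_le_add_right (hb e) _) _).trans ?_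
      rw [hen, Real.one_rpow, mul_one, ← ENNReal.ofReal_add (by positivity) hb0,
        ← ENNReal.ofReal_mul (by positivity)]
      apply ENNReal.ofReal_le_ofReal
      apply le_of_eq
      ring
  -- At the critical order the `Q`-th moment may be infinite. The exponent `m` is used where `|⟪u,
  -- ξ⟫| ≥ 1` and `m + 1` elsewhere; they lie strictly on either side of `Q`, so both dyadic series
  -- converge.
  · obtain ⟨b, hb0, hb⟩ := exists_high_moment_bound hν hC (Nat.cast_nonneg m) hmQ
    obtain ⟨b', hb0', hb'⟩ := exists_low_moment_bound hν hC (p := m + 1) (by positivity) hlt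
    refine ⟨A * (b + b'), by positivity, fun u => ?_⟩
    have hpt : ∀ ξ : E d, ENNReal.ofReal |ψ ⟪u, ξ⟫| ≤ ENNReal.ofReal A *
        (ENNReal.ofReal (if 1 ≤ |⟪u, ξ⟫| then |⟪u, ξ⟫| ^ (m : ℝ) else 0) +
          ENNReal.ofReal (if 1 ≤ |⟪u, ξ⟫| then 0 else |⟪u, ξ⟫| ^ ((m : ℝ) + 1))) := by
      intro ξ
      split_ifs with h
      · rw [ENNReal.ofReal_zero, add_zero, ← ENNReal.ofReal_mul hA, Real.rpow_natCast]
        exact ENNReal.ofReal_le_ofReal (h1 _)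
      · rw [ENNReal.ofReal_zero, zero_add, ← ENNReal.ofReal_mul hA]
        have := h2 ⟪u, ξ⟫
        rw [← Real.rpow_natCast] at this
        push_cast at this
        exact ENNReal.ofReal_le_ofReal this
    refine (lintegral_mono hpt).trans ?_
    rw [lintegral_const_mul' _ _ ENNReal.ofReal_ne_top, lintegral_add_left (hmeas u _)]
    refine (mul_le_mul_right (add_le_add (hb u) (hb' u)) _).trans ?_
    rw [← ENNReal.ofReal_add (by positivity) (by positivity), ← ENNReal.ofReal_mul hA]
    apply ENNReal.ofReal_le_ofReal
    apply le_of_eq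
    ring

end AvgDensity

namespace AvgDensity

variable {d : ℕ}

/-! ### Taylor remainders of the complex exponential -/

/-- The derivative of a remainder is `I` times the preceding remainder, so the mean value inequality
on `[-|x|, |x|]` raises the power by one. The factorial is given up, as only the order matters. -/
theorem norm_exp_mul_I_sub_sum_le (n : ℕ) (x : ℝ) :
    ‖Complex.exp (x * Complex.I) - ∑ j ∈ Finset.range n, (x * Complex.I) ^ j / (j.factorial : ℂ)‖
      ≤ 2 * |x| ^ n ∧
    (n ≠ 0 → ‖Complex.exp (x * Complex.I) -
      ∑ j ∈ Finset.range n, (x * Complex.I) ^ j / (j.factorial : ℂ)‖ ≤ |x| ^ n) := by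
  suffices H : ‖Complex.exp (x * Complex.I) -
      ∑ j ∈ Finset.range n, (x * Complex.I) ^ j / (j.factorial : ℂ)‖ ≤ |x| ^ n by
    exact ⟨H.trans (by nlinarith [pow_nonneg (abs_nonneg x) n]), fun _ => H⟩
  induction n generalizing x with
  | zero => simp [Complex.norm_exp_ofReal_mul_I]
  | succ n ih =>
    set F : ℝ → ℂ := fun t => Complex.exp (t * Complex.I) -
      ∑ j ∈ Finset.range (n + 1), (t * Complex.I) ^ j / (j.factorial : ℂ) with hF
    have hder : ∀ t : ℝ, HasDerivAt F (Complex.I * (Complex.exp (t * Complex.I) -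
        ∑ j ∈ Finset.range n, (t * Complex.I) ^ j / (j.factorial : ℂ))) t := by
      intro t
      have hI : HasDerivAt (fun t : ℝ => (t : ℂ) * Complex.I) Complex.I t := by
        simpa using (Complex.ofRealCLM.hasDerivAt (x := t)).mul_const Complex.I
      have h1 := hI.cexp
      have h2 : HasDerivAt (fun t : ℝ => ∑ j ∈ Finset.range (n + 1),
          ((t : ℂ) * Complex.I) ^ j / (j.factorial : ℂ))
          (∑ j ∈ Finset.range (n + 1),
            (j * ((t : ℂ) * Complex.I) ^ (j - 1) * Complex.I) / (j.factorial : ℂ)) t :=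
        HasDerivAt.fun_sum fun j _ => (hI.pow j).div_const _
      refine (h1.sub h2).congr_deriv ?_
      rw [Finset.sum_range_succ', mul_sub, Finset.mul_sum]
      simp only [Nat.cast_zero, zero_mul, zero_div, add_zero, Nat.add_sub_cancel]
      congr 1
      · ring
      · refine Finset.sum_congr rfl fun j _ => ?_
        rw [Nat.factorial_succ]
        push_cast
        have h1 : (j : ℂ) + 1 ≠ 0 := by exact_mod_cast Nat.succ_ne_zero j
        have h2 : (j.factorial : ℂ) ≠ 0 := by exact_mod_cast j.factorial_ne_zero
        field_simp
    have hmv := Convex.norm_image_sub_le_of_norm_hasDerivWithin_le (𝕜 := ℝ) (f := F)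
      (s := Set.Icc (-|x|) |x|) (x := 0) (y := x) (C := |x| ^ n)
      (fun t _ => (hder t).hasDerivWithinAt)
      (fun t ht => by
        rw [norm_mul, Complex.norm_I, one_mul]
        exact (ih t).trans (pow_le_pow_left₀ (abs_nonneg t) (abs_le.2 ht) n))
      (convex_Icc _ _) ⟨by simp, by simp⟩ ⟨neg_abs_le x, le_abs_self x⟩
    have hF0 : F 0 = 0 := by
      simp [hF, Finset.sum_range_succ']
    rw [hF0, sub_zero, sub_zero, Real.norm_eq_abs, ← pow_succ] at hmv
    exact hmv

/-- The remainder of `cos (2πx)` after its Taylor polynomial of degree `m` at `0`. -/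
noncomputable def cosRemainder (m : ℕ) (x : ℝ) : ℝ :=
  Real.cos (2 * Real.pi * x) -
    ∑ j ∈ Finset.range (m + 1), (2 * Real.pi) ^ j / j.factorial * (Complex.I ^ j).re * x ^ j

theorem cosRemainder_eq (m : ℕ) (x : ℝ) : cosRemainder m x =
    (Complex.exp ((2 * Real.pi * x : ℝ) * Complex.I) - ∑ j ∈ Finset.range (m + 1),
      ((2 * Real.pi * x : ℝ) * Complex.I) ^ j / (j.factorial : ℂ)).re := by
  rw [cosRemainder, Complex.sub_re, Complex.exp_ofReal_mul_I_re, Complex.re_sum]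
  congr 1
  refine Finset.sum_congr rfl fun j _ => ?_
  rw [mul_pow (_ : ℂ), ← Complex.ofReal_pow, mul_div_assoc, Complex.re_ofReal_mul,
    ← Complex.ofReal_natCast, Complex.div_ofReal_re, mul_pow _ x]
  ring

theorem abs_cosRemainder_le_succ (m : ℕ) (x : ℝ) :
    |cosRemainder m x| ≤ (2 * Real.pi) ^ (m + 1) * |x| ^ (m + 1) := by
  rw [cosRemainder_eq]
  refine (Complex.abs_re_le_norm _).trans
    (((norm_exp_mul_I_sub_sum_le (m + 1) _).2 m.succ_ne_zero).trans (le_of_eq ?_))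
  rw [abs_mul, abs_of_pos (by positivity), mul_pow]

/-- The remainder after degree `m` is the one after degree `m - 1` less a monomial, whence `3 = 2 +
1`. Together with the preceding bound, the remainder has order `m + 1` at zero and `m` at infinity,
as `exists_remainder_bound` requires. -/
theorem abs_cosRemainder_le (m : ℕ) (x : ℝ) :
    |cosRemainder m x| ≤ 3 * (2 * Real.pi) ^ m * |x| ^ m := by
  have hpi : (0 : ℝ) < 2 * Real.pi := by positivity
  rw [cosRemainder_eq, Finset.sum_range_succ, ← sub_sub]
  refine (Complex.abs_re_le_norm _).trans ((norm_sub_le _ _).trans ?_)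
  have h1 := (norm_exp_mul_I_sub_sum_le m (2 * Real.pi * x)).1
  have h2 : ‖((2 * Real.pi * x : ℝ) * Complex.I) ^ m / (m.factorial : ℂ)‖
      ≤ |2 * Real.pi * x| ^ m := by
    rw [norm_div, norm_pow, norm_mul, Complex.norm_I, mul_one, Complex.norm_real,
      Real.norm_eq_abs, Complex.norm_natCast]
    exact div_le_self (by positivity) (by exact_mod_cast m.factorial_pos)
  have h3 : |2 * Real.pi * x| ^ m = (2 * Real.pi) ^ m * |x| ^ m := by
    rw [abs_mul, abs_of_pos hpi, mul_pow]
  rw [h3] at h1 h2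
  linarith

theorem continuous_cosRemainder (m : ℕ) : Continuous (cosRemainder m) := by
  unfold cosRemainder; fun_prop

/-! ### Moments of the kernel -/

namespace ConditionK

variable {K : E d → ℝ} {P : ℝ}

theorem order_pos (hK : ConditionK K P) : 0 < P := lt_of_le_of_lt (by positivity) hK.order

theorem integrable_mul_of_le (hK : ConditionK K P) {g : E d → ℝ} (hg : Measurable g)
    (hle : ∀ u, |g u| ≤ 1 + (∑ i, |u i|) ^ P) : Integrable (fun u => K u * g u) volume := by
  refine hK.integrable.mono' (hK.measurable.mul hg).aestronglyMeasurable
    (Eventually.of_forall fun u => ?_)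
  rw [norm_mul]
  exact mul_le_mul_of_nonneg_left (hle u) (abs_nonneg _)

theorem integrable_kernel (hK : ConditionK K P) : Integrable K volume := by
  have := hK.integrable_mul_of_le (g := fun _ => 1) measurable_const
    (fun u => by
      have : 0 ≤ (∑ i, |u i|) ^ P := by positivity
      simpa using this)
  simpa using this

theorem pow_le_one_add_rpow {a p q : ℝ} (ha : 0 ≤ a) (hp : 0 ≤ p) (hpq : p ≤ q) :
    a ^ p ≤ 1 + a ^ q := by
  rcases le_or_gt a 1 with h | h
  · have := Real.rpow_le_one ha h hp
    have := Real.rpow_nonneg ha q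
    linarith
  · have := Real.rpow_le_rpow_of_exponent_le h.le hpq
    linarith

theorem norm_le_sum_abs (u : E d) : ‖u‖ ≤ ∑ i, |u i| := by
  rw [EuclideanSpace.norm_eq]
  refine Real.sqrt_le_iff.2 ⟨by positivity, ?_⟩
  simpa using Finset.sum_sq_le_sq_sum_of_nonneg (s := Finset.univ) (f := fun i => |u i|)
    (fun i _ => abs_nonneg _)

theorem integrable_norm_rpow (hK : ConditionK K P) {q : ℝ} (hq : 0 ≤ q) (hqP : q ≤ P) :
    Integrable (fun u => K u * ‖u‖ ^ q) volume := by
  refine hK.integrable_mul_of_le (by fun_prop) fun u => ?_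
  rw [abs_of_nonneg (by positivity)]
  exact (Real.rpow_le_rpow (norm_nonneg _) (norm_le_sum_abs u) hq).trans
    (pow_le_one_add_rpow (by positivity) hq hqP)

theorem integrable_monomial (hK : ConditionK K P) (l : Fin d → ℕ)
    (hl : ((∑ i, l i : ℕ) : ℝ) ≤ P) : Integrable (fun u : E d => K u * ∏ i, u i ^ l i) volume := by
  refine hK.integrable_mul_of_le (by fun_prop) fun u => ?_
  refine le_trans ?_ (pow_le_one_add_rpow (p := ((∑ i, l i : ℕ) : ℝ)) (by positivity)
    (by positivity) hl)
  rw [Finset.abs_prod, Real.rpow_natCast, ← Finset.prod_pow_eq_pow_sum]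
  refine Finset.prod_le_prod (fun i _ => abs_nonneg _) fun i _ => ?_
  rw [abs_pow]
  exact pow_le_pow_left₀ (abs_nonneg _)
    (Finset.single_le_sum (f := fun i => |u i|) (fun i _ => abs_nonneg _) (Finset.mem_univ i)) _

theorem inner_pow_eq (u ξ : E d) (j : ℕ) : (⟪u, ξ⟫ : ℝ) ^ j =
    ∑ k ∈ Finset.piAntidiag Finset.univ j,
      (Nat.multinomial Finset.univ k : ℝ) * (∏ i, ξ i ^ k i) * ∏ i, u i ^ k i := by
  have : (⟪u, ξ⟫ : ℝ) = ∑ i, ξ i * u i := by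
    simp [PiLp.inner_apply]
  rw [this, Finset.sum_pow_eq_sum_piAntidiag]
  refine Finset.sum_congr rfl fun k _ => ?_
  rw [mul_assoc, ← Finset.prod_mul_distrib]
  simp only [mul_pow]

theorem integrable_inner_pow (hK : ConditionK K P) (ξ : E d) {j : ℕ} (hj : (j : ℝ) ≤ P) :
    Integrable (fun u => K u * (⟪u, ξ⟫ : ℝ) ^ j) volume := by
  simp_rw [inner_pow_eq, Finset.mul_sum]
  refine integrable_finsetSum _ fun k hk => ?_
  rw [Finset.mem_piAntidiag] at hk
  refine ((hK.integrable_monomial k (by rw [hk.1]; exact hj)).const_mul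
    ((Nat.multinomial Finset.univ k : ℝ) * (∏ i, ξ i ^ k i))).congr
    (Eventually.of_forall fun u => ?_)
  ring

/-- The multinomial expansion involves only monomials of total degree `j`, and the moment condition
kills each of them. -/
theorem integral_inner_pow (hK : ConditionK K P) (ξ : E d) {j : ℕ} (hj0 : 0 < j)
    (hj : (j : ℝ) < P) : ∫ u, K u * (⟪u, ξ⟫ : ℝ) ^ j = 0 := by
  have e : ∀ u : E d, K u * (⟪u, ξ⟫ : ℝ) ^ j = ∑ k ∈ Finset.piAntidiag Finset.univ j,
      ((Nat.multinomial Finset.univ k : ℝ) * (∏ i, ξ i ^ k i)) * (K u * ∏ i, u i ^ k i) := by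
    intro u
    rw [inner_pow_eq, Finset.mul_sum]
    exact Finset.sum_congr rfl fun k _ => by ring
  simp_rw [e]
  rw [integral_finsetSum]
  · refine Finset.sum_eq_zero fun k hk => ?_
    rw [Finset.mem_piAntidiag] at hk
    rw [integral_const_mul]
    have := hK.moments k (by rw [hk.1]; exact hj0) (by rw [hk.1]; exact hj)
    simp_rw [mul_comm (∏ i, _) (K _)] at this
    rw [this, mul_zero]
  · intro k hk
    rw [Finset.mem_piAntidiag] at hk
    exact (hK.integrable_monomial k (by rw [hk.1]; exact hj.le)).const_mul _

/-- Against the kernel, `cos - 1` may be replaced by a Taylor remainder of the cosine. -/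
theorem integral_cos_sub_one (hK : ConditionK K P) (ξ : E d) (h : ℝ) {m : ℕ} (hm : (m : ℝ) < P) :
    ∫ u, K u * (Real.cos (2 * Real.pi * ⟪h • u, ξ⟫) - 1)
      = ∫ u, K u * cosRemainder m ⟪h • u, ξ⟫ := by
  have hterm : ∀ j ∈ Finset.range m, Integrable (fun u : E d => K u *
      ((2 * Real.pi) ^ (j + 1) / (j + 1).factorial * (Complex.I ^ (j + 1)).re *
        ⟪h • u, ξ⟫ ^ (j + 1))) volume ∧
      ∫ u : E d, K u * ((2 * Real.pi) ^ (j + 1) / (j + 1).factorial * (Complex.I ^ (j + 1)).re *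
        ⟪h • u, ξ⟫ ^ (j + 1)) = 0 := by
    intro j hj
    have hjP : ((j + 1 : ℕ) : ℝ) < P :=
      lt_of_le_of_lt (by exact_mod_cast Finset.mem_range.1 hj) hm
    have e : (fun u : E d => K u * ((2 * Real.pi) ^ (j + 1) / (j + 1).factorial *
        (Complex.I ^ (j + 1)).re * ⟪h • u, ξ⟫ ^ (j + 1))) =
        fun u => ((2 * Real.pi) ^ (j + 1) / (j + 1).factorial * (Complex.I ^ (j + 1)).re *
          h ^ (j + 1)) * (K u * ⟪u, ξ⟫ ^ (j + 1)) := by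
      funext u
      rw [real_inner_smul_left, mul_pow]
      ring
    rw [e]
    refine ⟨(hK.integrable_inner_pow ξ hjP.le).const_mul _, ?_⟩
    rw [integral_const_mul, hK.integral_inner_pow ξ j.succ_pos hjP, mul_zero]
  have hc : Integrable (fun u : E d => K u * (Real.cos (2 * Real.pi * ⟪h • u, ξ⟫) - 1)) volume := by
    refine hK.integrable_kernel.mul_bdd (c := 2) (by fun_prop) (Eventually.of_forall fun u => ?_)
    rw [Real.norm_eq_abs, abs_le]
    constructor <;> linarith [Real.neg_one_le_cos (2 * Real.pi * ⟪h • u, ξ⟫),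
      Real.cos_le_one (2 * Real.pi * ⟪h • u, ξ⟫)]
  have e : ∀ u : E d, K u * cosRemainder m ⟪h • u, ξ⟫ =
      K u * (Real.cos (2 * Real.pi * ⟪h • u, ξ⟫) - 1) - ∑ j ∈ Finset.range m,
        K u * ((2 * Real.pi) ^ (j + 1) / (j + 1).factorial * (Complex.I ^ (j + 1)).re *
          ⟪h • u, ξ⟫ ^ (j + 1)) := by
    intro u
    rw [cosRemainder, Finset.sum_range_succ', ← Finset.mul_sum]
    simp
    ring
  simp_rw [e]
  rw [integral_sub hc (integrable_finsetSum _ fun j hj => (hterm j hj).1),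
    integral_finsetSum _ fun j hj => (hterm j hj).1,
    Finset.sum_eq_zero fun j hj => (hterm j hj).2, sub_zero]

end ConditionK

end AvgDensity

namespace AvgDensity

variable {d : ℕ}

/-! ### Smoothing a density with the kernel -/

/-- `f` is a probability density that is bounded by `M`. -/
structure BoundedDensity (f : E d → ℝ) (M : ℝ) : Prop where
  measurable : Measurable f
  nonneg : ∀ x, 0 ≤ f x
  le : ∀ x, f x ≤ M
  integrable : Integrable f volume
  integral_one : ∫ x, f x = 1

/-- The convolution `x ↦ ∫ K(u) f(x + hu) du`. -/
noncomputable def smooth (K : E d → ℝ) (h : ℝ) (f : E d → ℝ) (x : E d) : ℝ :=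
  ∫ u, K u * f (x + h • u)

theorem chordLength_sq (x : ℝ) : chordLength x ^ 2 = 2 - 2 * Real.cos (2 * Real.pi * x) := by
  rw [chordLength, ← Complex.normSq_eq_norm_sq, Complex.normSq_apply, Complex.sub_re,
    Complex.sub_im, Complex.exp_ofReal_mul_I_re, Complex.exp_ofReal_mul_I_im]
  simp only [Complex.one_re, Complex.one_im]
  nlinarith [Real.sin_sq_add_cos_sq (2 * Real.pi * x)]

theorem chordLength_sq_le (x : ℝ) : chordLength x ^ 2 ≤ 4 := by
  rw [chordLength_sq]; linarith [Real.neg_one_le_cos (2 * Real.pi * x)]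

namespace BoundedDensity

variable {f : E d → ℝ} {M : ℝ}

theorem abs_le (hf : BoundedDensity f M) (x : E d) : |f x| ≤ M := by
  rw [abs_of_nonneg (hf.nonneg x)]; exact hf.le x

theorem memLp_two (hf : BoundedDensity f M) : MemLp f 2 volume :=
  (memLp_two_iff_integrable_sq hf.measurable.aestronglyMeasurable).2 <| by
    simp_rw [pow_two]
    exact hf.integrable.mul_bdd (c := M) hf.measurable.aestronglyMeasurable
      (Eventually.of_forall hf.abs_le)

theorem lintegral_shift_sub_sq (hf : BoundedDensity f M) (y : E d) :
    ∫⁻ x, ENNReal.ofReal ((f (x + y) - f x) ^ 2)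
      = ∫⁻ ξ, ENNReal.ofReal (chordLength ⟪y, ξ⟫ ^ 2) ∂(spectralMeasure f) := by
  have h := lintegral_chordLength_pow hf.integrable hf.memLp_two y 1
  rw [mul_one] at h
  rw [h, eLpNorm_eq_lintegral_rpow_enorm_toReal (by norm_num) (by norm_num)]
  simp only [ENNReal.toReal_ofNat]
  rw [← ENNReal.rpow_natCast, ← ENNReal.rpow_mul]
  norm_num
  refine lintegral_congr fun x => ?_
  rw [fwdDiff, Real.enorm_eq_ofReal_abs, ← ENNReal.ofReal_pow (abs_nonneg _), sq_abs]

theorem integrable_shift_mul (hf : BoundedDensity f M) (y : E d) :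
    Integrable (fun x => f (x + y) * f x) volume := by
  have := hf.measurable
  exact hf.integrable.bdd_mul (c := M) (Measurable.aestronglyMeasurable (by fun_prop)) (Eventually.of_forall fun x => hf.abs_le _)

/-- The autocorrelation of `f` is the Fourier transform of its spectral measure. -/
theorem integral_shift_mul_sub (hf : BoundedDensity f M) (y : E d) :
    (∫ x, f (x + y) * f x) - ∫ x, f x * f x
      = ∫ ξ, (Real.cos (2 * Real.pi * ⟪y, ξ⟫) - 1) ∂(spectralMeasure f) := by
  have hm := hf.measurable
  have hc := continuous_chordLength
  have hsq : Integrable (fun x => f x * f x) volume := by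
    simpa using hf.integrable_shift_mul 0
  have hsqy : Integrable (fun x => f (x + y) * f (x + y)) volume := hsq.comp_add_right y
  have h1 : ∫ x, (f (x + y) - f x) ^ 2 = 2 * (∫ x, f x * f x) - 2 * ∫ x, f (x + y) * f x := by
    have e : ∀ x, (f (x + y) - f x) ^ 2
        = f (x + y) * f (x + y) + f x * f x - 2 * (f (x + y) * f x) := fun x => by ring
    simp_rw [e]
    rw [integral_sub (f := fun x => f (x + y) * f (x + y) + f x * f x) (hsqy.add hsq) ((hf.integrable_shift_mul y).const_mul 2),
      integral_add hsqy hsq, integral_const_mul,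
      integral_add_right_eq_self (fun x => f x * f x) y]
    ring
  have h2 : ∫ x, (f (x + y) - f x) ^ 2 = ∫ ξ, chordLength ⟪y, ξ⟫ ^ 2 ∂(spectralMeasure f) := by
    rw [integral_eq_lintegral_of_nonneg_ae (Eventually.of_forall fun x => sq_nonneg _)
      (by fun_prop), integral_eq_lintegral_of_nonneg_ae (Eventually.of_forall fun x => sq_nonneg _)
      (by fun_prop), hf.lintegral_shift_sub_sq]
  have h3 : ∫ ξ, (Real.cos (2 * Real.pi * ⟪y, ξ⟫) - 1) ∂(spectralMeasure f)
      = -(1 / 2) * ∫ ξ, chordLength ⟪y, ξ⟫ ^ 2 ∂(spectralMeasure f) := by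
    rw [← integral_const_mul]
    refine integral_congr_ae (Eventually.of_forall fun ξ => ?_)
    simp only [chordLength_sq]
    ring
  rw [h3, ← h2, h1]
  ring

variable {K : E d → ℝ} {P : ℝ}

theorem integrable_kernel_mul_shift (hf : BoundedDensity f M) (hK : Integrable K volume)
    (h : ℝ) (x : E d) : Integrable (fun u => K u * f (x + h • u)) volume := by
  have := hf.measurable
  exact hK.mul_bdd (c := M) (Measurable.aestronglyMeasurable (by fun_prop)) (Eventually.of_forall fun u => hf.abs_le _)

theorem measurable_smooth (hf : BoundedDensity f M) (hK : Measurable K) (h : ℝ) :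
    Measurable (smooth K h f) := by
  have := hf.measurable
  have hm : StronglyMeasurable (Function.uncurry fun (x u : E d) => K u * f (x + h • u)) :=
    Measurable.stronglyMeasurable (by simp only [Function.uncurry_def]; fun_prop)
  exact (StronglyMeasurable.integral_prod_right hm).measurable

theorem abs_smooth_le (hf : BoundedDensity f M) (hK : Integrable K volume) (h : ℝ) (x : E d) :
    |smooth K h f x| ≤ M * ∫ u, |K u| := by
  rw [smooth, ← Real.norm_eq_abs, ← integral_const_mul]
  refine norm_integral_le_of_norm_le (hK.abs.const_mul M) (Eventually.of_forall fun u => ?_)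
  rw [norm_mul, mul_comm]
  exact mul_le_mul_of_nonneg_right (hf.abs_le _) (abs_nonneg _)

theorem integral_mul_smooth (hf : BoundedDensity f M) (hK : Integrable K volume) (h : ℝ) :
    ∫ x, f x * smooth K h f x = ∫ u, K u * ∫ x, f (x + h • u) * f x := by
  have hm := hf.measurable
  have e1 : ∀ x, f x * smooth K h f x = ∫ u, f x * (K u * f (x + h • u)) := fun x => by
    rw [smooth, integral_const_mul]
  have e2 : ∀ u, K u * ∫ x, f (x + h • u) * f x = ∫ x, f x * (K u * f (x + h • u)) := fun u => by
    rw [← integral_const_mul]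
    refine integral_congr_ae (Eventually.of_forall fun x => ?_)
    simp only
    ring
  simp_rw [e1, e2]
  refine integral_integral_swap ?_
  refine ((hf.integrable.mul_prod hK).mul_bdd (c := M)
    (g := fun z : E d × E d => f (z.1 + h • z.2)) (Measurable.aestronglyMeasurable (by fun_prop))
    (Eventually.of_forall fun u => hf.abs_le _)).congr (Eventually.of_forall fun z => ?_)
  simp only [Function.uncurry]
  ring

/-- The bias of the smoothed average density. -/
theorem exists_bias_bound (hf : BoundedDensity f M) (hK : ConditionK K P) {s : ℝ} (hs : 0 < s)
    (hs2 : ∀ m : ℕ, 2 * s ≠ m) (hB : MemBesovTwoInfty s f) :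
    ∃ C : ℝ, 0 ≤ C ∧ ∀ h : ℝ, 0 < h →
      |(∫ x, f x * smooth K h f x) - ∫ x, f x * f x| ≤ C * h ^ (2 * expS P s) := by
  have hm := hf.measurable
  have hKi := hK.integrable_kernel
  have hKm := hK.measurable
  have hPpos := hK.order_pos
  obtain ⟨-, C, hC⟩ := hB
  set ν := spectralMeasure f with hνdef
  have : IsFiniteMeasure ν := isFiniteMeasure_spectralMeasure hf.integrable hf.memLp_two
  -- The Besov bound, squared and read through Plancherel: the spectral measure sees the exponent `2
  -- * s`.
  have hν : ChordMomentBound ν (2 * s) (C ^ 2) (2 * (⌊s⌋₊ + 1)) := by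
    intro y
    rw [hνdef, lintegral_chordLength_pow hf.integrable hf.memLp_two]
    refine (pow_le_pow_left' (hC y) 2).trans ?_
    have h0 : (0 : ℝ) ≤ |C| * ‖y‖ ^ s := by positivity
    refine (pow_le_pow_left' (ENNReal.ofReal_le_ofReal
      (mul_le_mul_of_nonneg_right (le_abs_self C) (by positivity))) 2).trans ?_
    rw [← ENNReal.ofReal_pow h0, mul_pow, sq_abs, ← Real.rpow_natCast (_ ^ s),
      ← Real.rpow_mul (norm_nonneg y), mul_comm s]
    simp
  set Q := 2 * expS P s with hQdef
  have hQmin : Q = min P (2 * s) := by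
    rw [hQdef, expS, mul_min_of_nonneg _ _ zero_le_two]
    congr 1; ring
  have hQ0 : 0 < Q := by rw [hQmin]; exact lt_min hPpos (by linarith)
  have hQP : Q ≤ P := by rw [hQmin]; exact min_le_left _ _
  -- The choice is `⌈Q⌉ - 1` and not `⌊Q⌋`: `m` must lie strictly below `Q ≤ P` even for integral
  -- `Q`, so that all moments of degree `1, …, m` vanish.
  obtain ⟨m, hm1, hm2⟩ : ∃ m : ℕ, (m : ℝ) < Q ∧ Q ≤ m + 1 := by
    have hpos : 0 < ⌈Q⌉₊ := Nat.ceil_pos.2 hQ0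
    refine ⟨⌈Q⌉₊ - 1, ?_, ?_⟩
    · exact Nat.lt_ceil.1 (by omega)
    · have := Nat.le_ceil Q
      have h2 : ((⌈Q⌉₊ - 1 : ℕ) : ℝ) + 1 = ⌈Q⌉₊ := by
        exact_mod_cast Nat.sub_add_cancel hpos
      linarith
  -- When `Q = 2 * s`, the upper bound `Q ≤ m + 1` has to be strict; this is where `2 * s` not being
  -- an integer enters.
  have hQα : Q < 2 * s ∨ Q = 2 * s ∧ Q < m + 1 := by
    rcases lt_or_ge P (2 * s) with h | h
    · left; rw [hQmin, min_eq_left h.le]; exact h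
    · right
      have : Q = 2 * s := by rw [hQmin, min_eq_right h]
      refine ⟨this, lt_of_le_of_ne hm2 fun h' => hs2 (m + 1) ?_⟩
      rw [← this, h']; push_cast; rfl
  have hpi : (1 : ℝ) ≤ 2 * Real.pi := by linarith [Real.pi_gt_three]
  obtain ⟨b, hb0, hb⟩ := exists_remainder_bound hν (sq_nonneg C) hm1 hm2 hQα
    (A := 3 * (2 * Real.pi) ^ (m + 1)) (by positivity) (cosRemainder m)
    (fun x => (abs_cosRemainder_le m x).trans (by
      have := pow_le_pow_right₀ hpi m.le_succ
      gcongr))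
    (fun x => (abs_cosRemainder_le_succ m x).trans (by
      have : 0 ≤ (2 * Real.pi) ^ (m + 1) * |x| ^ (m + 1) := by positivity
      linarith))
  refine ⟨b * ∫ u, |K u * ‖u‖ ^ Q|, by positivity, fun h hh => ?_⟩
  have hcos : ∀ t : ℝ, ‖Real.cos t - 1‖ ≤ 2 := fun t => by
    rw [Real.norm_eq_abs, _root_.abs_le]
    constructor <;> linarith [Real.neg_one_le_cos t, Real.cos_le_one t]
  have e1 : (∫ x, f x * smooth K h f x) - ∫ x, f x * f x
      = ∫ u, ∫ ξ, K u * (Real.cos (2 * Real.pi * ⟪h • u, ξ⟫) - 1) ∂ν := by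
    simp_rw [integral_const_mul, hνdef, ← hf.integral_shift_mul_sub, mul_sub]
    have hint : Integrable (fun u => K u * ∫ x, f (x + h • u) * f x) volume := by
      have hmm : StronglyMeasurable (Function.uncurry fun (u x : E d) => f (x + h • u) * f x) :=
        Measurable.stronglyMeasurable (by simp only [Function.uncurry_def]; fun_prop)
      refine hKi.mul_bdd (c := M) (StronglyMeasurable.integral_prod_right hmm).aestronglyMeasurable
        (Eventually.of_forall fun u => ?_)
      refine (norm_integral_le_of_norm_le (hf.integrable.const_mul M)
        (Eventually.of_forall fun x => ?_)).trans (le_of_eq ?_)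
      · rw [norm_mul, Real.norm_eq_abs, Real.norm_eq_abs, abs_of_nonneg (hf.nonneg x)]
        exact mul_le_mul_of_nonneg_right (hf.abs_le _) (hf.nonneg x)
      · rw [integral_const_mul, hf.integral_one, mul_one]
    rw [integral_sub hint (hKi.mul_const _), ← hf.integral_mul_smooth hKi, integral_mul_const,
      hK.integral_one, one_mul]
  have hprod : Integrable (Function.uncurry fun (u ξ : E d) =>
      K u * (Real.cos (2 * Real.pi * ⟪h • u, ξ⟫) - 1)) (volume.prod ν) := by
    refine (hKi.comp_fst ν).mul_bdd (c := 2)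
      (g := fun z : E d × E d => Real.cos (2 * Real.pi * ⟪h • z.1, z.2⟫) - 1) (by fun_prop)
      (Eventually.of_forall fun z => hcos _)
  -- For fixed `ξ` the integral over `u` is taken first, so that the moments remove the Taylor
  -- polynomial before absolute values appear. Tonelli's theorem swaps back afterwards.
  have e2 : (∫ x, f x * smooth K h f x) - ∫ x, f x * f x
      = ∫ ξ, (∫ u, K u * cosRemainder m ⟪h • u, ξ⟫) ∂ν := by
    rw [e1, integral_integral_swap hprod]
    exact integral_congr_ae (Eventually.of_forall fun ξ =>
      hK.integral_cos_sub_one ξ h (hm1.trans_le hQP))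
  have hcr := (continuous_cosRemainder m).measurable
  have hKQ := (hK.integrable_norm_rpow hQ0.le hQP).abs
  have key : ENNReal.ofReal |(∫ x, f x * smooth K h f x) - ∫ x, f x * f x|
      ≤ ENNReal.ofReal (b * (∫ u, |K u * ‖u‖ ^ Q|) * h ^ Q) := by
    rw [e2, ← Real.enorm_eq_ofReal_abs]
    calc ‖∫ ξ, (∫ u, K u * cosRemainder m ⟪h • u, ξ⟫) ∂ν‖ₑ
        ≤ ∫⁻ ξ, (∫⁻ u, ‖K u * cosRemainder m ⟪h • u, ξ⟫‖ₑ) ∂ν :=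
          (enorm_integral_le_lintegral_enorm _).trans
            (lintegral_mono fun ξ => enorm_integral_le_lintegral_enorm _)
      _ = ∫⁻ u, ∫⁻ ξ, ‖K u * cosRemainder m ⟪h • u, ξ⟫‖ₑ ∂ν := by
          refine lintegral_lintegral_swap (Measurable.aemeasurable ?_)
          simp only [Function.uncurry_def]
          fun_prop
      _ ≤ ∫⁻ u, ENNReal.ofReal (b * h ^ Q * |K u * ‖u‖ ^ Q|) := by
          refine lintegral_mono fun u => ?_
          simp only [enorm_mul]
          rw [lintegral_const_mul' _ _ (by simp)]
          simp only [Real.enorm_eq_ofReal_abs]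
          refine (mul_le_mul_right (hb (h • u)) _).trans ?_
          rw [← ENNReal.ofReal_mul (abs_nonneg _), norm_smul, Real.norm_of_nonneg hh.le,
            Real.mul_rpow hh.le (norm_nonneg _), abs_mul,
            abs_of_nonneg (show 0 ≤ ‖u‖ ^ Q by positivity)]
          exact ENNReal.ofReal_le_ofReal (le_of_eq (by ring))
      _ = ENNReal.ofReal (b * (∫ u, |K u * ‖u‖ ^ Q|) * h ^ Q) := by
          rw [← ofReal_integral_eq_lintegral_ofReal (hKQ.const_mul _)
            (Eventually.of_forall fun u => by positivity), integral_const_mul]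
          congr 1
          ring
  exact (ENNReal.ofReal_le_ofReal_iff (by positivity)).1 key

/-- This is continuity of translations in `L²`, seen on the Fourier side: the integrand is at most
`4`, the spectral measure is finite, and the chord vanishes at `y = 0`. -/
theorem tendsto_chord_sq_zero (hf : BoundedDensity f M) :
    Tendsto (fun y : E d => ∫⁻ ξ, ENNReal.ofReal (chordLength ⟪y, ξ⟫ ^ 2) ∂(spectralMeasure f))
      (𝓝 0) (𝓝 0) := by
  have hc := continuous_chordLength
  have : IsFiniteMeasure (spectralMeasure f) :=
    isFiniteMeasure_spectralMeasure hf.integrable hf.memLp_two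
  have h0 : ∫⁻ _ξ : E d, (0 : ℝ≥0∞) ∂(spectralMeasure f) = 0 := by simp
  rw [← h0]
  refine tendsto_lintegral_filter_of_dominated_convergence (fun _ => ENNReal.ofReal 4)
    (Eventually.of_forall fun y => by fun_prop)
    (Eventually.of_forall fun y => Eventually.of_forall fun ξ =>
      ENNReal.ofReal_le_ofReal (chordLength_sq_le _))
    (by rw [lintegral_const]; exact ENNReal.mul_ne_top (by simp) (measure_ne_top _ _))
    (Eventually.of_forall fun ξ => ?_)
  have hcont : Continuous fun y : E d => ENNReal.ofReal (chordLength ⟪y, ξ⟫ ^ 2) :=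
    ENNReal.continuous_ofReal.comp (by fun_prop)
  have := hcont.tendsto 0
  simpa [chordLength] using this

/-- Cauchy–Schwarz for the factors `a^(1/2)` and `a^(1/2) * b`. -/
theorem lintegral_mul_sq_le {α : Type*} [MeasurableSpace α] (μ : Measure α) {a b : α → ℝ≥0∞}
    (ha : Measurable a) (hb : Measurable b) :
    (∫⁻ x, a x * b x ∂μ) ^ 2 ≤ (∫⁻ x, a x ∂μ) * ∫⁻ x, a x * b x ^ 2 ∂μ := by
  have h := ENNReal.lintegral_mul_le_Lp_mul_Lq μ Real.HolderConjugate.two_two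
    (f := fun x => a x ^ (1 / 2 : ℝ)) (g := fun x => a x ^ (1 / 2 : ℝ) * b x)
    (by fun_prop) (by fun_prop)
  have e1 : ∀ x, a x ^ (1 / 2 : ℝ) * (a x ^ (1 / 2 : ℝ) * b x) = a x * b x := by
    intro x
    rw [← mul_assoc, ← ENNReal.rpow_add_of_nonneg _ _ (by norm_num) (by norm_num)]
    norm_num
  have e2 : ∀ x, (a x ^ (1 / 2 : ℝ)) ^ (2 : ℝ) = a x := by
    intro x
    rw [← ENNReal.rpow_mul]; norm_num
  have e3 : ∀ x, (a x ^ (1 / 2 : ℝ) * b x) ^ (2 : ℝ) = a x * b x ^ 2 := by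
    intro x
    rw [ENNReal.mul_rpow_of_nonneg _ _ (by norm_num), e2]; norm_num
  simp only [Pi.mul_apply, e1, e2, e3] at h
  refine (pow_le_pow_left' h 2).trans (le_of_eq ?_)
  rw [mul_pow, ← ENNReal.rpow_natCast, ← ENNReal.rpow_natCast, ← ENNReal.rpow_mul,
    ← ENNReal.rpow_mul]
  norm_num

/-- The kernel smoother converges in `L²` as the bandwidth vanishes. -/
theorem tendsto_lintegral_smooth_sub_sq (hf : BoundedDensity f M) (hKm : Measurable K)
    (hK : Integrable K volume) (hK1 : ∫ u, K u = 1) :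
    Tendsto (fun h : ℝ => ∫⁻ x, ENNReal.ofReal ((smooth K h f x - f x) ^ 2)) (𝓝 0) (𝓝 0) := by
  have hm := hf.measurable
  have hc := continuous_chordLength
  have hKfin : ∫⁻ u, ‖K u‖ₑ ≠ ∞ := hK.2.ne
  set ω : E d → ℝ≥0∞ :=
    fun y => ∫⁻ ξ, ENNReal.ofReal (chordLength ⟪y, ξ⟫ ^ 2) ∂(spectralMeasure f) with hω
  have hfin : IsFiniteMeasure (spectralMeasure f) :=
    isFiniteMeasure_spectralMeasure hf.integrable hf.memLp_two
  have hωm : Measurable ω := by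
    refine Measurable.lintegral_prod_right' (f := fun z : E d × E d =>
      ENNReal.ofReal (chordLength ⟪z.1, z.2⟫ ^ 2)) (by fun_prop)
  have hωle : ∀ y, ω y ≤ ENNReal.ofReal 4 * spectralMeasure f Set.univ := by
    intro y
    rw [← lintegral_const]
    exact lintegral_mono fun ξ => ENNReal.ofReal_le_ofReal (chordLength_sq_le _)
  -- Cauchy–Schwarz with weight `|K u|`, then Tonelli: the squared smoothing error is at most an
  -- average of squared translation errors at the shifts `h • u`.
  have hbound : ∀ h : ℝ, ∫⁻ x, ENNReal.ofReal ((smooth K h f x - f x) ^ 2)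
      ≤ (∫⁻ u, ‖K u‖ₑ) * ∫⁻ u, ‖K u‖ₑ * ω (h • u) := by
    intro h
    have hpt : ∀ x, ENNReal.ofReal ((smooth K h f x - f x) ^ 2)
        ≤ (∫⁻ u, ‖K u‖ₑ) * ∫⁻ u, ‖K u‖ₑ * ENNReal.ofReal ((f (x + h • u) - f x) ^ 2) := by
      intro x
      have e : smooth K h f x - f x = ∫ u, K u * (f (x + h • u) - f x) := by
        simp_rw [mul_sub]
        rw [integral_sub (hf.integrable_kernel_mul_shift hK h x) (hK.mul_const _),
          integral_mul_const, hK1, one_mul, smooth]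
      have e2 : ∀ r : ℝ, ENNReal.ofReal (r ^ 2) = ‖r‖ₑ ^ 2 := fun r => by
        rw [Real.enorm_eq_ofReal_abs, ← ENNReal.ofReal_pow (abs_nonneg _), sq_abs]
      rw [e]
      simp only [e2]
      refine le_trans (pow_le_pow_left' (enorm_integral_le_lintegral_enorm _) 2) ?_
      simp only [enorm_mul]
      exact lintegral_mul_sq_le _ (by fun_prop) (by fun_prop)
    refine (lintegral_mono hpt).trans (le_of_eq ?_)
    rw [lintegral_const_mul' _ _ hKfin, lintegral_lintegral_swap]
    · congr 1
      refine lintegral_congr fun u => ?_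
      rw [lintegral_const_mul' _ _ (by simp), hf.lintegral_shift_sub_sq]
    · refine Measurable.aemeasurable ?_
      simp only [Function.uncurry_def]
      fun_prop
  have hlim : Tendsto (fun h : ℝ => ∫⁻ u, ‖K u‖ₑ * ω (h • u)) (𝓝 0) (𝓝 0) := by
    have h0 : ∫⁻ _u : E d, (0 : ℝ≥0∞) = 0 := by simp
    rw [← h0]
    refine tendsto_lintegral_filter_of_dominated_convergence
      (fun u => ‖K u‖ₑ * (ENNReal.ofReal 4 * spectralMeasure f Set.univ))
      (Eventually.of_forall fun y => by fun_prop)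
      (Eventually.of_forall fun h => Eventually.of_forall fun u =>
        mul_le_mul_right (hωle _) _)
      (by
        rw [lintegral_mul_const' _ _ (ENNReal.mul_ne_top (by simp) (measure_ne_top _ _))]
        exact ENNReal.mul_ne_top hKfin (ENNReal.mul_ne_top (by simp) (measure_ne_top _ _)))
      (Eventually.of_forall fun u => ?_)
    have h1 : Tendsto (fun h : ℝ => h • u) (𝓝 0) (𝓝 0) := by
      have : Continuous fun h : ℝ => h • u := by fun_prop
      simpa using this.tendsto 0
    have h2 := (hf.tendsto_chord_sq_zero).comp h1
    simpa using ENNReal.Tendsto.const_mul (a := ‖K u‖ₑ) h2 (Or.inr (by simp))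
  have hlim2 : Tendsto (fun h : ℝ => (∫⁻ u, ‖K u‖ₑ) * ∫⁻ u, ‖K u‖ₑ * ω (h • u)) (𝓝 0) (𝓝 0) := by
    simpa using ENNReal.Tendsto.const_mul (a := ∫⁻ u, ‖K u‖ₑ) hlim (Or.inr hKfin)
  exact tendsto_of_tendsto_of_tendsto_of_le_of_le tendsto_const_nhds hlim2 (fun _ => zero_le)
    hbound

end BoundedDensity

end AvgDensity

namespace AvgDensity

variable {d : ℕ}

/-! ### A uniform central limit theorem -/

/-- Telescoping in the unit disc; it reduces the comparison of characteristic functions of sums to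
that of a single factor. -/
theorem norm_pow_sub_pow_le {z w : ℂ} (hz : ‖z‖ ≤ 1) (hw : ‖w‖ ≤ 1) (n : ℕ) :
    ‖z ^ n - w ^ n‖ ≤ n * ‖z - w‖ := by
  induction n with
  | zero => simp
  | succ n ih =>
    have e : z ^ (n + 1) - w ^ (n + 1) = z * (z ^ n - w ^ n) + (z - w) * w ^ n := by ring
    rw [e]
    refine (norm_add_le _ _).trans ?_
    rw [norm_mul, norm_mul, norm_pow]
    have h1 : ‖z‖ * ‖z ^ n - w ^ n‖ ≤ ‖z ^ n - w ^ n‖ :=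
      mul_le_of_le_one_left (norm_nonneg _) hz
    have h2 : ‖z - w‖ * ‖w‖ ^ n ≤ ‖z - w‖ :=
      mul_le_of_le_one_right (norm_nonneg _) (pow_le_one₀ (norm_nonneg _) hw)
    push_cast
    linarith

/-- Centring removes the linear term, and the cubic remainder is controlled by the bound `M` alone.
Boundedness thus plays the part of Lindeberg's condition, uniformly in the law. -/
theorem norm_charFun_taylor_le {α : Type*} [MeasurableSpace α] {G : Measure α}
    [IsProbabilityMeasure G] {q : α → ℝ} {M : ℝ} (hq : Measurable q) (hM : ∀ x, |q x| ≤ M)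
    (h0 : ∫ x, q x ∂G = 0) (s : ℝ) :
    ‖(∫ x, Complex.exp ((s * q x : ℝ) * Complex.I) ∂G) - (1 - s ^ 2 / 2 * ∫ x, q x ^ 2 ∂G : ℝ)‖
      ≤ |s| ^ 3 * M ^ 3 := by
  have hqi : Integrable q G := Integrable.of_bound hq.aestronglyMeasurable M
    (Eventually.of_forall hM)
  have hq2 : Integrable (fun x => q x ^ 2) G := by
    refine Integrable.of_bound (by fun_prop) (M ^ 2) (Eventually.of_forall fun x => ?_)
    rw [Real.norm_eq_abs, abs_pow]
    exact pow_le_pow_left₀ (abs_nonneg _) (hM x) 2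
  have hexp : Integrable (fun x => Complex.exp ((s * q x : ℝ) * Complex.I)) G := by
    refine Integrable.of_bound (by fun_prop) 1 (Eventually.of_forall fun x => ?_)
    rw [Complex.norm_exp_ofReal_mul_I]
  have e1 : ((1 - s ^ 2 / 2 * ∫ x, q x ^ 2 ∂G : ℝ) : ℂ)
      = ∫ x, (∑ j ∈ Finset.range 3, ((s * q x : ℝ) * Complex.I) ^ j / (j.factorial : ℂ)) ∂G := by
    have e2 : ∀ x, (∑ j ∈ Finset.range 3, ((s * q x : ℝ) * Complex.I) ^ j / (j.factorial : ℂ))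
        = ((1 - s ^ 2 / 2 * q x ^ 2 : ℝ) : ℂ) + ((s * q x : ℝ) : ℂ) * Complex.I := by
      intro x
      simp only [Finset.sum_range_succ, Finset.range_zero, Finset.sum_empty, Nat.factorial]
      push_cast
      rw [mul_pow _ Complex.I 2, Complex.I_sq]
      ring
    simp_rw [e2]
    rw [integral_add (((integrable_const _).sub (hq2.const_mul _)).ofReal)
      (((hqi.const_mul _).ofReal).mul_const _), integral_mul_const, integral_complex_ofReal,
      integral_complex_ofReal, integral_const_mul, h0, integral_sub (integrable_const _)
      (hq2.const_mul _), integral_const_mul]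
    simp
  have hsum : Integrable (fun x => ∑ j ∈ Finset.range 3,
      ((s * q x : ℝ) * Complex.I) ^ j / (j.factorial : ℂ)) G := by
    refine integrable_finsetSum _ fun j _ => ?_
    refine Integrable.of_bound (by fun_prop) ((|s| * M) ^ j) (Eventually.of_forall fun x => ?_)
    rw [norm_div, norm_pow, norm_mul, Complex.norm_I, mul_one, Complex.norm_real,
      Real.norm_eq_abs, Complex.norm_natCast, abs_mul]
    refine (div_le_self (by positivity) (by exact_mod_cast j.factorial_pos)).trans ?_
    exact pow_le_pow_left₀ (by positivity) (mul_le_mul_of_nonneg_left (hM x) (abs_nonneg _)) j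
  rw [e1, ← integral_sub hexp hsum]
  refine (norm_integral_le_of_norm_le_const (C := |s| ^ 3 * M ^ 3)
    (Eventually.of_forall fun x => ?_)).trans (by simp)
  refine ((norm_exp_mul_I_sub_sum_le 3 (s * q x)).2 (by norm_num)).trans ?_
  rw [abs_mul, mul_pow]
  gcongr
  exact hM x

/-- The normalized sum of `n` independent draws of `q`. -/
noncomputable def normSum {α : Type*} (q : α → ℝ) {n : ℕ} (x : Fin n → α) : ℝ :=
  (√(n : ℝ))⁻¹ * ∑ i, q (x i)

theorem measurable_normSum {α : Type*} [MeasurableSpace α] {q : α → ℝ} (hq : Measurable q)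
    {n : ℕ} : Measurable (normSum q : (Fin n → α) → ℝ) := by
  unfold normSum
  fun_prop

theorem charFun_map_normSum {α : Type*} [MeasurableSpace α] {G : Measure α}
    [IsProbabilityMeasure G] {q : α → ℝ} (hq : Measurable q) (n : ℕ) (t : ℝ) :
    charFun ((Measure.pi fun _ : Fin n => G).map (normSum q)) t
      = (∫ x, Complex.exp ((t * (√(n : ℝ))⁻¹ * q x : ℝ) * Complex.I) ∂G) ^ n := by
  rw [charFun_apply_real, integral_map (measurable_normSum hq).aemeasurable (by fun_prop)]
  have h := integral_fintype_prod_eq_pow (ι := Fin n) (μ := G)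
    (fun x => Complex.exp ((t * (√(n : ℝ))⁻¹ * q x : ℝ) * Complex.I))
  rw [Fintype.card_fin] at h
  rw [← h]
  refine integral_congr_ae (Eventually.of_forall fun x => ?_)
  simp only [← Complex.exp_sum, normSum]
  congr 1
  push_cast
  rw [Finset.mul_sum, Finset.mul_sum, Finset.sum_mul]
  exact Finset.sum_congr rfl fun i _ => by ring

/-- The central limit theorem for triangular arrays of bounded, row-wise i.i.d. variables. -/
theorem tendsto_charFun_normSum {α : ℕ → Type*} [∀ m, MeasurableSpace (α m)]
    (G : ∀ m, Measure (α m)) [∀ m, IsProbabilityMeasure (G m)] (q : ∀ m, α m → ℝ) (n : ℕ → ℕ)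
    {M v : ℝ} (hv : 0 ≤ v) (hn : Tendsto n atTop atTop) (hq : ∀ m, Measurable (q m))
    (hM : ∀ m x, |q m x| ≤ M) (h0 : ∀ m, ∫ x, q m x ∂(G m) = 0)
    (hvar : Tendsto (fun m => ∫ x, q m x ^ 2 ∂(G m)) atTop (𝓝 v)) (t : ℝ) :
    Tendsto (fun m => charFun ((Measure.pi fun _ : Fin (n m) => G m).map (normSum (q m))) t) atTop
      (𝓝 (Complex.exp ((-(v * t ^ 2 / 2) : ℝ)))) := by
  simp_rw [charFun_map_normSum (hq _)]
  rw [tendsto_iff_norm_sub_tendsto_zero]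
  have hnR : Tendsto (fun m => (n m : ℝ)) atTop atTop := tendsto_natCast_atTop_atTop.comp hn
  have hns : Tendsto (fun m => (√(n m : ℝ))⁻¹) atTop (𝓝 0) :=
    tendsto_inv_atTop_zero.comp (Real.tendsto_sqrt_atTop.comp hnR)
  have hni : Tendsto (fun m => ((n m : ℝ))⁻¹) atTop (𝓝 0) := tendsto_inv_atTop_zero.comp hnR
  have hlim : Tendsto (fun m => |t| ^ 3 * M ^ 3 * (√(n m : ℝ))⁻¹ +
      t ^ 2 / 2 * |(∫ x, q m x ^ 2 ∂(G m)) - v| + (v * t ^ 2 / 2) ^ 2 * (n m : ℝ)⁻¹)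
      atTop (𝓝 0) := by
    have h1 : Tendsto (fun m => |(∫ x, q m x ^ 2 ∂(G m)) - v|) atTop (𝓝 0) := by
      simpa using (hvar.sub_const v).abs
    simpa using ((hns.const_mul (|t| ^ 3 * M ^ 3)).add (h1.const_mul (t ^ 2 / 2))).add
      (hni.const_mul ((v * t ^ 2 / 2) ^ 2))
  refine squeeze_zero' (Eventually.of_forall fun m => norm_nonneg _) ?_ hlim
  filter_upwards [hnR.eventually_ge_atTop (max 1 (v * t ^ 2 / 2))] with m hm
  have hm1 : (1 : ℝ) ≤ n m := (le_max_left _ _).trans hm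
  have hm2 : v * t ^ 2 / 2 ≤ n m := (le_max_right _ _).trans hm
  have hm0 : (0 : ℝ) < n m := by linarith
  set V := ∫ x, q m x ^ 2 ∂(G m) with hV
  set s := t * (√(n m : ℝ))⁻¹ with hs
  set y := v * t ^ 2 / 2 / n m with hy
  have hy0 : 0 ≤ y := by positivity
  have hy1 : y ≤ 1 := (div_le_one hm0).2 hm2
  have hs2 : s ^ 2 = t ^ 2 / n m := by
    rw [hs, mul_pow, inv_pow, Real.sq_sqrt hm0.le]; rfl
  -- The Gaussian limit is written as an `n m`-th power too, so that only the bases need comparison;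
  -- each contributes an error `o(1/n)`.
  have hw : Complex.exp ((-(v * t ^ 2 / 2) : ℝ)) = ((Real.exp (-y) : ℝ) : ℂ) ^ n m := by
    rw [Complex.ofReal_exp, ← Complex.exp_nat_mul]
    congr 1
    rw [hy]
    push_cast
    have : (n m : ℂ) ≠ 0 := by exact_mod_cast hm0.ne'
    field_simp
  set z := ∫ x, Complex.exp ((s * q m x : ℝ) * Complex.I) ∂(G m) with hz
  have hz1 : ‖z‖ ≤ 1 := by
    refine (norm_integral_le_of_norm_le_const (C := 1) (Eventually.of_forall fun x => ?_)).trans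
      (by simp)
    rw [Complex.norm_exp_ofReal_mul_I]
  have hw1 : ‖((Real.exp (-y) : ℝ) : ℂ)‖ ≤ 1 := by
    rw [Complex.norm_real, Real.norm_of_nonneg (Real.exp_pos _).le]
    exact Real.exp_le_one_iff.2 (by linarith)
  rw [hw]
  refine (norm_pow_sub_pow_le hz1 hw1 _).trans ?_
  have t1 := norm_charFun_taylor_le (hq m) (hM m) (h0 m) s
  rw [← hz, ← hV] at t1
  have t2 := Real.abs_exp_sub_one_sub_id_le (x := -y) (by rw [abs_neg, abs_of_nonneg hy0]; exact hy1)
  have t3 : ‖z - ((Real.exp (-y) : ℝ) : ℂ)‖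
      ≤ |s| ^ 3 * M ^ 3 + |(1 - s ^ 2 / 2 * V) - (1 - y)| + y ^ 2 := by
    have e : z - ((Real.exp (-y) : ℝ) : ℂ) = (z - (1 - s ^ 2 / 2 * V : ℝ)) +
        (((1 - s ^ 2 / 2 * V) - (1 - y) : ℝ) : ℂ) - ((Real.exp (-y) - 1 - -y : ℝ) : ℂ) := by
      push_cast; ring
    rw [e]
    refine (norm_sub_le _ _).trans (add_le_add ((norm_add_le _ _).trans (add_le_add t1 ?_)) ?_)
    · rw [Complex.norm_real, Real.norm_eq_abs]
    · rw [Complex.norm_real, Real.norm_eq_abs]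
      simpa using t2
  refine (mul_le_mul_of_nonneg_left t3 hm0.le).trans (le_of_eq ?_)
  have e1 : (n m : ℝ) * |s| ^ 3 = |t| ^ 3 * (√(n m : ℝ))⁻¹ := by
    have : |s| ^ 3 = |t| ^ 3 * ((√(n m : ℝ))⁻¹ ^ 2 * (√(n m : ℝ))⁻¹) := by
      rw [hs, abs_mul, abs_of_nonneg (inv_nonneg.2 (Real.sqrt_nonneg _)), mul_pow]; ring
    rw [this, inv_pow, Real.sq_sqrt hm0.le]
    field_simp
  have e2 : (n m : ℝ) * |(1 - s ^ 2 / 2 * V) - (1 - y)| = t ^ 2 / 2 * |V - v| := by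
    have : (1 - s ^ 2 / 2 * V) - (1 - y) = -(t ^ 2 / 2 / n m * (V - v)) := by
      rw [hs2, hy]; field_simp; ring
    rw [this, abs_neg, abs_mul, abs_of_nonneg (by positivity)]
    field_simp
  have e3 : (n m : ℝ) * y ^ 2 = (v * t ^ 2 / 2) ^ 2 * (n m : ℝ)⁻¹ := by
    rw [hy]; field_simp
  rw [mul_add, mul_add, e2, e3, ← mul_assoc, e1]
  ring

/-! ### Distribution functions -/

/-- The distribution function of the centred normal law with variance `v`. -/
noncomputable def normalCdf (v t : ℝ) : ℝ := (gaussianReal 0 v.toNNReal).real (Set.Iic t)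

theorem normalCdf_mono (v : ℝ) : Monotone (normalCdf v) := fun _ _ h =>
  measureReal_mono (Set.Iic_subset_Iic.2 h)

/-- The constant is the maximum of the normal density. -/
theorem normalCdf_sub_le {v : ℝ} (hv : 0 < v) {a b : ℝ} (hab : a ≤ b) :
    normalCdf v b - normalCdf v a ≤ (√(2 * Real.pi * v))⁻¹ * (b - a) := by
  have hv' : v.toNNReal ≠ 0 := by simpa using hv
  have h1 : normalCdf v b - normalCdf v a = (gaussianReal 0 v.toNNReal).real (Set.Ioc a b) := by
    rw [normalCdf, normalCdf, ← Set.Iic_sdiff_Iic,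
      measureReal_sdiff (Set.Iic_subset_Iic.2 hab) measurableSet_Iic]
  rw [h1, Measure.real, gaussianReal_apply _ hv']
  refine ENNReal.toReal_le_of_le_ofReal (mul_nonneg (by positivity) (by linarith)) ?_
  calc ∫⁻ x in Set.Ioc a b, gaussianPDF 0 v.toNNReal x
      ≤ ∫⁻ _ in Set.Ioc a b, ENNReal.ofReal (√(2 * Real.pi * v))⁻¹ := by
        refine lintegral_mono fun x => ENNReal.ofReal_le_ofReal ?_
        rw [gaussianPDFReal_def, Real.coe_toNNReal _ hv.le]
        refine mul_le_of_le_one_right (by positivity) (Real.exp_le_one_iff.2 ?_)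
        exact div_nonpos_of_nonpos_of_nonneg (by nlinarith [sq_nonneg (x - 0)]) (by positivity)
    _ = _ := by
        rw [lintegral_const, Measure.restrict_apply_univ, Real.volume_Ioc,
          ← ENNReal.ofReal_mul (by positivity)]

/-- Pólya's theorem for the normal distribution. -/
theorem eventually_forall_abs_sub_normalCdf_le {v : ℝ} (hv : 0 < v) {μ : ℕ → ProbabilityMeasure ℝ}
    {μ₀ : ProbabilityMeasure ℝ} (h₀ : (μ₀ : Measure ℝ) = gaussianReal 0 v.toNNReal)
    (hμ : Tendsto μ atTop (𝓝 μ₀)) {ε : ℝ} (hε : 0 < ε) :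
    ∀ᶠ m in atTop, ∀ t, |(μ m : Measure ℝ).real (Set.Iic t) - normalCdf v t| ≤ ε := by
  have hv' : v.toNNReal ≠ 0 := by simpa using hv
  have hpt : ∀ t, Tendsto (fun m => (μ m : Measure ℝ).real (Set.Iic t)) atTop
      (𝓝 (normalCdf v t)) := by
    intro t
    have hfr : (μ₀ : Measure ℝ) (frontier (Set.Iic t)) = 0 := by
      rw [h₀, frontier_Iic]
      have := nullSingletonClass_gaussianReal (μ := 0) hv'
      exact measure_singleton t
    have := ProbabilityMeasure.tendsto_measure_of_null_frontier_of_tendsto' hμ hfr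
    have h2 := (ENNReal.tendsto_toReal (measure_ne_top _ _)).comp this
    rw [h₀] at h2
    exact h2
  set L := (√(2 * Real.pi * v))⁻¹ with hL
  have hL0 : 0 < L := by positivity
  obtain ⟨a, ha⟩ : ∃ a, normalCdf v a ≤ ε / 4 := by
    have h1 := tendsto_cdf_atBot (gaussianReal 0 v.toNNReal)
    obtain ⟨a, ha⟩ := (h1.eventually_le_const (show (0 : ℝ) < ε / 4 by linarith)).exists
    exact ⟨a, by rwa [cdf_eq_real] at ha⟩
  obtain ⟨b, hab, hb⟩ : ∃ b, a ≤ b ∧ 1 - ε / 4 ≤ normalCdf v b := by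
    have h1 := tendsto_cdf_atTop (gaussianReal 0 v.toNNReal)
    obtain ⟨b, hb, hab⟩ := ((h1.eventually_const_le (show 1 - ε / 4 < 1 by linarith)).and
      (eventually_ge_atTop a)).exists
    exact ⟨b, hab, by rwa [cdf_eq_real] at hb⟩
  -- On a grid of mesh `δ` the limit rises by at most `ε/4` per cell. Agreement up to `ε/4` at the
  -- finitely many grid points and monotonicity control every `t`; below `a` and above `b` the limit
  -- is within `ε/4` of `0` and `1`.
  set δ := ε / (4 * L) with hδ
  have hδ0 : 0 < δ := by positivity
  have hLδ : L * δ = ε / 4 := by rw [hδ]; field_simp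
  set N := ⌈(b - a) / δ⌉₊ with hN
  have hgrid : ∀ᶠ m in atTop, ∀ j ∈ Finset.range (N + 2),
      |(μ m : Measure ℝ).real (Set.Iic (a + j * δ)) - normalCdf v (a + j * δ)| ≤ ε / 4 := by
    rw [Finset.eventually_all]
    intro j _
    have := ((hpt (a + j * δ)).sub_const (normalCdf v (a + j * δ))).abs
    rw [sub_self, abs_zero] at this
    exact this.eventually_le_const (by linarith)
  filter_upwards [hgrid] with m hm t
  have hFmono : Monotone fun t => (μ m : Measure ℝ).real (Set.Iic t) := fun _ _ h =>
    measureReal_mono (Set.Iic_subset_Iic.2 h)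
  have hF0 : ∀ t, 0 ≤ (μ m : Measure ℝ).real (Set.Iic t) := fun t => measureReal_nonneg
  have hF1 : ∀ t, (μ m : Measure ℝ).real (Set.Iic t) ≤ 1 := fun t => measureReal_le_one
  have hΦ0 : 0 ≤ normalCdf v t := measureReal_nonneg
  have hΦ1 : normalCdf v t ≤ 1 := measureReal_le_one
  have hm0 := abs_le.1 (hm 0 (by simp))
  simp only [Nat.cast_zero, zero_mul, add_zero] at hm0
  rcases lt_or_ge t a with hta | hta
  · have h1 : (μ m : Measure ℝ).real (Set.Iic t) ≤ (μ m : Measure ℝ).real (Set.Iic a) :=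
      hFmono hta.le
    have h2 := normalCdf_mono v hta.le
    rw [abs_le]
    constructor <;> linarith [hF0 t]
  rcases le_or_gt (a + N * δ) t with htb | htb
  · have hbN : b ≤ a + N * δ := by
      have := Nat.le_ceil ((b - a) / δ)
      rw [div_le_iff₀ hδ0] at this
      linarith
    have h1 : (μ m : Measure ℝ).real (Set.Iic (a + N * δ)) ≤ (μ m : Measure ℝ).real (Set.Iic t) :=
      hFmono htb
    have h2 := normalCdf_mono v hbN
    have h3 := normalCdf_mono v htb
    have h4 := abs_le.1 (hm N (by simp))
    rw [abs_le]
    constructor <;> linarith [hF1 t]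
  · set j := ⌊(t - a) / δ⌋₊ with hj
    have hta' : 0 ≤ (t - a) / δ := div_nonneg (by linarith) hδ0.le
    have hj1 : a + j * δ ≤ t := by
      have := Nat.floor_le hta'
      rw [le_div_iff₀ hδ0] at this
      linarith
    have hj2 : t ≤ a + (j + 1 : ℕ) * δ := by
      have := (Nat.lt_floor_add_one ((t - a) / δ)).le
      rw [div_le_iff₀ hδ0] at this
      push_cast
      linarith
    have hjN : j < N := by
      have h1 : a + j * δ < a + N * δ := lt_of_le_of_lt hj1 htb
      have h2 : (j : ℝ) < N := lt_of_mul_lt_mul_right (by linarith) hδ0.le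
      exact_mod_cast h2
    have g1 := abs_le.1 (hm j (by simp; omega))
    have g2 := abs_le.1 (hm (j + 1) (by simp; omega))
    have l1 := normalCdf_sub_le hv hj1
    have l2 := normalCdf_sub_le hv hj2
    have m1 : (μ m : Measure ℝ).real (Set.Iic (a + j * δ)) ≤ (μ m : Measure ℝ).real (Set.Iic t) :=
      hFmono hj1
    have m2 : (μ m : Measure ℝ).real (Set.Iic t)
      ≤ (μ m : Measure ℝ).real (Set.Iic (a + (j + 1 : ℕ) * δ)) := hFmono hj2
    have d1 : L * (t - (a + j * δ)) ≤ L * δ := by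
      refine mul_le_mul_of_nonneg_left ?_ hL0.le
      push_cast at hj2
      linarith
    have d2 : L * (a + (j + 1 : ℕ) * δ - t) ≤ L * δ := by
      refine mul_le_mul_of_nonneg_left ?_ hL0.le
      push_cast
      linarith
    rw [abs_le]
    constructor <;> linarith

/-- The central limit theorem in Kolmogorov distance, uniformly over the laws of bounded variables
with variance close to `v`. -/
theorem exists_uniform_clt {v : ℝ} (hv : 0 < v) (M : ℝ) {ε : ℝ} (hε : 0 < ε) :
    ∃ δ > 0, ∃ N : ℕ, ∀ n ≥ N, ∀ (G : Measure (E d)) (q : E d → ℝ), IsProbabilityMeasure G →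
      Measurable q → (∀ x, |q x| ≤ M) → ∫ x, q x ∂G = 0 → |(∫ x, q x ^ 2 ∂G) - v| < δ →
      ∀ t, |(Measure.pi fun _ : Fin n => G).real {x | normSum q x ≤ t} - normalCdf v t| ≤ ε := by
  -- Failure for every `δ = 1/(m+1)` and `N = m` produces a triangular array whose variances tend to
  -- `v`, and this contradicts the central limit theorem together with Pólya's theorem.
  by_contra! H
  choose n hn G q hG hq hM h0 hvar t ht using fun m : ℕ =>
    H (1 / ((m : ℝ) + 1)) (by positivity) m
  have hvar' : Tendsto (fun m => ∫ x, q m x ^ 2 ∂(G m)) atTop (𝓝 v) := by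
    rw [tendsto_iff_norm_sub_tendsto_zero]
    exact squeeze_zero (fun m => norm_nonneg _) (fun m => (hvar m).le)
      tendsto_one_div_add_atTop_nhds_zero_nat
  have hntop : Tendsto n atTop atTop := tendsto_atTop_mono hn tendsto_id
  have hchar := tendsto_charFun_normSum G q n hv.le hntop hq hM h0 hvar'
  have hprob : ∀ m, IsProbabilityMeasure
      ((Measure.pi fun _ : Fin (n m) => G m).map (normSum (q m))) := fun m =>
    Measure.isProbabilityMeasure_map (measurable_normSum (hq m)).aemeasurable
  set μ : ℕ → ProbabilityMeasure ℝ := fun m =>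
    ⟨(Measure.pi fun _ : Fin (n m) => G m).map (normSum (q m)), hprob m⟩ with hμ
  set μ₀ : ProbabilityMeasure ℝ := ⟨gaussianReal 0 v.toNNReal, inferInstance⟩ with hμ₀
  have hconv : Tendsto μ atTop (𝓝 μ₀) := by
    refine ProbabilityMeasure.tendsto_of_tendsto_charFun fun t => ?_
    have : charFun (μ₀ : Measure ℝ) t = Complex.exp ((-(v * t ^ 2 / 2) : ℝ)) := by
      rw [hμ₀]
      change charFun (gaussianReal 0 v.toNNReal) t = _
      rw [charFun_gaussianReal, Real.coe_toNNReal _ hv.le]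
      push_cast
      congr 1
      ring
    rw [this]
    exact hchar t
  obtain ⟨m, hm⟩ := (eventually_forall_abs_sub_normalCdf_le hv (μ₀ := μ₀) rfl hconv hε).exists
  have h1 := hm (t m)
  have h2 := ht m
  have e : (μ m : Measure ℝ).real (Set.Iic (t m))
      = (Measure.pi fun _ : Fin (n m) => G m).real {x | normSum (q m) x ≤ t m} := by
    rw [hμ]
    change ((Measure.pi fun _ : Fin (n m) => G m).map (normSum (q m))).real (Set.Iic (t m)) = _
    rw [map_measureReal_apply (measurable_normSum (hq m)) measurableSet_Iic]
    rfl
  rw [e] at h1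
  linarith

/-- A perturbation of size at most `δ` outside an event of probability at most `p` moves a
distribution function little. -/
theorem abs_measureReal_le_sub_normalCdf_le {α : Type*} [MeasurableSpace α] {Q : Measure α}
    [IsProbabilityMeasure Q] {v : ℝ} (hv : 0 < v) {Z W : α → ℝ} {D p δ : ℝ} (hδ : 0 ≤ δ)
    (hD : ∀ t, |Q.real {x | W x ≤ t} - normalCdf v t| ≤ D)
    (hp : Q.real {x | δ < |Z x - W x|} ≤ p) (t : ℝ) :
    |Q.real {x | Z x ≤ t} - normalCdf v t| ≤ D + p + (√(2 * Real.pi * v))⁻¹ * δ := by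
  have h1 : Q.real {x | Z x ≤ t} ≤ Q.real {x | W x ≤ t + δ} + Q.real {x | δ < |Z x - W x|} := by
    refine (measureReal_mono fun x hx => ?_).trans (measureReal_union_le _ _)
    by_cases hc : δ < |Z x - W x|
    · exact Or.inr hc
    · left
      have := (abs_le.1 (not_lt.1 hc)).1
      simp only [Set.mem_ofPred_eq] at hx ⊢
      linarith
  have h2 : Q.real {x | W x ≤ t - δ} ≤ Q.real {x | Z x ≤ t} + Q.real {x | δ < |Z x - W x|} := by
    refine (measureReal_mono fun x hx => ?_).trans (measureReal_union_le _ _)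
    by_cases hc : δ < |Z x - W x|
    · exact Or.inr hc
    · left
      have := (abs_le.1 (not_lt.1 hc)).2
      simp only [Set.mem_ofPred_eq] at hx ⊢
      linarith
  have d1 := abs_le.1 (hD (t + δ))
  have d2 := abs_le.1 (hD (t - δ))
  have l1 := normalCdf_sub_le hv (show t ≤ t + δ by linarith)
  have l2 := normalCdf_sub_le hv (show t - δ ≤ t by linarith)
  rw [add_sub_cancel_left] at l1
  rw [sub_sub_cancel] at l2
  rw [abs_le]
  constructor <;> linarith

end AvgDensity

namespace AvgDensity

/-! ### Bounded measurable functions -/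

/-- Bounded measurable functions. -/
structure BddMeas {β : Type*} [MeasurableSpace β] (Φ : β → ℝ) : Prop where
  measurable : Measurable Φ
  bounded : ∃ B : ℝ, ∀ x, |Φ x| ≤ B

namespace BddMeas

variable {β γ : Type*} [MeasurableSpace β] [MeasurableSpace γ] {Φ Ψ : β → ℝ}

theorem const (c : ℝ) : BddMeas fun _ : β => c := ⟨measurable_const, |c|, fun _ => le_rfl⟩

theorem add (h₁ : BddMeas Φ) (h₂ : BddMeas Ψ) : BddMeas fun x => Φ x + Ψ x := by
  obtain ⟨m₁, B₁, b₁⟩ := h₁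
  obtain ⟨m₂, B₂, b₂⟩ := h₂
  exact ⟨m₁.add m₂, B₁ + B₂, fun x => (abs_add_le _ _).trans (add_le_add (b₁ x) (b₂ x))⟩

theorem mul (h₁ : BddMeas Φ) (h₂ : BddMeas Ψ) : BddMeas fun x => Φ x * Ψ x := by
  obtain ⟨m₁, B₁, b₁⟩ := h₁
  obtain ⟨m₂, B₂, b₂⟩ := h₂
  refine ⟨m₁.mul m₂, B₁ * B₂, fun x => ?_⟩
  rw [abs_mul]
  exact mul_le_mul (b₁ x) (b₂ x) (abs_nonneg _) ((abs_nonneg _).trans (b₁ x))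

theorem const_mul (c : ℝ) (h : BddMeas Φ) : BddMeas fun x => c * Φ x := (const c).mul h

theorem neg (h : BddMeas Φ) : BddMeas fun x => -Φ x := by simpa using h.const_mul (-1)

theorem sub (h₁ : BddMeas Φ) (h₂ : BddMeas Ψ) : BddMeas fun x => Φ x - Ψ x := by
  simpa [sub_eq_add_neg] using h₁.add h₂.neg

theorem sq (h : BddMeas Φ) : BddMeas fun x => Φ x ^ 2 := by
  simpa [pow_two] using h.mul h

theorem sum {ι : Type*} (s : Finset ι) {F : ι → β → ℝ} (h : ∀ i ∈ s, BddMeas (F i)) :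
    BddMeas fun x => ∑ i ∈ s, F i x := by
  classical
  induction s using Finset.induction_on with
  | empty => simpa using const (0 : ℝ)
  | insert i s hi ih =>
    simp_rw [Finset.sum_insert hi]
    exact (h i (Finset.mem_insert_self i s)).add
      (ih fun j hj => h j (Finset.mem_insert_of_mem hj))

theorem comp (h : BddMeas Φ) {g : γ → β} (hg : Measurable g) : BddMeas fun x => Φ (g x) :=
  ⟨h.measurable.comp hg, h.bounded.imp fun _ hB x => hB (g x)⟩

theorem integrable (h : BddMeas Φ) (μ : Measure β) [IsFiniteMeasure μ] : Integrable Φ μ := by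
  obtain ⟨m, B, b⟩ := h
  exact Integrable.of_bound m.aestronglyMeasurable B (Eventually.of_forall b)

theorem integral_right {Φ : γ × β → ℝ} (h : BddMeas Φ) (μ : Measure β) [IsProbabilityMeasure μ] :
    BddMeas fun x => ∫ y, Φ (x, y) ∂μ := by
  obtain ⟨m, B, b⟩ := h
  refine ⟨(StronglyMeasurable.integral_prod_right' m.stronglyMeasurable).measurable, B,
    fun x => ?_⟩
  rw [← Real.norm_eq_abs]
  exact (norm_integral_le_of_norm_le_const (C := B) (Eventually.of_forall fun y => b (x, y))).trans
    (by simp)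

theorem sq_integral_le (h : BddMeas Φ) (μ : Measure β) [IsProbabilityMeasure μ] :
    (∫ x, Φ x ∂μ) ^ 2 ≤ ∫ x, Φ x ^ 2 ∂μ := by
  have h1 : 0 ≤ ∫ x, (Φ x - ∫ y, Φ y ∂μ) ^ 2 ∂μ := integral_nonneg fun _ => sq_nonneg _
  have e : ∀ x, (Φ x - ∫ y, Φ y ∂μ) ^ 2
      = Φ x ^ 2 - (2 * (∫ y, Φ y ∂μ) * Φ x - (∫ y, Φ y ∂μ) ^ 2) := fun x => by ring
  simp_rw [e] at h1
  rw [integral_sub (h.sq.integrable μ) (((h.const_mul _).sub (const _)).integrable μ),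
    integral_sub ((h.const_mul _).integrable μ) ((const _).integrable μ),
    integral_const_mul] at h1
  simp at h1
  nlinarith

theorem integral_centered_sq_le (h : BddMeas Φ) (μ : Measure β) [IsProbabilityMeasure μ] :
    ∫ x, (Φ x - ∫ y, Φ y ∂μ) ^ 2 ∂μ ≤ ∫ x, Φ x ^ 2 ∂μ := by
  have e : ∀ x, (Φ x - ∫ y, Φ y ∂μ) ^ 2
      = Φ x ^ 2 - (2 * (∫ y, Φ y ∂μ) * Φ x - (∫ y, Φ y ∂μ) ^ 2) := fun x => by ring
  simp_rw [e]
  rw [integral_sub (h.sq.integrable μ) (((h.const_mul _).sub (const _)).integrable μ),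
    integral_sub ((h.const_mul _).integrable μ) ((const _).integrable μ),
    integral_const_mul]
  simp
  nlinarith [sq_nonneg (∫ y, Φ y ∂μ)]

theorem integral_mono (h₁ : BddMeas Φ) (h₂ : BddMeas Ψ) (μ : Measure β) [IsFiniteMeasure μ]
    (h : ∀ x, Φ x ≤ Ψ x) : ∫ x, Φ x ∂μ ≤ ∫ x, Ψ x ∂μ :=
  MeasureTheory.integral_mono (h₁.integrable μ) (h₂.integrable μ) h

/-- Pythagoras' theorem. -/
theorem integral_sum_sq {ι : Type*} (s : Finset ι) {F : ι → β → ℝ} (h : ∀ i ∈ s, BddMeas (F i))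
    (μ : Measure β) [IsFiniteMeasure μ]
    (ho : ∀ i ∈ s, ∀ j ∈ s, i ≠ j → ∫ x, F i x * F j x ∂μ = 0) :
    ∫ x, (∑ i ∈ s, F i x) ^ 2 ∂μ = ∑ i ∈ s, ∫ x, F i x ^ 2 ∂μ := by
  simp_rw [pow_two, Finset.sum_mul_sum]
  rw [integral_finsetSum _ fun i hi =>
    (sum s fun j hj => (h i hi).mul (h j hj)).integrable μ]
  refine Finset.sum_congr rfl fun i hi => ?_
  rw [integral_finsetSum _ fun j hj => ((h i hi).mul (h j hj)).integrable μ]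
  exact Finset.sum_eq_single i (fun j hj hne => ho i hi j hj hne.symm) fun h' => absurd hi h'

end BddMeas

/-! ### Integrals over i.i.d. samples -/

section Pi

variable {α : Type*} [MeasurableSpace α] {G : Measure α} [IsProbabilityMeasure G] {n : ℕ}

/-- Redrawing one coordinate independently leaves the product law unchanged, which permits
integrating out that coordinate with the others frozen. -/
theorem measurePreserving_update (i : Fin n) :
    MeasurePreserving (fun p : α × (Fin n → α) => Function.update p.2 i p.1)
      (G.prod (Measure.pi fun _ => G)) (Measure.pi fun _ => G) := by
  have hm : Measurable fun p : α × (Fin n → α) => Function.update p.2 i p.1 := by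
    refine measurable_pi_iff.2 fun j => ?_
    by_cases hj : j = i
    · subst hj; simpa using measurable_fst
    · simp only [Function.update_of_ne hj]; fun_prop
  refine ⟨hm, (Measure.pi_eq fun s hs => ?_).symm⟩
  rw [Measure.map_apply hm (MeasurableSet.univ_pi hs)]
  have e : (fun p : α × (Fin n → α) => Function.update p.2 i p.1) ⁻¹' Set.univ.pi s
      = s i ×ˢ Set.univ.pi (Function.update s i Set.univ) := by
    ext p
    simp only [Set.mem_preimage, Set.mem_pi, Set.mem_univ, true_implies, Set.mem_prod]
    constructor
    · intro h
      refine ⟨by simpa using h i, fun j => ?_⟩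
      by_cases hj : j = i
      · subst hj; simp
      · simpa [Function.update_of_ne hj] using h j
    · rintro ⟨h1, h2⟩ j
      by_cases hj : j = i
      · subst hj; simpa using h1
      · simpa [Function.update_of_ne hj] using h2 j
  rw [e, Measure.prod_prod, Measure.pi_pi, ← Finset.mul_prod_erase Finset.univ _ (Finset.mem_univ i),
    ← Finset.mul_prod_erase Finset.univ (fun j => G (s j)) (Finset.mem_univ i)]
  simp only [Function.update_self, measure_univ, one_mul]
  congr 1
  refine Finset.prod_congr rfl fun j hj => ?_
  rw [Function.update_of_ne (Finset.ne_of_mem_erase hj)]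

theorem integral_pi_update {Φ : (Fin n → α) → ℝ} (h : BddMeas Φ) (i : Fin n) :
    ∫ x, Φ x ∂(Measure.pi fun _ => G)
      = ∫ x, ∫ t, Φ (Function.update x i t) ∂G ∂(Measure.pi fun _ => G) := by
  have hp := measurePreserving_update (G := G) i
  calc ∫ x, Φ x ∂(Measure.pi fun _ => G)
      = ∫ p : α × (Fin n → α), Φ (Function.update p.2 i p.1)
          ∂(G.prod (Measure.pi fun _ => G)) := by
        conv_lhs => rw [← hp.map_eq]
        exact integral_map hp.measurable.aemeasurable h.measurable.aestronglyMeasurable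
    _ = _ := integral_prod_symm _ ((h.comp hp.measurable).integrable _)

/-- Conditional centring in one coordinate; the orthogonality relations between projected terms all
come from here. -/
theorem integral_pi_eq_zero {Φ : (Fin n → α) → ℝ} (h : BddMeas Φ) (i : Fin n)
    (h0 : ∀ x, ∫ t, Φ (Function.update x i t) ∂G = 0) :
    ∫ x, Φ x ∂(Measure.pi fun _ => G) = 0 := by
  rw [integral_pi_update h i]
  simp [h0]

theorem integral_pi_eval (φ : α → ℝ) (i : Fin n) (hφ : Measurable φ) :
    ∫ x, φ (x i) ∂(Measure.pi fun _ => G) = ∫ t, φ t ∂G := by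
  have hp := measurePreserving_eval (fun _ : Fin n => G) i
  exact (hp.map_eq ▸ (integral_map hp.measurable.aemeasurable
    hφ.aestronglyMeasurable).symm : _ = ∫ t, φ t ∂G)

theorem integral_pi_eval_pair {ψ : α × α → ℝ} (hψ : BddMeas ψ) {i j : Fin n} (hij : i ≠ j) :
    ∫ x, ψ (x i, x j) ∂(Measure.pi fun _ => G) = ∫ s, ∫ t, ψ (s, t) ∂G ∂G := by
  have hm : BddMeas fun x : Fin n → α => ψ (x i, x j) := hψ.comp (by fun_prop)
  rw [integral_pi_update hm j]
  simp only [Function.update_self, Function.update_of_ne hij]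
  exact integral_pi_eval (fun s => ∫ t, ψ (s, t) ∂G) i (hψ.integral_right G).measurable

/-- The second moment of a weighted sum of centred i.i.d. terms. -/
theorem integral_linear_sq {φ : α → ℝ} (hφ : BddMeas φ) (h0 : ∫ t, φ t ∂G = 0) (c : Fin n → ℝ) :
    ∫ x, (∑ i, c i * φ (x i)) ^ 2 ∂(Measure.pi fun _ => G) = (∑ i, c i ^ 2) * ∫ t, φ t ^ 2 ∂G := by
  have hb : ∀ i, BddMeas fun x : Fin n → α => c i * φ (x i) := fun i =>
    (hφ.comp (by fun_prop)).const_mul _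
  rw [BddMeas.integral_sum_sq _ (fun i _ => hb i), Finset.sum_mul]
  · refine Finset.sum_congr rfl fun i _ => ?_
    simp_rw [mul_pow]
    rw [integral_const_mul, integral_pi_eval (fun t => φ t ^ 2) i hφ.sq.measurable]
  · intro i _ j _ hij
    refine integral_pi_eq_zero ((hb i).mul (hb j)) i fun x => ?_
    simp only [Function.update_self, Function.update_of_ne hij.symm]
    rw [integral_mul_const, integral_const_mul, h0]
    simp

/-- The second moment of a weighted sum of completely degenerate kernels over ordered pairs. -/
theorem integral_degenerate_sq {r : α × α → ℝ} (hr : BddMeas r)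
    (h1 : ∀ y, ∫ t, r (t, y) ∂G = 0) (h2 : ∀ y, ∫ t, r (y, t) ∂G = 0) (a : Fin n × Fin n → ℝ)
    (s : Finset (Fin n × Fin n))
    (hs : ∀ p ∈ s, p.1 ≠ p.2 ∧ ∀ p' ∈ s, p ≠ p' →
      (p.1 ≠ p'.1 ∧ p.1 ≠ p'.2) ∨ (p.2 ≠ p'.1 ∧ p.2 ≠ p'.2)) :
    ∫ x, (∑ p ∈ s, a p * r (x p.1, x p.2)) ^ 2 ∂(Measure.pi fun _ => G)
      = (∑ p ∈ s, a p ^ 2) * ∫ y, ∫ t, r (y, t) ^ 2 ∂G ∂G := by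
  have hb : ∀ p : Fin n × Fin n, BddMeas fun x : Fin n → α => a p * r (x p.1, x p.2) := fun p =>
    (hr.comp (by fun_prop)).const_mul _
  rw [BddMeas.integral_sum_sq _ (fun p _ => hb p), Finset.sum_mul]
  · refine Finset.sum_congr rfl fun p hp => ?_
    simp_rw [mul_pow]
    rw [integral_const_mul, integral_pi_eval_pair hr.sq (hs p hp).1]
  · intro p hp p' hp' hne
    obtain ⟨h12, h⟩ := hs p hp
    rcases h p' hp' hne with ⟨k1, k2⟩ | ⟨k1, k2⟩
    · refine integral_pi_eq_zero ((hb p).mul (hb p')) p.1 fun x => ?_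
      simp only [Function.update_self, Function.update_of_ne h12.symm,
        Function.update_of_ne k1.symm, Function.update_of_ne k2.symm]
      rw [integral_mul_const, integral_const_mul, h1]
      simp
    · refine integral_pi_eq_zero ((hb p).mul (hb p')) p.2 fun x => ?_
      simp only [Function.update_self, Function.update_of_ne h12,
        Function.update_of_ne k1.symm, Function.update_of_ne k2.symm]
      rw [integral_mul_const, integral_const_mul, h2]
      simp

end Pi

/-! ### The Hoeffding projection -/

/-- Off-diagonal weights of a `U`-statistic that are uniform up to a factor, with row and column
sums close to those of uniform weights. -/
structure AlmostUniformWeights (n : ℕ) (C : ℝ) (a : Fin n → Fin n → ℝ) : Prop where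
  diag : ∀ i, a i i = 0
  abs_le : ∀ i j, |a i j| ≤ C / n ^ 2
  marginal : ∀ i, |(∑ j, a i j) + (∑ j, a j i) - 2 / n| ≤ C / n ^ 2

section Hoeffding

variable {α : Type*} [MeasurableSpace α] {G : Measure α} [IsProbabilityMeasure G] {n : ℕ}
  {k : α × α → ℝ}

theorem integral_integral_sq_le (hk : BddMeas k) :
    ∫ x, (∫ y, k (x, y) ∂G) ^ 2 ∂G ≤ ∫ x, ∫ y, k (x, y) ^ 2 ∂G ∂G :=
  (hk.integral_right G).sq.integral_mono (hk.sq.integral_right G) G fun x =>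
    BddMeas.sq_integral_le (hk.comp (g := fun y => (x, y)) (by fun_prop)) G

/-- The part of a kernel that is orthogonal to functions of one variable. -/
noncomputable def degeneratePart (G : Measure α) (k : α × α → ℝ) (p : α × α) : ℝ :=
  k p - (∫ t, k (p.1, t) ∂G) - (∫ t, k (p.2, t) ∂G) + ∫ s, ∫ t, k (s, t) ∂G ∂G

theorem bddMeas_degeneratePart (hk : BddMeas k) : BddMeas (degeneratePart G k) :=
  ((hk.sub ((BddMeas.integral_right hk G).comp (measurable_fst (β := α)))).sub
    ((BddMeas.integral_right hk G).comp (measurable_snd (α := α)))).add (BddMeas.const _)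

theorem integral_degeneratePart_right (hk : BddMeas k) (y : α) :
    ∫ t, degeneratePart G k (y, t) ∂G = 0 := by
  have h1 : BddMeas fun t => k (y, t) := hk.comp (by fun_prop)
  have h2 := hk.integral_right G
  simp only [degeneratePart]
  rw [integral_add (((h1.sub (BddMeas.const _)).sub h2).integrable G)
      ((BddMeas.const _).integrable G),
    integral_sub ((h1.sub (BddMeas.const _)).integrable G) (h2.integrable G),
    integral_sub (h1.integrable G) ((BddMeas.const _).integrable G)]
  simp

theorem integral_degeneratePart_left (hk : BddMeas k) (hsymm : ∀ x y, k (x, y) = k (y, x)) (y : α) :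
    ∫ t, degeneratePart G k (t, y) ∂G = 0 := by
  rw [← integral_degeneratePart_right (G := G) hk y]
  refine integral_congr_ae (Eventually.of_forall fun t => ?_)
  simp only [degeneratePart, hsymm t y]
  ring

/-- By Jensen's inequality each of the four terms has second moment at most that of `k`, and a
square of four terms is at most four times the sum of squares: `16 = 4 * 4`. -/
theorem integral_degeneratePart_sq_le (hk : BddMeas k) :
    ∫ x, ∫ y, degeneratePart G k (x, y) ^ 2 ∂G ∂G ≤ 16 * ∫ x, ∫ y, k (x, y) ^ 2 ∂G ∂G := by
  set κ := ∫ x, ∫ y, k (x, y) ^ 2 ∂G ∂G with hκ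
  have hg := hk.integral_right G
  have hgκ : ∫ x, (∫ y, k (x, y) ∂G) ^ 2 ∂G ≤ κ := integral_integral_sq_le hk
  have hθ : (∫ s, ∫ t, k (s, t) ∂G ∂G) ^ 2 ≤ κ := (hg.sq_integral_le G).trans hgκ
  have hin : ∀ x, ∫ y, degeneratePart G k (x, y) ^ 2 ∂G
      ≤ 4 * ((∫ y, k (x, y) ^ 2 ∂G) + (∫ t, k (x, t) ∂G) ^ 2 + κ + κ) := by
    intro x
    have hx : BddMeas fun t => k (x, t) := hk.comp (by fun_prop)
    have hpt : ∀ y, degeneratePart G k (x, y) ^ 2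
        ≤ 4 * (k (x, y) ^ 2 + (∫ t, k (x, t) ∂G) ^ 2 + (∫ t, k (y, t) ∂G) ^ 2 + κ) := by
      intro y
      simp only [degeneratePart]
      nlinarith [sq_nonneg (k (x, y) + ∫ t, k (x, t) ∂G), sq_nonneg (k (x, y) + ∫ t, k (y, t) ∂G),
        sq_nonneg (k (x, y) - ∫ s, ∫ t, k (s, t) ∂G ∂G),
        sq_nonneg ((∫ t, k (x, t) ∂G) - ∫ t, k (y, t) ∂G),
        sq_nonneg ((∫ t, k (x, t) ∂G) + ∫ s, ∫ t, k (s, t) ∂G ∂G),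
        sq_nonneg ((∫ t, k (y, t) ∂G) + ∫ s, ∫ t, k (s, t) ∂G ∂G)]
    have hB := (((hx.sq.add (BddMeas.const ((∫ t, k (x, t) ∂G) ^ 2))).add hg.sq).add
      (BddMeas.const κ)).const_mul 4
    refine (BddMeas.integral_mono
      ((bddMeas_degeneratePart hk).sq.comp (g := fun y => (x, y)) (by fun_prop)) hB G hpt).trans ?_
    rw [integral_const_mul,
      integral_add (((hx.sq.add (BddMeas.const _)).add hg.sq).integrable G)
        ((BddMeas.const _).integrable G),
      integral_add ((hx.sq.add (BddMeas.const _)).integrable G) (hg.sq.integrable G),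
      integral_add (hx.sq.integrable G) ((BddMeas.const _).integrable G)]
    simp
    linarith
  have hk2 := hk.sq.integral_right G
  refine (BddMeas.integral_mono ((bddMeas_degeneratePart hk).sq.integral_right G)
    ((((hk2.add hg.sq).add (BddMeas.const κ)).add (BddMeas.const κ)).const_mul 4) G hin).trans ?_
  rw [integral_const_mul,
    integral_add (((hk2.add hg.sq).add (BddMeas.const _)).integrable G)
      ((BddMeas.const _).integrable G),
    integral_add ((hk2.add hg.sq).integrable G) ((BddMeas.const _).integrable G),
    integral_add (hk2.integrable G) (hg.sq.integrable G)]
  simp only [integral_const, probReal_univ, smul_eq_mul, one_mul]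
  linarith

/-- The weighted sum `∑ a_{ij} k(x_i, x_j)`. -/
def pairSum (a : Fin n → Fin n → ℝ) (k : α × α → ℝ) (x : Fin n → α) : ℝ :=
  ∑ i, ∑ j, a i j * k (x i, x j)

theorem bddMeas_pairSum (hk : BddMeas k) (a : Fin n → Fin n → ℝ) :
    BddMeas (pairSum a k : (Fin n → α) → ℝ) :=
  BddMeas.sum _ fun _ _ => BddMeas.sum _ fun _ _ => (hk.comp (by fun_prop)).const_mul _

/-- The error made in replacing a weighted pair sum with its projection on sums of `q`. -/
noncomputable def projectionError (G : Measure α) (a : Fin n → Fin n → ℝ) (k : α × α → ℝ)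
    (q : α → ℝ) (x : Fin n → α) : ℝ :=
  √(n : ℝ) * (pairSum a k x - (∑ i, ∑ j, a i j) * ∫ s, ∫ t, k (s, t) ∂G ∂G)
    - normSum (fun y => 2 * (q y - ∫ z, q z ∂G)) x

theorem bddMeas_normSum {q : α → ℝ} (hq : BddMeas q) :
    BddMeas (normSum q : (Fin n → α) → ℝ) :=
  (BddMeas.sum _ fun _ _ => hq.comp (by fun_prop)).const_mul _

set_option linter.unusedSectionVars false in
theorem bddMeas_projectionError (hk : BddMeas k) (a : Fin n → Fin n → ℝ) {q : α → ℝ}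
    (hq : BddMeas q) : BddMeas (projectionError G a k q) :=
  (((bddMeas_pairSum hk a).sub (BddMeas.const _)).const_mul _).sub
    (bddMeas_normSum ((hq.sub (BddMeas.const _)).const_mul 2))

/-- Orthogonality leaves the sum of at most `n²` squared weights, each at most `C²/n⁴`. The constant
is `2` from cutting the square into two triangles times `16` from the degenerate part. -/
theorem integral_degenerate_pairSum_sq_le {C : ℝ} {a : Fin n → Fin n → ℝ}
    (ha : AlmostUniformWeights n C a) (hn : 0 < n) (hk : BddMeas k)
    (hsymm : ∀ x y, k (x, y) = k (y, x)) :
    ∫ x, pairSum a (degeneratePart G k) x ^ 2 ∂(Measure.pi fun _ => G)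
      ≤ 32 * C ^ 2 / n ^ 2 * ∫ x, ∫ y, k (x, y) ^ 2 ∂G ∂G := by
  classical
  set r := degeneratePart G k with hr
  have hrb : BddMeas r := bddMeas_degeneratePart hk
  have hn' : (0 : ℝ) < n := by exact_mod_cast hn
  set κ := ∫ x, ∫ y, k (x, y) ^ 2 ∂G ∂G with hκ
  set ρ := ∫ x, ∫ y, r (x, y) ^ 2 ∂G ∂G with hρ
  have hρ0 : 0 ≤ ρ := integral_nonneg fun _ => integral_nonneg fun _ => sq_nonneg _
  have hρκ : ρ ≤ 16 * κ := integral_degeneratePart_sq_le hk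
  -- The terms at `(i, j)` and `(j, i)` depend on the same coordinates and need not be orthogonal.
  -- Inside one triangle, of two distinct pairs each has an index that the other lacks.
  set s₁ : Finset (Fin n × Fin n) := Finset.univ.filter fun p => p.1 < p.2 with hs₁
  set s₂ : Finset (Fin n × Fin n) := Finset.univ.filter fun p => p.2 < p.1 with hs₂
  set b : Fin n × Fin n → ℝ := fun p => a p.1 p.2 with hb
  have hsplit : ∀ x : Fin n → α, pairSum a r x
      = (∑ p ∈ s₁, b p * r (x p.1, x p.2)) + ∑ p ∈ s₂, b p * r (x p.1, x p.2) := by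
    intro x
    rw [pairSum, ← Finset.sum_product', hs₁, hs₂, Finset.sum_filter, Finset.sum_filter,
      ← Finset.sum_add_distrib, Finset.univ_product_univ]
    refine Finset.sum_congr rfl fun p _ => ?_
    rcases lt_trichotomy p.1 p.2 with h | h | h
    · simp [h, h.not_gt, hb]
    · simp [h, ha.diag]
    · simp [h, h.not_gt, hb]
  have hb2 : ∀ p, b p ^ 2 ≤ (C / n ^ 2) ^ 2 := fun p => by
    rw [← sq_abs]
    exact pow_le_pow_left₀ (abs_nonneg _) (ha.abs_le _ _) 2
  have hS₁ := integral_degenerate_sq hrb (integral_degeneratePart_left hk hsymm)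
    (integral_degeneratePart_right hk) b s₁ (by
      rintro ⟨i, j⟩ hp
      simp only [hs₁, Finset.mem_filter, Finset.mem_univ, true_and] at hp
      refine ⟨hp.ne, ?_⟩
      rintro ⟨i', j'⟩ hp' hne
      simp only [hs₁, Finset.mem_filter, Finset.mem_univ, true_and, ne_eq, Prod.mk.injEq] at hp' hne ⊢
      omega)
  have hS₂ := integral_degenerate_sq hrb (integral_degeneratePart_left hk hsymm)
    (integral_degeneratePart_right hk) b s₂ (by
      rintro ⟨i, j⟩ hp
      simp only [hs₂, Finset.mem_filter, Finset.mem_univ, true_and] at hp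
      refine ⟨hp.ne', ?_⟩
      rintro ⟨i', j'⟩ hp' hne
      simp only [hs₂, Finset.mem_filter, Finset.mem_univ, true_and, ne_eq, Prod.mk.injEq] at hp' hne ⊢
      omega)
  have hbm : ∀ s : Finset (Fin n × Fin n),
      BddMeas fun x : Fin n → α => ∑ p ∈ s, b p * r (x p.1, x p.2) := fun s =>
    BddMeas.sum _ fun p _ => (hrb.comp (by fun_prop)).const_mul _
  have hsum : (∑ p ∈ s₁, b p ^ 2) + ∑ p ∈ s₂, b p ^ 2 ≤ C ^ 2 / n ^ 2 := by
    have hdisj : Disjoint s₁ s₂ := by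
      rw [hs₁, hs₂, Finset.disjoint_filter]
      intro p _ h
      exact h.not_gt
    rw [← Finset.sum_union hdisj]
    refine (Finset.sum_le_card_nsmul _ _ _ fun p _ => hb2 p).trans ?_
    have hc : ((s₁ ∪ s₂).card : ℝ) ≤ n * n := by
      have := Finset.card_le_univ (s₁ ∪ s₂)
      rw [Fintype.card_prod, Fintype.card_fin] at this
      exact_mod_cast this
    rw [nsmul_eq_mul]
    refine (mul_le_mul_of_nonneg_right hc (sq_nonneg _)).trans (le_of_eq ?_)
    field_simp
  calc ∫ x, pairSum a r x ^ 2 ∂(Measure.pi fun _ => G)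
      ≤ ∫ x, (2 * (∑ p ∈ s₁, b p * r (x p.1, x p.2)) ^ 2 +
          2 * (∑ p ∈ s₂, b p * r (x p.1, x p.2)) ^ 2) ∂(Measure.pi fun _ => G) := by
        refine BddMeas.integral_mono (bddMeas_pairSum hrb a).sq
          (((hbm s₁).sq.const_mul 2).add ((hbm s₂).sq.const_mul 2)) _ fun x => ?_
        rw [hsplit]
        nlinarith [sq_nonneg ((∑ p ∈ s₁, b p * r (x p.1, x p.2)) -
          ∑ p ∈ s₂, b p * r (x p.1, x p.2))]
    _ = 2 * ((∑ p ∈ s₁, b p ^ 2) + ∑ p ∈ s₂, b p ^ 2) * ρ := by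
        rw [integral_add (((hbm s₁).sq.const_mul 2).integrable _)
          (((hbm s₂).sq.const_mul 2).integrable _), integral_const_mul, integral_const_mul,
          hS₁, hS₂]
        ring
    _ ≤ 2 * (C ^ 2 / n ^ 2) * (16 * κ) := by
        refine mul_le_mul (by linarith) hρκ hρ0 (by positivity)
    _ = _ := by ring

/-- The mean square of the projection error. -/
theorem integral_projectionError_sq_le {C : ℝ} {a : Fin n → Fin n → ℝ}
    (ha : AlmostUniformWeights n C a) (hn : 0 < n) (hk : BddMeas k)
    (hsymm : ∀ x y, k (x, y) = k (y, x)) {q : α → ℝ} (hq : BddMeas q) :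
    ∫ x, projectionError G a k q x ^ 2 ∂(Measure.pi fun _ => G)
      ≤ 99 * C ^ 2 * ((∫ x, ∫ y, k (x, y) ^ 2 ∂G ∂G) / n)
        + 12 * ∫ x, ((∫ y, k (x, y) ∂G) - q x) ^ 2 ∂G := by
  set r := degeneratePart G k with hr
  have hrb : BddMeas r := bddMeas_degeneratePart hk
  have hn' : (0 : ℝ) < n := by exact_mod_cast hn
  have hn1 : (1 : ℝ) ≤ n := by exact_mod_cast hn
  set κ := ∫ x, ∫ y, k (x, y) ^ 2 ∂G ∂G with hκ
  have hκ0 : 0 ≤ κ := integral_nonneg fun _ => integral_nonneg fun _ => sq_nonneg _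
  set k₁ : α → ℝ := fun x => ∫ y, k (x, y) ∂G with hk₁
  have hk₁b : BddMeas k₁ := hk.integral_right G
  set θ := ∫ s, ∫ t, k (s, t) ∂G ∂G with hθ
  set qm := ∫ z, q z ∂G with hqm
  set c : Fin n → ℝ := fun i => (∑ j, a i j) + (∑ j, a j i) - 2 / n with hc
  set g : α → ℝ := fun x => k₁ x - θ with hg
  set w : α → ℝ := fun x => (k₁ x - q x) - (θ - qm) with hw
  have hgb : BddMeas g := hk₁b.sub (BddMeas.const _)
  have hwb : BddMeas w := (hk₁b.sub hq).sub (BddMeas.const _)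
  have hg0 : ∫ x, g x ∂G = 0 := by
    rw [hg, integral_sub (hk₁b.integrable G) ((BddMeas.const _).integrable G)]
    simp [hk₁, hθ]
  have hmean : ∫ x, (k₁ x - q x) ∂G = θ - qm :=
    integral_sub (hk₁b.integrable G) (hq.integrable G)
  have hw0 : ∫ x, w x ∂G = 0 := by
    rw [hw, integral_sub ((hk₁b.sub hq).integrable G) ((BddMeas.const _).integrable G), hmean]
    simp
  have hg2 : ∫ x, g x ^ 2 ∂G ≤ κ :=
    (hk₁b.integral_centered_sq_le G).trans (integral_integral_sq_le hk)
  have hw2 : ∫ x, w x ^ 2 ∂G ≤ ∫ x, (k₁ x - q x) ^ 2 ∂G := by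
    have := (hk₁b.sub hq).integral_centered_sq_le G
    rwa [hmean] at this
  -- Hoeffding's decomposition: the degenerate part, a linear part from the deviation `c` of the
  -- marginal weights from `2/n`, and a linear part from replacing `k₁` by `q`.
  have hdecomp : ∀ x : Fin n → α, projectionError G a k q x = √(n : ℝ) * pairSum a r x
      + √(n : ℝ) * (∑ i, c i * g (x i)) + (√(n : ℝ))⁻¹ * (∑ i, 2 * w (x i)) := by
    intro x
    have e1 : pairSum a k x - (∑ i, ∑ j, a i j) * θ
        = pairSum a r x + ∑ i, ((∑ j, a i j) + (∑ j, a j i)) * g (x i) := by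
      have e2 : ∑ i, ((∑ j, a i j) + (∑ j, a j i)) * g (x i)
          = ∑ i, ∑ j, a i j * (g (x i) + g (x j)) := by
        simp_rw [add_mul, mul_add, Finset.sum_add_distrib, Finset.sum_mul]
        congr 1
        rw [Finset.sum_comm]
      rw [e2, pairSum, pairSum, Finset.sum_mul, ← Finset.sum_add_distrib, ← Finset.sum_sub_distrib]
      refine Finset.sum_congr rfl fun i _ => ?_
      rw [Finset.sum_mul, ← Finset.sum_add_distrib, ← Finset.sum_sub_distrib]
      refine Finset.sum_congr rfl fun j _ => ?_
      simp only [hr, degeneratePart, hg, hk₁, ← hθ]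
      ring
    have e3 : ∑ i, ((∑ j, a i j) + (∑ j, a j i)) * g (x i)
        = (∑ i, c i * g (x i)) + 2 / n * ∑ i, g (x i) := by
      rw [Finset.mul_sum, ← Finset.sum_add_distrib]
      refine Finset.sum_congr rfl fun i _ => ?_
      simp only [hc]; ring
    have e4 : √(n : ℝ) * (2 / n * ∑ i, g (x i)) = (√(n : ℝ))⁻¹ * ∑ i, 2 * g (x i) := by
      rw [← Finset.mul_sum]
      have h2 : √(n : ℝ) * √(n : ℝ) = n := Real.mul_self_sqrt hn'.le
      have h3 : √(n : ℝ) ≠ 0 := (Real.sqrt_pos.2 hn').ne'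
      field_simp
      rw [pow_two, h2]
    have e5 : (∑ i, 2 * g (x i)) - ∑ i, 2 * (q (x i) - qm) = ∑ i, 2 * w (x i) := by
      rw [← Finset.sum_sub_distrib]
      refine Finset.sum_congr rfl fun i _ => ?_
      simp only [hg, hw]; ring
    rw [projectionError, normSum, e1, e3, mul_add, mul_add, e4, ← e5]
    ring
  have hA := integral_degenerate_pairSum_sq_le (G := G) ha hn hk hsymm
  have hB := integral_linear_sq (n := n) hgb hg0 c
  have hD := integral_linear_sq (n := n) hwb hw0 (fun _ => 2)
  have hc2 : ∑ i, c i ^ 2 ≤ C ^ 2 / n ^ 3 := by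
    have : ∀ i ∈ Finset.univ, c i ^ 2 ≤ (C / n ^ 2) ^ 2 := fun i _ => by
      rw [← sq_abs]
      exact pow_le_pow_left₀ (abs_nonneg _) (ha.marginal i) 2
    refine (Finset.sum_le_card_nsmul _ _ _ this).trans (le_of_eq ?_)
    rw [Finset.card_univ, Fintype.card_fin, nsmul_eq_mul]
    field_simp
  have b1 : BddMeas fun x : Fin n → α => pairSum a r x := bddMeas_pairSum hrb a
  have b2 : BddMeas fun x : Fin n → α => ∑ i, c i * g (x i) :=
    BddMeas.sum _ fun i _ => (hgb.comp (by fun_prop)).const_mul _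
  have b3 : BddMeas fun x : Fin n → α => ∑ i, 2 * w (x i) :=
    BddMeas.sum _ fun i _ => (hwb.comp (by fun_prop)).const_mul _
  have hsq : √(n : ℝ) ^ 2 = n := Real.sq_sqrt hn'.le
  calc ∫ x, projectionError G a k q x ^ 2 ∂(Measure.pi fun _ => G)
      ≤ ∫ x, (3 * n * pairSum a r x ^ 2 + 3 * n * (∑ i, c i * g (x i)) ^ 2
          + 3 * (n : ℝ)⁻¹ * (∑ i, 2 * w (x i)) ^ 2) ∂(Measure.pi fun _ => G) := by
        refine BddMeas.integral_mono (bddMeas_projectionError hk a hq).sq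
          (((b1.sq.const_mul _).add (b2.sq.const_mul _)).add (b3.sq.const_mul _)) _ fun x => ?_
        rw [hdecomp]
        set A := √(n : ℝ) * pairSum a r x
        set B := √(n : ℝ) * (∑ i, c i * g (x i))
        set D := (√(n : ℝ))⁻¹ * (∑ i, 2 * w (x i))
        have hA' : 3 * n * pairSum a r x ^ 2 = 3 * A ^ 2 := by rw [mul_pow, hsq]; ring
        have hB' : 3 * n * (∑ i, c i * g (x i)) ^ 2 = 3 * B ^ 2 := by rw [mul_pow, hsq]; ring
        have hD' : 3 * (n : ℝ)⁻¹ * (∑ i, 2 * w (x i)) ^ 2 = 3 * D ^ 2 := by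
          rw [mul_pow, inv_pow, hsq]; ring
        rw [hA', hB', hD']
        nlinarith [sq_nonneg (A - B), sq_nonneg (A - D), sq_nonneg (B - D)]
    _ = 3 * n * (∫ x, pairSum a r x ^ 2 ∂(Measure.pi fun _ => G))
          + 3 * n * ((∑ i, c i ^ 2) * ∫ t, g t ^ 2 ∂G) + 12 * ∫ t, w t ^ 2 ∂G := by
        rw [integral_add (((b1.sq.const_mul _).add (b2.sq.const_mul _)).integrable _)
          ((b3.sq.const_mul _).integrable _), integral_add ((b1.sq.const_mul _).integrable _)
          ((b2.sq.const_mul _).integrable _), integral_const_mul, integral_const_mul,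
          integral_const_mul, hB, hD]
        congr 1
        rw [Finset.sum_const, Finset.card_univ, Fintype.card_fin, nsmul_eq_mul]
        field_simp
        norm_num
        ring
    _ ≤ 3 * n * (32 * C ^ 2 / n ^ 2 * κ) + 3 * n * (C ^ 2 / n ^ 3 * κ)
          + 12 * ∫ x, (k₁ x - q x) ^ 2 ∂G := by
        have hg0' : 0 ≤ ∫ t, g t ^ 2 ∂G := integral_nonneg fun _ => sq_nonneg _
        have := mul_le_mul hc2 hg2 hg0' (by positivity)
        gcongr
    -- The square of three summands costs a factor `3`: hence `99 = 3 * 32 + 3`, where the last `3`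
    -- absorbs a spare `1/n`, and `12 = 3 * 2²`.
    _ ≤ _ := by
        have e1 : 3 * n * (32 * C ^ 2 / n ^ 2 * κ) = 96 * C ^ 2 * (κ / n) := by
          field_simp; norm_num; ring
        have e2 : 3 * n * (C ^ 2 / n ^ 3 * κ) = 3 * C ^ 2 * (κ / n) * (1 / n) := by field_simp
        have e3 : 3 * C ^ 2 * (κ / n) * (1 / n) ≤ 3 * C ^ 2 * (κ / n) :=
          mul_le_of_le_one_right (by positivity) ((div_le_one hn').2 hn1)
        rw [e1, e2]
        linarith

/-- The mean of all squared kernel values over the sample, diagonal included. -/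
theorem integral_mean_sq_le (hn : 0 < n) (hk : BddMeas k) {k₀ : ℝ} (hdiag : ∀ x, k (x, x) = k₀) :
    ∫ x, (1 / (n : ℝ) ^ 2 * ∑ i, ∑ j, k (x i, x j) ^ 2) ∂(Measure.pi fun _ : Fin n => G)
      ≤ k₀ ^ 2 / n + ∫ x, ∫ y, k (x, y) ^ 2 ∂G ∂G := by
  have hn' : (0 : ℝ) < n := by exact_mod_cast hn
  set κ := ∫ x, ∫ y, k (x, y) ^ 2 ∂G ∂G with hκ
  have hκ0 : 0 ≤ κ := integral_nonneg fun _ => integral_nonneg fun _ => sq_nonneg _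
  have hb : ∀ i j : Fin n, BddMeas fun x : Fin n → α => k (x i, x j) ^ 2 := fun i j =>
    hk.sq.comp (g := fun x : Fin n → α => (x i, x j)) (by fun_prop)
  rw [integral_const_mul, integral_finsetSum _ fun i _ =>
    (BddMeas.sum _ fun j _ => hb i j).integrable _]
  have h1 : ∀ i : Fin n, ∫ x, ∑ j, k (x i, x j) ^ 2 ∂(Measure.pi fun _ : Fin n => G)
      ≤ k₀ ^ 2 + n * κ := by
    intro i
    rw [integral_finsetSum _ fun j _ => (hb i j).integrable _]
    have h2 : ∀ j ∈ Finset.univ, ∫ x, k (x i, x j) ^ 2 ∂(Measure.pi fun _ : Fin n => G)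
        ≤ (if i = j then k₀ ^ 2 else 0) + κ := by
      intro j _
      by_cases hij : i = j
      · subst hij
        simp [hdiag, hκ0]
      · rw [integral_pi_eval_pair (ψ := fun p => k p ^ 2) hk.sq hij]
        simp [hij, hκ]
    refine (Finset.sum_le_sum h2).trans (le_of_eq ?_)
    rw [Finset.sum_add_distrib]
    simp
  refine (mul_le_mul_of_nonneg_left (Finset.sum_le_sum fun i _ => h1 i) (by positivity)).trans
    (le_of_eq ?_)
  rw [Finset.sum_const, Finset.card_univ, Fintype.card_fin, nsmul_eq_mul]
  field_simp

/-- The mean square error at a sample point of the kernel average over the sample. -/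
theorem integral_average_sub_sq_le (hn : 0 < n) (hk : BddMeas k) {k₀ : ℝ}
    (hdiag : ∀ x, k (x, x) = k₀) {q : α → ℝ} (hq : BddMeas q) (i : Fin n) :
    ∫ x, (1 / (n : ℝ) * (∑ j, k (x i, x j)) - q (x i)) ^ 2 ∂(Measure.pi fun _ : Fin n => G)
      ≤ 4 * ((k₀ / n) ^ 2 + 2 * ((∫ x, ∫ y, k (x, y) ^ 2 ∂G ∂G) / n)
        + ∫ x, ((∫ y, k (x, y) ∂G) - q x) ^ 2 ∂G) := by
  classical
  have hn' : (0 : ℝ) < n := by exact_mod_cast hn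
  have hn1 : (1 : ℝ) ≤ n := by exact_mod_cast hn
  set κ := ∫ x, ∫ y, k (x, y) ^ 2 ∂G ∂G with hκ
  have hκ0 : 0 ≤ κ := integral_nonneg fun _ => integral_nonneg fun _ => sq_nonneg _
  set k₁ : α → ℝ := fun x => ∫ y, k (x, y) ∂G with hk₁
  have hk₁b : BddMeas k₁ := hk.integral_right G
  set F : Fin n → (Fin n → α) → ℝ := fun j x => k (x i, x j) - k₁ (x i) with hF
  have hFb : ∀ j, BddMeas (F j) := fun j =>
    (hk.comp (g := fun x : Fin n → α => (x i, x j)) (by fun_prop)).sub (hk₁b.comp (by fun_prop))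
  set s : Finset (Fin n) := Finset.univ.erase i with hs
  have hsum : ∫ x, (∑ j ∈ s, F j x) ^ 2 ∂(Measure.pi fun _ : Fin n => G) ≤ n * κ := by
    rw [BddMeas.integral_sum_sq _ (fun j _ => hFb j)]
    · have h1 : ∀ j ∈ s, ∫ x, F j x ^ 2 ∂(Measure.pi fun _ : Fin n => G) ≤ κ := by
        intro j hj
        have hij : i ≠ j := (Finset.ne_of_mem_erase hj).symm
        have hψ : BddMeas fun p : α × α => (k p - k₁ p.1) ^ 2 :=
          (hk.sub (hk₁b.comp measurable_fst)).sq
        refine (integral_pi_eval_pair (G := G) hψ hij).le.trans ?_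
        exact BddMeas.integral_mono (hψ.integral_right G) (hk.sq.integral_right G) G fun y =>
          BddMeas.integral_centered_sq_le (hk.comp (g := fun t => (y, t)) (by fun_prop)) G
      refine (Finset.sum_le_card_nsmul _ _ _ h1).trans ?_
      rw [nsmul_eq_mul]
      refine mul_le_mul_of_nonneg_right ?_ hκ0
      have := Finset.card_le_univ s
      rw [Fintype.card_fin] at this
      exact_mod_cast this
    · intro j hj j' hj' hne
      have hij : i ≠ j := (Finset.ne_of_mem_erase hj).symm
      refine integral_pi_eq_zero ((hFb j).mul (hFb j')) j fun x => ?_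
      simp only [hF, Function.update_self, Function.update_of_ne hij,
        Function.update_of_ne hne.symm]
      rw [integral_mul_const, integral_sub
        (BddMeas.integrable (hk.comp (g := fun t => (x i, t)) (by fun_prop)) G)
        ((BddMeas.const _).integrable G)]
      simp [hk₁]
  -- The term `j = i` is the constant `k₀`, the other `n - 1` are centred given `x i`, and the
  -- missing `n`-th copy of `k₁ (x i)` is the last summand.
  have hdecomp : ∀ x : Fin n → α, 1 / (n : ℝ) * (∑ j, k (x i, x j)) - q (x i)
      = k₀ / n + 1 / (n : ℝ) * (∑ j ∈ s, F j x) + (k₁ (x i) - q (x i)) - 1 / (n : ℝ) * k₁ (x i) := by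
    intro x
    have h1 : ∑ j, k (x i, x j) = k₀ + ∑ j ∈ s, k (x i, x j) := by
      rw [← Finset.add_sum_erase _ _ (Finset.mem_univ i), hdiag]
    have h2 : ∑ j ∈ s, F j x = (∑ j ∈ s, k (x i, x j)) - (n - 1) * k₁ (x i) := by
      simp only [hF]
      rw [Finset.sum_sub_distrib, Finset.sum_const, hs, Finset.card_erase_of_mem (Finset.mem_univ i),
        Finset.card_univ, Fintype.card_fin, nsmul_eq_mul, Nat.cast_pred hn]
    rw [h1, h2]
    field_simp
    ring
  have bF : BddMeas fun x : Fin n → α => ∑ j ∈ s, F j x := BddMeas.sum _ fun j _ => hFb j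
  have bq : BddMeas fun y => (k₁ y - q y) ^ 2 := (hk₁b.sub hq).sq
  have bqi : BddMeas fun x : Fin n → α => (k₁ (x i) - q (x i)) ^ 2 := bq.comp (by fun_prop)
  have bki : BddMeas fun x : Fin n → α => k₁ (x i) ^ 2 := hk₁b.sq.comp (by fun_prop)
  have bL : BddMeas fun x : Fin n → α => (1 / (n : ℝ) * (∑ j, k (x i, x j)) - q (x i)) ^ 2 :=
    (((BddMeas.sum _ fun j _ => hk.comp (g := fun x : Fin n → α => (x i, x j))
      (by fun_prop)).const_mul _).sub (hq.comp (by fun_prop))).sq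
  calc ∫ x, (1 / (n : ℝ) * (∑ j, k (x i, x j)) - q (x i)) ^ 2 ∂(Measure.pi fun _ : Fin n => G)
      ≤ ∫ x, (4 * ((k₀ / n) ^ 2 + (1 / (n : ℝ)) ^ 2 * (∑ j ∈ s, F j x) ^ 2
          + (k₁ (x i) - q (x i)) ^ 2 + (1 / (n : ℝ)) ^ 2 * k₁ (x i) ^ 2))
          ∂(Measure.pi fun _ : Fin n => G) := by
        refine BddMeas.integral_mono bL (((((BddMeas.const _).add (bF.sq.const_mul _)).add bqi).add
          (bki.const_mul _)).const_mul 4) _ fun x => ?_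
        rw [hdecomp, ← mul_pow, ← mul_pow]
        set A := k₀ / (n : ℝ)
        set B := 1 / (n : ℝ) * ∑ j ∈ s, F j x
        set D := k₁ (x i) - q (x i)
        set H := 1 / (n : ℝ) * k₁ (x i)
        nlinarith [sq_nonneg (A - B), sq_nonneg (A - D), sq_nonneg (B - D), sq_nonneg (A + H),
          sq_nonneg (B + H), sq_nonneg (D + H)]
    _ = 4 * ((k₀ / n) ^ 2 + (1 / (n : ℝ)) ^ 2 *
          (∫ x, (∑ j ∈ s, F j x) ^ 2 ∂(Measure.pi fun _ : Fin n => G))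
          + (∫ y, (k₁ y - q y) ^ 2 ∂G) + (1 / (n : ℝ)) ^ 2 * ∫ y, k₁ y ^ 2 ∂G) := by
        rw [integral_const_mul,
          integral_add ((((BddMeas.const _).add (bF.sq.const_mul _)).add bqi).integrable _)
            ((bki.const_mul _).integrable _),
          integral_add (((BddMeas.const _).add (bF.sq.const_mul _)).integrable _)
            (bqi.integrable _),
          integral_add ((BddMeas.const _).integrable _) ((bF.sq.const_mul _).integrable _),
          integral_const_mul, integral_const_mul,
          integral_pi_eval (fun y => (k₁ y - q y) ^ 2) i bq.measurable,
          integral_pi_eval (fun y => k₁ y ^ 2) i hk₁b.sq.measurable]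
        simp
    _ ≤ 4 * ((k₀ / n) ^ 2 + (1 / (n : ℝ)) ^ 2 * (n * κ)
          + (∫ y, (k₁ y - q y) ^ 2 ∂G) + (1 / (n : ℝ)) ^ 2 * (n * κ)) := by
        have h1 : ∫ y, k₁ y ^ 2 ∂G ≤ n * κ :=
          (integral_integral_sq_le hk).trans (le_mul_of_one_le_left hκ0 hn1)
        gcongr
    _ = _ := by
        field_simp
        ring

end Hoeffding

end AvgDensity

namespace AvgDensity

variable {d : ℕ}

/-! ### Kernel integrals under the density and under the empirical distribution -/

/-- The scaled kernel as a function of a pair of points. -/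
noncomputable def pairKernel (K : E d → ℝ) (h : ℝ) (p : E d × E d) : ℝ :=
  scaledKernel K h (p.1 - p.2)

theorem ConditionK.bddMeas {K : E d → ℝ} {P : ℝ} (hK : ConditionK K P) : BddMeas K :=
  ⟨hK.measurable, hK.bounded⟩

theorem bddMeas_pairKernel {K : E d → ℝ} (hK : BddMeas K) (h : ℝ) : BddMeas (pairKernel K h) :=
  (hK.comp (g := fun p : E d × E d => h⁻¹ • (p.1 - p.2)) (by fun_prop)).const_mul _

theorem pairKernel_symm {K : E d → ℝ} (hK : ∀ u, K (-u) = K u) (h : ℝ) (x y : E d) :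
    pairKernel K h (x, y) = pairKernel K h (y, x) := by
  rw [pairKernel, pairKernel, scaledKernel, scaledKernel, ← hK (h⁻¹ • (x - y)), ← smul_neg, neg_sub]

theorem pairKernel_diag (K : E d → ℝ) (h : ℝ) (x : E d) : pairKernel K h (x, x) = K 0 / h ^ d := by
  rw [pairKernel, scaledKernel, sub_self, smul_zero, one_div, inv_mul_eq_div]

theorem integral_scaled {h : ℝ} (hh : 0 < h) (φ : E d → ℝ) :
    ∫ z, φ (h⁻¹ • z) = h ^ d * ∫ u, φ u := by
  rw [Measure.integral_comp_inv_smul_of_nonneg _ _ hh.le, finrank_euclideanSpace_fin, smul_eq_mul]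

namespace BoundedDensity

variable {f : E d → ℝ} {M : ℝ} {K : E d → ℝ}

theorem bddMeas (hf : BoundedDensity f M) : BddMeas f := ⟨hf.measurable, M, hf.abs_le⟩

theorem measurable_ofReal (hf : BoundedDensity f M) : Measurable fun x => ENNReal.ofReal (f x) :=
  ENNReal.measurable_ofReal.comp hf.measurable

theorem integral_densityLaw (hf : BoundedDensity f M) (g : E d → ℝ) :
    ∫ x, g x ∂(densityLaw f) = ∫ x, f x * g x := by
  rw [densityLaw, integral_withDensity_eq_integral_toReal_smul
    hf.measurable_ofReal (Eventually.of_forall fun x => ENNReal.ofReal_lt_top)]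
  refine integral_congr_ae (Eventually.of_forall fun x => ?_)
  simp only [ENNReal.toReal_ofReal (hf.nonneg x), smul_eq_mul]

theorem isProbabilityMeasure (hf : BoundedDensity f M) : IsProbabilityMeasure (densityLaw f) := by
  refine ⟨?_⟩
  rw [densityLaw, withDensity_apply _ MeasurableSet.univ, Measure.restrict_univ,
    ← ofReal_integral_eq_lintegral_ofReal hf.integrable (Eventually.of_forall hf.nonneg),
    hf.integral_one, ENNReal.ofReal_one]

theorem avgDensity_eq (hf : BoundedDensity f M) : avgDensity f = ∫ x, f x * f x :=
  hf.integral_densityLaw f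

/-- Substitution `y = x - h u`, followed by a reflection of `u`, which evenness of `K` permits. -/
theorem integral_pairKernel (hf : BoundedDensity f M) (hK : ∀ u, K (-u) = K u) {h : ℝ}
    (hh : 0 < h) (x : E d) : ∫ y, pairKernel K h (x, y) ∂(densityLaw f) = smooth K h f x := by
  rw [hf.integral_densityLaw, smooth,
    ← integral_sub_left_eq_self (fun y => f y * pairKernel K h (x, y)) volume x]
  have e : ∀ z, f (x - z) * pairKernel K h (x, x - z)
      = 1 / h ^ d * (fun u => K u * f (x + h • (-u))) (h⁻¹ • z) := by
    intro z
    simp only [pairKernel, scaledKernel, sub_sub_cancel, smul_neg, smul_smul,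
      mul_inv_cancel₀ hh.ne', one_smul, ← sub_eq_add_neg]
    ring
  simp_rw [e]
  rw [integral_const_mul, integral_scaled hh (fun u => K u * f (x + h • (-u))), ← mul_assoc, one_div, inv_mul_cancel₀ (by positivity),
    one_mul, ← integral_neg_eq_self]
  simp only [hK, neg_neg]

/-- Squaring the scaled kernel gives `h^(-2d)` and the change of variables returns `h^d`. One copy
of `f` is bounded by `M`, the other has integral one. -/
theorem integral_pairKernel_sq_le (hf : BoundedDensity f M) (hKb : BddMeas K)
    (hKi : Integrable K volume) {h : ℝ} (hh : 0 < h) :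
    ∫ x, ∫ y, pairKernel K h (x, y) ^ 2 ∂(densityLaw f) ∂(densityLaw f)
      ≤ M * (∫ u, K u ^ 2) / h ^ d := by
  have := hf.isProbabilityMeasure
  obtain ⟨hKm, B, hB⟩ := hKb
  have hK2 : Integrable (fun u => K u ^ 2) volume := by
    simp_rw [pow_two]
    exact hKi.mul_bdd (c := B) hKm.aestronglyMeasurable (Eventually.of_forall hB)
  have hin : ∀ x, ∫ y, pairKernel K h (x, y) ^ 2 ∂(densityLaw f) ≤ M * (∫ u, K u ^ 2) / h ^ d := by
    intro x
    rw [hf.integral_densityLaw,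
      ← integral_sub_left_eq_self (fun y => f y * pairKernel K h (x, y) ^ 2) volume x]
    have e : ∀ z, pairKernel K h (x, x - z) ^ 2
        = (1 / h ^ d) ^ 2 * (fun u => K u ^ 2) (h⁻¹ • z) := by
      intro z
      simp only [pairKernel, scaledKernel, sub_sub_cancel, mul_pow]
    simp_rw [e]
    have hKh : Integrable (fun z => K (h⁻¹ • z) ^ 2) volume :=
      hK2.comp_smul (inv_ne_zero hh.ne')
    calc ∫ z, f (x - z) * ((1 / h ^ d) ^ 2 * K (h⁻¹ • z) ^ 2)
        ≤ ∫ z, M * (1 / h ^ d) ^ 2 * K (h⁻¹ • z) ^ 2 := by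
          refine integral_mono_of_nonneg (Eventually.of_forall fun z => ?_) (hKh.const_mul _)
            (Eventually.of_forall fun z => ?_)
          · have := hf.nonneg (x - z)
            simp only [Pi.zero_apply]
            positivity
          · simp only
            rw [mul_assoc M]
            exact mul_le_mul_of_nonneg_right (hf.le _) (by positivity)
      _ = M * (∫ u, K u ^ 2) / h ^ d := by
          rw [integral_const_mul, integral_scaled hh (fun u => K u ^ 2)]
          field_simp
  refine (BddMeas.integral_mono
    ((bddMeas_pairKernel ⟨hKm, B, hB⟩ h).sq.integral_right (densityLaw f))
    (BddMeas.const _) (densityLaw f) hin).trans (by simp)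

theorem tendsto_integral_smooth_sub_sq (hf : BoundedDensity f M) (hKm : Measurable K)
    (hKi : Integrable K volume) (hK1 : ∫ u, K u = 1) :
    Tendsto (fun h : ℝ => ∫ x, (smooth K h f x - f x) ^ 2 ∂(densityLaw f)) (𝓝 0) (𝓝 0) := by
  have := hf.isProbabilityMeasure
  have hlim := hf.tendsto_lintegral_smooth_sub_sq hKm hKi hK1
  have hle : ∀ h : ℝ, ENNReal.ofReal (∫ x, (smooth K h f x - f x) ^ 2 ∂(densityLaw f))
      ≤ ENNReal.ofReal M * ∫⁻ x, ENNReal.ofReal ((smooth K h f x - f x) ^ 2) := by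
    intro h
    have hb : BddMeas fun x => (smooth K h f x - f x) ^ 2 :=
      BddMeas.sq (BddMeas.sub ⟨hf.measurable_smooth hKm h, _, hf.abs_smooth_le hKi h⟩ hf.bddMeas)
    rw [ofReal_integral_eq_lintegral_ofReal (hb.integrable _)
      (Eventually.of_forall fun x => sq_nonneg _), densityLaw,
      lintegral_withDensity_eq_lintegral_mul _ hf.measurable_ofReal
        (g := fun x => ENNReal.ofReal ((smooth K h f x - f x) ^ 2))
        (ENNReal.measurable_ofReal.comp hb.measurable), ← lintegral_const_mul' _ _ (by simp)]
    refine lintegral_mono fun x => ?_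
    exact mul_le_mul_left (ENNReal.ofReal_le_ofReal (hf.le x)) _
  have hlim2 : Tendsto (fun h : ℝ => ENNReal.ofReal (∫ x, (smooth K h f x - f x) ^ 2 ∂(densityLaw f)))
      (𝓝 0) (𝓝 0) := by
    have h3 := ENNReal.Tendsto.const_mul (a := ENNReal.ofReal M) hlim (Or.inr (by simp))
    rw [mul_zero] at h3
    exact tendsto_of_tendsto_of_tendsto_of_le_of_le tendsto_const_nhds h3 (fun _ => zero_le) hle
  have h4 := (ENNReal.tendsto_toReal ENNReal.zero_ne_top).comp hlim2
  rw [ENNReal.toReal_zero] at h4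
  refine h4.congr fun h => ?_
  exact ENNReal.toReal_ofReal (integral_nonneg fun _ => sq_nonneg _)

end BoundedDensity

section Empirical

variable {n : ℕ}

theorem integral_empirical (x : Fin n → E d) (g : E d → ℝ) :
    ∫ y, g y ∂(empirical x) = 1 / n * ∑ i, g (x i) := by
  rw [empirical, integral_smul_measure, integral_finsetSum_measure]
  · simp [ENNReal.toReal_inv]
  · exact fun i _ => integrable_dirac (by simp [enorm_lt_top])

theorem isProbabilityMeasure_empirical (hn : 0 < n) (x : Fin n → E d) :
    IsProbabilityMeasure (empirical x) := by
  refine ⟨?_⟩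
  rw [empirical, Measure.smul_apply, Measure.finsetSum_apply]
  simp only [measure_univ, Finset.sum_const, Finset.card_univ, Fintype.card_fin, nsmul_eq_mul,
    mul_one, smul_eq_mul]
  exact ENNReal.inv_mul_cancel (by exact_mod_cast hn.ne') (by simp)

end Empirical

end AvgDensity

namespace AvgDensity

variable {d : ℕ}

/-! ### Almost uniform weights -/

/-- The total weight is half the sum of the `n` row plus column marginals. -/
theorem AlmostUniformWeights.abs_sum_sub_one_le {n : ℕ} {C : ℝ} {a : Fin n → Fin n → ℝ}
    (ha : AlmostUniformWeights n C a) (hn : 0 < n) : |(∑ i, ∑ j, a i j) - 1| ≤ C / 2 / n := by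
  have hn' : (0 : ℝ) < n := by exact_mod_cast hn
  have e : (∑ i, ∑ j, a i j) - 1
      = 1 / 2 * ∑ i, ((∑ j, a i j) + (∑ j, a j i) - 2 / n) := by
    rw [Finset.sum_sub_distrib, Finset.sum_add_distrib, Finset.sum_comm (f := fun i j => a j i),
      Finset.sum_const, Finset.card_univ, Fintype.card_fin, nsmul_eq_mul]
    field_simp
    ring
  rw [e, abs_mul, abs_of_pos (by norm_num)]
  have h := (Finset.abs_sum_le_sum_abs (fun i => (∑ j, a i j) + (∑ j, a j i) - 2 / (n : ℝ))
    Finset.univ).trans (Finset.sum_le_card_nsmul _ _ _ fun i _ => ha.marginal i)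
  rw [Finset.card_univ, Fintype.card_fin, nsmul_eq_mul] at h
  refine (mul_le_mul_of_nonneg_left h (by norm_num)).trans (le_of_eq ?_)
  field_simp

/-- The off-diagonal weights of the plug-in estimator. -/
noncomputable def uniformWeights (n : ℕ) (i j : Fin n) : ℝ := if i = j then 0 else 1 / (n : ℝ) ^ 2

theorem almostUniformWeights_uniform {n : ℕ} (hn : 0 < n) :
    AlmostUniformWeights n 2 (uniformWeights n) := by
  have hn' : (0 : ℝ) < n := by exact_mod_cast hn
  refine ⟨fun i => by simp [uniformWeights], fun i j => ?_, fun i => ?_⟩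
  · rw [uniformWeights]
    split_ifs
    · simp; positivity
    · rw [abs_of_pos (by positivity)]
      gcongr
      norm_num
  · have e1 : ∑ j, uniformWeights n i j = (n - 1) / (n : ℝ) ^ 2 := by
      simp only [uniformWeights]
      rw [Finset.sum_ite, Finset.sum_const_zero, zero_add, Finset.sum_const, nsmul_eq_mul,
        Finset.filter_ne, Finset.card_erase_of_mem (Finset.mem_univ i), Finset.card_univ,
        Fintype.card_fin, Nat.cast_pred hn]
      ring
    have e2 : ∑ j, uniformWeights n j i = ∑ j, uniformWeights n i j :=
      Finset.sum_congr rfl fun j _ => by simp only [uniformWeights, eq_comm]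
    rw [e2, e1]
    have : (n - 1) / (n : ℝ) ^ 2 + (n - 1) / (n : ℝ) ^ 2 - 2 / n = -(2 / (n : ℝ) ^ 2) := by
      field_simp
      ring
    rw [this, abs_neg, abs_of_pos (by positivity)]

/-- The plug-in estimator is the sum of its diagonal and a pair sum. -/
theorem mean_mean_eq_pairSum {α : Type*} {n : ℕ} (hn : 0 < n) {k : α × α → ℝ} {k₀ : ℝ}
    (hdiag : ∀ x, k (x, x) = k₀) (x : Fin n → α) :
    1 / (n : ℝ) * ∑ i, 1 / (n : ℝ) * ∑ j, k (x i, x j) = k₀ / n + pairSum (uniformWeights n) k x := by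
  have hn' : (0 : ℝ) < n := by exact_mod_cast hn
  have h1 : ∀ i, ∑ j, uniformWeights n i j * k (x i, x j)
      = 1 / (n : ℝ) ^ 2 * ((∑ j, k (x i, x j)) - k₀) := by
    intro i
    have : ∀ j, uniformWeights n i j * k (x i, x j)
        = 1 / (n : ℝ) ^ 2 * (k (x i, x j) - if i = j then k₀ else 0) := by
      intro j
      rw [uniformWeights]
      split_ifs with h
      · subst h; simp [hdiag]
      · ring
    simp_rw [this]
    rw [← Finset.mul_sum, Finset.sum_sub_distrib]
    simp
  rw [pairSum]
  simp_rw [h1]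
  rw [← Finset.mul_sum, ← Finset.mul_sum, Finset.sum_sub_distrib, Finset.sum_const,
    Finset.card_univ, Fintype.card_fin, nsmul_eq_mul]
  field_simp
  ring

/-! ### Probability bounds -/

theorem measureReal_lt_abs_le {β : Type*} [MeasurableSpace β] {Q : Measure β}
    [IsProbabilityMeasure Q] {Y : β → ℝ} (hY : BddMeas Y) {τ : ℝ} (hτ : 0 < τ) :
    Q.real {x | τ < |Y x|} ≤ (∫ x, Y x ^ 2 ∂Q) / τ ^ 2 := by
  rw [le_div_iff₀ (by positivity), mul_comm]
  refine le_trans (mul_le_mul_of_nonneg_left (measureReal_mono fun x hx => ?_) (by positivity))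
    (mul_meas_ge_le_integral_of_nonneg (Eventually.of_forall fun x => sq_nonneg (Y x))
      (hY.sq.integrable Q) (τ ^ 2))
  simp only [Set.mem_ofPred_eq] at hx ⊢
  rw [← sq_abs (Y x)]
  exact pow_le_pow_left₀ hτ.le hx.le 2

theorem measureReal_lt_le {β : Type*} [MeasurableSpace β] {Q : Measure β}
    [IsProbabilityMeasure Q] {Y : β → ℝ} (hY : BddMeas Y) (h0 : ∀ x, 0 ≤ Y x) {τ : ℝ} (hτ : 0 < τ) :
    Q.real {x | τ < Y x} ≤ (∫ x, Y x ∂Q) / τ := by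
  rw [le_div_iff₀ hτ, mul_comm]
  refine le_trans (mul_le_mul_of_nonneg_left (measureReal_mono fun x hx => ?_) hτ.le)
    (mul_meas_ge_le_integral_of_nonneg (Eventually.of_forall h0) (hY.integrable Q) τ)
  simp only [Set.mem_ofPred_eq] at hx ⊢
  exact hx.le

section Mean

variable {α : Type*} [MeasurableSpace α] {G : Measure α} [IsProbabilityMeasure G] {n : ℕ}

theorem bddMeas_mean {φ : α → ℝ} (hφ : BddMeas φ) :
    BddMeas fun x : Fin n → α => 1 / (n : ℝ) * ∑ i, φ (x i) :=
  (BddMeas.sum _ fun _ _ => hφ.comp (by fun_prop)).const_mul _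

theorem integral_mean_sq (hn : 0 < n) {φ : α → ℝ} (hφ : BddMeas φ) (h0 : ∫ t, φ t ∂G = 0) :
    ∫ x, (1 / (n : ℝ) * ∑ i, φ (x i)) ^ 2 ∂(Measure.pi fun _ : Fin n => G)
      = (∫ t, φ t ^ 2 ∂G) / n := by
  have hn' : (n : ℝ) ≠ 0 := by exact_mod_cast hn.ne'
  have := integral_linear_sq (n := n) hφ h0 (fun _ => 1 / (n : ℝ))
  simp_rw [← Finset.mul_sum] at this
  rw [this, Finset.sum_const, Finset.card_univ, Fintype.card_fin, nsmul_eq_mul]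
  field_simp

/-- The distribution function of a normalized pair sum, compared with the normal distribution. -/
theorem abs_measureReal_pairSum_sub_normalCdf_le {a : Fin n → Fin n → ℝ} {k : α × α → ℝ}
    (hk : BddMeas k) {q : α → ℝ} (hq : BddMeas q) {v : ℝ} (hv : 0 < v) {D δ c : ℝ} (hδ : 0 < δ)
    (hD : ∀ t, |(Measure.pi fun _ : Fin n => G).real
      {x | normSum (fun y => 2 * (q y - ∫ z, q z ∂G)) x ≤ t} - normalCdf v t| ≤ D) (t : ℝ) :
    |(Measure.pi fun _ : Fin n => G).real {x | √(n : ℝ) * (pairSum a k x - c) ≤ t} - normalCdf v t|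
      ≤ D + (∫ x, projectionError G a k q x ^ 2 ∂(Measure.pi fun _ => G)) / δ ^ 2
        + (√(2 * Real.pi * v))⁻¹ *
          (δ + |√(n : ℝ) * ((∑ i, ∑ j, a i j) * (∫ s, ∫ t, k (s, t) ∂G ∂G) - c)|) := by
  refine abs_measureReal_le_sub_normalCdf_le hv (by positivity) hD
    ((measureReal_mono fun x hx => ?_).trans
      (measureReal_lt_abs_le (bddMeas_projectionError hk a hq) hδ)) t
  simp only [Set.mem_ofPred_eq] at hx ⊢
  set b := √(n : ℝ) * ((∑ i, ∑ j, a i j) * (∫ s, ∫ t, k (s, t) ∂G ∂G) - c) with hb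
  have e : √(n : ℝ) * (pairSum a k x - c) - normSum (fun y => 2 * (q y - ∫ z, q z ∂G)) x
      = projectionError G a k q x + b := by
    rw [projectionError, hb]; ring
  rw [e] at hx
  have := abs_add_le (projectionError G a k q x) b
  linarith

end Mean

/-! ### The law of a sample -/

section Sample

variable {Ω : Type*} [MeasurableSpace Ω] {μ : Measure Ω}
  {X : ℕ → Ω → E d} {f : E d → ℝ}

theorem IsIIDSample.measurable_sample (hX : IsIIDSample μ X f) (n : ℕ) :
    Measurable (sample X n) :=
  measurable_pi_iff.2 fun i => hX.measurable i

theorem IsIIDSample.map_sample [IsProbabilityMeasure μ] (hX : IsIIDSample μ X f) (n : ℕ) :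
    μ.map (sample X n) = Measure.pi fun _ : Fin n => densityLaw f := by
  have h : iIndepFun (fun i : Fin n => X i) μ :=
    hX.indep.precomp (g := fun i : Fin n => (i : ℕ)) Fin.val_injective
  have h := (iIndepFun_iff_map_fun_eq_pi_map (f := fun i : Fin n => X i)
    fun i => (hX.measurable i).aemeasurable).1 h
  simp only [hX.law] at h
  exact h

theorem IsIIDSample.measureReal_sample [IsProbabilityMeasure μ] (hX : IsIIDSample μ X f) {n : ℕ} {s : Set (Fin n → E d)}
    (hs : MeasurableSet s) :
    μ.real {ω | sample X n ω ∈ s} = (Measure.pi fun _ : Fin n => densityLaw f).real s := by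
  rw [← hX.map_sample n, map_measureReal_apply (hX.measurable_sample n) hs]
  rfl

theorem IsIIDSample.boundedDensity [IsProbabilityMeasure μ] (hX : IsIIDSample μ X f) {M : ℝ} (hM : ∀ x, |f x| ≤ M) :
    BoundedDensity f M := by
  have hprob : IsProbabilityMeasure (densityLaw f) := by
    rw [← hX.law 0]
    exact Measure.isProbabilityMeasure_map (hX.measurable 0).aemeasurable
  have h1 : ∫⁻ x, ENNReal.ofReal (f x) = 1 := by
    have := hprob.measure_univ
    rwa [densityLaw, withDensity_apply _ MeasurableSet.univ, Measure.restrict_univ] at this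
  have hint : Integrable f volume := by
    refine ⟨hX.measurable_density.aestronglyMeasurable, ?_⟩
    rw [hasFiniteIntegral_iff_ofReal (Eventually.of_forall hX.density_nonneg), h1]
    exact ENNReal.one_lt_top
  refine ⟨hX.measurable_density, hX.density_nonneg, fun x => (le_abs_self _).trans (hM x), hint, ?_⟩
  rw [integral_eq_lintegral_of_nonneg_ae (Eventually.of_forall hX.density_nonneg)
    hX.measurable_density.aestronglyMeasurable, h1, ENNReal.toReal_one]

end Sample

end AvgDensity

namespace AvgDensity

variable {d : ℕ}

/-! ### Asymptotics under the bandwidth condition -/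

/-- The assumptions on the density, the kernel and the bandwidths. -/
structure RegularProblem (f : E d → ℝ) (M : ℝ) (K : E d → ℝ) (P s : ℝ) (h : ℕ → ℝ) : Prop where
  density : BoundedDensity f M
  kernel : ConditionK K P
  smooth_pos : 0 < s
  two_mul_not_nat : ∀ m : ℕ, 2 * s ≠ m
  besov : MemBesovTwoInfty s f
  bandwidth_pos : ∀ n, 0 < h n
  bandwidth : ConditionB d P s h
  bandwidth_tendsto : Tendsto h atTop (𝓝 0)

/-- The error, in mean square, of the kernel average as an estimator of `q` at the sample points,
plus the scaled mean of the squared kernel. -/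
noncomputable def empiricalError {α : Type*} (k : α × α → ℝ) (q : α → ℝ) {n : ℕ}
    (x : Fin n → α) : ℝ :=
  (1 / (n : ℝ) ^ 2 * ∑ i, ∑ j, k (x i, x j) ^ 2) / n
    + 1 / (n : ℝ) * ∑ i, (1 / (n : ℝ) * (∑ j, k (x i, x j)) - q (x i)) ^ 2

section EmpiricalError

variable {α : Type*} [MeasurableSpace α] {G : Measure α} [IsProbabilityMeasure G] {n : ℕ}
  {k : α × α → ℝ} {q : α → ℝ}

theorem empiricalError_nonneg {α : Type*} (k : α × α → ℝ) (q : α → ℝ) {n : ℕ} (x : Fin n → α) :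
    0 ≤ empiricalError k q x := by
  unfold empiricalError
  positivity

theorem bddMeas_pointError (hk : BddMeas k) (hq : BddMeas q) (i : Fin n) :
    BddMeas fun x : Fin n → α => (1 / (n : ℝ) * (∑ j, k (x i, x j)) - q (x i)) ^ 2 :=
  (((BddMeas.sum _ fun j _ => hk.comp (g := fun x : Fin n → α => (x i, x j))
    (by fun_prop)).const_mul _).sub (hq.comp (by fun_prop))).sq

theorem bddMeas_mean_sq (hk : BddMeas k) :
    BddMeas fun x : Fin n → α => 1 / (n : ℝ) ^ 2 * ∑ i, ∑ j, k (x i, x j) ^ 2 :=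
  (BddMeas.sum _ fun i _ => BddMeas.sum _ fun j _ =>
    (hk.comp (g := fun x : Fin n → α => (x i, x j)) (by fun_prop)).sq).const_mul _

theorem bddMeas_empiricalError (hk : BddMeas k) (hq : BddMeas q) :
    BddMeas (empiricalError k q : (Fin n → α) → ℝ) := by
  have h1 : BddMeas fun x : Fin n → α =>
      (1 / (n : ℝ) ^ 2 * ∑ i, ∑ j, k (x i, x j) ^ 2) / n := by
    simpa [div_eq_inv_mul] using (bddMeas_mean_sq (n := n) hk).const_mul ((n : ℝ)⁻¹)
  exact h1.add ((BddMeas.sum _ fun i _ => bddMeas_pointError hk hq i).const_mul _)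

/-- The term `k₀ / n` stems from the diagonal, which the empirical law charges and the density does
not; with `k₀ = K(0)/h^d` it vanishes once `n h^d → ∞`. The constants are `5 = 1 + 4` and `9 = 1 +
8`. -/
theorem integral_empiricalError_le (hn : 0 < n) (hk : BddMeas k) {k₀ : ℝ}
    (hdiag : ∀ x, k (x, x) = k₀) (hq : BddMeas q) :
    ∫ x, empiricalError k q x ∂(Measure.pi fun _ : Fin n => G)
      ≤ 5 * (k₀ / n) ^ 2 + 9 * ((∫ x, ∫ y, k (x, y) ^ 2 ∂G ∂G) / n)
        + 4 * ∫ x, ((∫ y, k (x, y) ∂G) - q x) ^ 2 ∂G := by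
  have hn' : (0 : ℝ) < n := by exact_mod_cast hn
  have hb := fun i => bddMeas_pointError (n := n) hk hq i
  have e : ∫ x, empiricalError k q x ∂(Measure.pi fun _ : Fin n => G)
      = (∫ x, (1 / (n : ℝ) ^ 2 * ∑ i, ∑ j, k (x i, x j) ^ 2) ∂(Measure.pi fun _ : Fin n => G)) / n
        + 1 / (n : ℝ) * ∑ i, ∫ x, (1 / (n : ℝ) * (∑ j, k (x i, x j)) - q (x i)) ^ 2
          ∂(Measure.pi fun _ : Fin n => G) := by
    simp only [empiricalError]
    rw [integral_add (((bddMeas_mean_sq hk).integrable _).div_const _)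
      (((BddMeas.sum _ fun i _ => hb i).const_mul _).integrable _), integral_div,
      integral_const_mul (1 / (n : ℝ)), integral_finsetSum _ fun i _ => (hb i).integrable _]
  rw [e]
  have h1 := div_le_div_of_nonneg_right (integral_mean_sq_le (G := G) hn hk hdiag) hn'.le
  have h2 := Finset.sum_le_card_nsmul _ _ _ fun i (_ : i ∈ Finset.univ) =>
    integral_average_sub_sq_le (G := G) hn hk hdiag hq i
  rw [Finset.card_univ, Fintype.card_fin, nsmul_eq_mul] at h2
  have h3 := mul_le_mul_of_nonneg_left h2 (show 0 ≤ 1 / (n : ℝ) by positivity)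
  refine (add_le_add h1 h3).trans (le_of_eq ?_)
  field_simp
  ring

end EmpiricalError

namespace RegularProblem

variable {f : E d → ℝ} {M : ℝ} {K : E d → ℝ} {P s : ℝ} {h : ℕ → ℝ}

theorem tendsto_inv (R : RegularProblem f M K P s h) :
    Tendsto (fun n : ℕ => 1 / ((n : ℝ) * h n ^ d)) atTop (𝓝 0) := by
  refine R.bandwidth.lower.inv_tendsto_atTop.congr fun n => ?_
  rw [Pi.inv_apply, one_div]

theorem tendsto_second_moment (R : RegularProblem f M K P s h) :
    Tendsto (fun n : ℕ => (∫ x, ∫ y, pairKernel K (h n) (x, y) ^ 2 ∂(densityLaw f)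
      ∂(densityLaw f)) / n) atTop (𝓝 0) := by
  have h1 := R.tendsto_inv.const_mul (M * ∫ u, K u ^ 2)
  rw [mul_zero] at h1
  refine squeeze_zero (fun n => div_nonneg (integral_nonneg fun _ => integral_nonneg fun _ =>
    sq_nonneg _) (Nat.cast_nonneg n)) (fun n => ?_) h1
  refine (div_le_div_of_nonneg_right (R.density.integral_pairKernel_sq_le R.kernel.bddMeas
    R.kernel.integrable_kernel (R.bandwidth_pos n)) (Nat.cast_nonneg n)).trans (le_of_eq ?_)
  rw [div_div, mul_comm (h n ^ d), mul_one_div]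

theorem tendsto_diag (R : RegularProblem f M K P s h) :
    Tendsto (fun n : ℕ => K 0 / h n ^ d / n) atTop (𝓝 0) := by
  have h1 := R.tendsto_inv.const_mul (K 0)
  rw [mul_zero] at h1
  refine h1.congr fun n => ?_
  rw [div_div, mul_comm (h n ^ d), mul_one_div]

theorem tendsto_smoothing_error (R : RegularProblem f M K P s h) :
    Tendsto (fun n : ℕ => ∫ x, ((∫ y, pairKernel K (h n) (x, y) ∂(densityLaw f)) - f x) ^ 2
      ∂(densityLaw f)) atTop (𝓝 0) := by
  have h1 := (R.density.tendsto_integral_smooth_sub_sq R.kernel.measurable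
    R.kernel.integrable_kernel R.kernel.integral_one).comp R.bandwidth_tendsto
  refine h1.congr fun n => ?_
  simp only [Function.comp_apply, R.density.integral_pairKernel R.kernel.even (R.bandwidth_pos n)]

theorem integral_pairKernel_eq (R : RegularProblem f M K P s h) (n : ℕ) :
    ∫ x, ∫ y, pairKernel K (h n) (x, y) ∂(densityLaw f) ∂(densityLaw f)
      = ∫ x, f x * smooth K (h n) f x := by
  simp only [R.density.integral_pairKernel R.kernel.even (R.bandwidth_pos n)]
  exact R.density.integral_densityLaw _

/-- The bias bound times `√n` is a multiple of `√n h^(2S)`, the square root of `n h^(4S)`. -/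
theorem tendsto_bias (R : RegularProblem f M K P s h) :
    Tendsto (fun n : ℕ => √(n : ℝ) * ((∫ x, ∫ y, pairKernel K (h n) (x, y) ∂(densityLaw f)
      ∂(densityLaw f)) - avgDensity f)) atTop (𝓝 0) := by
  obtain ⟨C, hC0, hC⟩ := R.density.exists_bias_bound R.kernel R.smooth_pos R.two_mul_not_nat R.besov
  have h1 := ((R.bandwidth.upper.sqrt).const_mul C)
  rw [Real.sqrt_zero, mul_zero] at h1
  refine squeeze_zero_norm (fun n => ?_) h1
  rw [R.integral_pairKernel_eq, R.density.avgDensity_eq, norm_mul, Real.norm_eq_abs,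
    Real.norm_eq_abs, abs_of_nonneg (Real.sqrt_nonneg _)]
  refine (mul_le_mul_of_nonneg_left (hC (h n) (R.bandwidth_pos n)) (Real.sqrt_nonneg _)).trans
    (le_of_eq ?_)
  have hp := R.bandwidth_pos n
  rw [Real.sqrt_mul (Nat.cast_nonneg n), Real.sqrt_eq_rpow (h n ^ _), ← Real.rpow_mul hp.le]
  have e : 4 * expS P s * (1 / 2) = 2 * expS P s := by ring
  rw [e]
  ring

theorem abs_integral_pairKernel_le (R : RegularProblem f M K P s h) (n : ℕ) :
    |∫ x, ∫ y, pairKernel K (h n) (x, y) ∂(densityLaw f) ∂(densityLaw f)|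
      ≤ M * ∫ u, |K u| := by
  have := R.density.isProbabilityMeasure
  simp only [R.density.integral_pairKernel R.kernel.even (R.bandwidth_pos n)]
  rw [← Real.norm_eq_abs]
  exact (norm_integral_le_of_norm_le_const (Eventually.of_forall fun x =>
    R.density.abs_smooth_le R.kernel.integrable_kernel (h n) x)).trans (by simp)

theorem tendsto_inv_sqrt : Tendsto (fun n : ℕ => (√(n : ℝ))⁻¹) atTop (𝓝 0) :=
  tendsto_inv_atTop_zero.comp (Real.tendsto_sqrt_atTop.comp tendsto_natCast_atTop_atTop)

/-- Changes of order `1/n` in the total weight are negligible. -/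
theorem tendsto_weight_error (R : RegularProblem f M K P s h) {C : ℝ} {w : ℕ → ℝ}
    (hw : ∀ᶠ n : ℕ in atTop, |w n| ≤ C / n) :
    Tendsto (fun n : ℕ => √(n : ℝ) * (w n * ∫ x, ∫ y, pairKernel K (h n) (x, y) ∂(densityLaw f)
      ∂(densityLaw f))) atTop (𝓝 0) := by
  have h1 := tendsto_inv_sqrt.const_mul (C * (M * ∫ u, |K u|))
  rw [mul_zero] at h1
  refine squeeze_zero_norm' ?_ h1
  filter_upwards [hw, eventually_gt_atTop 0] with n hn hn0
  have hn' : (0 : ℝ) < n := by exact_mod_cast hn0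
  rw [norm_mul, norm_mul, Real.norm_eq_abs, Real.norm_eq_abs, Real.norm_eq_abs,
    abs_of_nonneg (Real.sqrt_nonneg _)]
  have hC : 0 ≤ C / n := (abs_nonneg _).trans hn
  refine (mul_le_mul_of_nonneg_left (mul_le_mul hn (R.abs_integral_pairKernel_le n) (abs_nonneg _)
    hC) (Real.sqrt_nonneg _)).trans (le_of_eq ?_)
  have h2 : √(n : ℝ) * √(n : ℝ) = n := Real.mul_self_sqrt hn'.le
  have h3 : √(n : ℝ) ≠ 0 := (Real.sqrt_pos.2 hn').ne'
  field_simp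
  rw [pow_two, h2]
  ring

theorem tendsto_centering (R : RegularProblem f M K P s h) {C : ℝ} {w : ℕ → ℝ}
    (hw : ∀ᶠ n : ℕ in atTop, |w n - 1| ≤ C / n) :
    Tendsto (fun n : ℕ => √(n : ℝ) * (w n * (∫ x, ∫ y, pairKernel K (h n) (x, y) ∂(densityLaw f)
      ∂(densityLaw f)) - avgDensity f)) atTop (𝓝 0) := by
  have h1 := (R.tendsto_weight_error hw).add R.tendsto_bias
  rw [add_zero] at h1
  refine h1.congr fun n => ?_
  ring

theorem tendsto_projectionError (R : RegularProblem f M K P s h) {C : ℝ}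
    {a : (n : ℕ) → Fin n → Fin n → ℝ} (ha : ∀ᶠ n in atTop, AlmostUniformWeights n C (a n)) :
    Tendsto (fun n : ℕ => ∫ x, projectionError (densityLaw f) (a n) (pairKernel K (h n)) f x ^ 2
      ∂(Measure.pi fun _ : Fin n => densityLaw f)) atTop (𝓝 0) := by
  have := R.density.isProbabilityMeasure
  have h1 := (R.tendsto_second_moment.const_mul (99 * C ^ 2)).add
    (R.tendsto_smoothing_error.const_mul 12)
  rw [mul_zero, mul_zero, add_zero] at h1
  refine squeeze_zero' (Eventually.of_forall fun n => integral_nonneg fun _ => sq_nonneg _) ?_ h1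
  filter_upwards [ha, eventually_gt_atTop 0] with n hn hn0
  exact integral_projectionError_sq_le hn hn0 (bddMeas_pairKernel R.kernel.bddMeas _)
    (pairKernel_symm R.kernel.even _) R.density.bddMeas

theorem tendsto_empiricalError (R : RegularProblem f M K P s h) :
    Tendsto (fun n : ℕ => ∫ x, empiricalError (pairKernel K (h n)) f x
      ∂(Measure.pi fun _ : Fin n => densityLaw f)) atTop (𝓝 0) := by
  have := R.density.isProbabilityMeasure
  have h1 := (((R.tendsto_diag.pow 2).const_mul 5).add (R.tendsto_second_moment.const_mul 9)).add
    (R.tendsto_smoothing_error.const_mul 4)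
  norm_num at h1
  refine squeeze_zero' (Eventually.of_forall fun n => integral_nonneg fun _ =>
    empiricalError_nonneg _ _ _) ?_ h1
  filter_upwards [eventually_gt_atTop 0] with n hn0
  have := integral_empiricalError_le (G := densityLaw f) hn0
    (bddMeas_pairKernel R.kernel.bddMeas (h n)) (pairKernel_diag K (h n)) R.density.bddMeas
  simpa using this

end RegularProblem

/-! ### The variance of the linear part -/

section Variance

variable {f : E d → ℝ}

theorem BoundedDensity.varianceBound_eq {M : ℝ} (hf : BoundedDensity f M) :
    varianceBound f = ∫ x, (2 * (f x - avgDensity f)) ^ 2 ∂(densityLaw f) := by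
  have := hf.isProbabilityMeasure
  have hb : BddMeas (influence f) := (hf.bddMeas.sub (BddMeas.const _)).const_mul 2
  have h0 : ∫ x, influence f x ∂(densityLaw f) = 0 := by
    simp only [influence]
    rw [integral_const_mul, integral_sub (hf.bddMeas.integrable _) ((BddMeas.const _).integrable _)]
    simp [avgDensity]
  rw [varianceBound, variance_eq_integral hb.measurable.aemeasurable, h0]
  simp only [sub_zero, influence]

/-- Recentring from the empirical to the true mean costs four times a squared average, so two
applications of the weak law of large numbers make the empirical variance consistent. -/
theorem empirical_variance_sub {n : ℕ} (hn : 0 < n) (x : Fin n → E d) :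
    (∫ y, (2 * (f y - ∫ z, f z ∂(empirical x))) ^ 2 ∂(empirical x)) - varianceBound f
      = 1 / (n : ℝ) * (∑ i, ((2 * (f (x i) - avgDensity f)) ^ 2 - varianceBound f))
        - 4 * (1 / (n : ℝ) * ∑ i, (f (x i) - avgDensity f)) ^ 2 := by
  have hn' : (n : ℝ) ≠ 0 := by exact_mod_cast hn.ne'
  set m := 1 / (n : ℝ) * ∑ i, (f (x i) - avgDensity f) with hm
  have e1 : ∫ z, f z ∂(empirical x) = avgDensity f + m := by
    rw [integral_empirical, hm, Finset.sum_sub_distrib, Finset.sum_const, Finset.card_univ,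
      Fintype.card_fin, nsmul_eq_mul]
    field_simp
    ring
  have e2 : ∀ i, (2 * (f (x i) - (avgDensity f + m))) ^ 2
      = ((2 * (f (x i) - avgDensity f)) ^ 2 - varianceBound f) - 8 * m * (f (x i) - avgDensity f)
        + (varianceBound f + 4 * m ^ 2) := fun i => by ring
  rw [e1, integral_empirical]
  simp_rw [e2]
  rw [Finset.sum_add_distrib, Finset.sum_sub_distrib, ← Finset.mul_sum, Finset.sum_const,
    Finset.card_univ, Fintype.card_fin, nsmul_eq_mul, mul_add, mul_sub (1 / (n : ℝ))]
  have e3 : 1 / (n : ℝ) * (8 * m * ∑ i, (f (x i) - avgDensity f)) = 8 * m * m := by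
    rw [hm]; ring
  have e4 : 1 / (n : ℝ) * (n * (varianceBound f + 4 * m ^ 2)) = varianceBound f + 4 * m ^ 2 := by
    field_simp
  rw [e3, e4]
  ring

end Variance

end AvgDensity

namespace AvgDensity

variable {d : ℕ}

/-! ### Distribution functions under the density and under the empirical distribution -/

section Clt

variable {f : E d → ℝ} {M : ℝ}

/-- The central limit theorem for centered sums of `f`, uniformly in the distribution. -/
theorem BoundedDensity.exists_uniform_clt (hf : BoundedDensity f M) {v : ℝ} (hv : 0 < v) {ε : ℝ}
    (hε : 0 < ε) :
    ∃ δ > 0, ∃ N : ℕ, ∀ n ≥ N, ∀ G : Measure (E d), IsProbabilityMeasure G →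
      |(∫ y, (2 * (f y - ∫ z, f z ∂G)) ^ 2 ∂G) - v| < δ →
      ∀ t, |(Measure.pi fun _ : Fin n => G).real
        {x | normSum (fun y => 2 * (f y - ∫ z, f z ∂G)) x ≤ t} - normalCdf v t| ≤ ε := by
  obtain ⟨δ, hδ, N, hN⟩ := AvgDensity.exists_uniform_clt (d := d) hv (4 * M) hε
  refine ⟨δ, hδ, N, fun n hn G hG hvar => hN n hn G _ hG
    ((hf.measurable.sub_const _).const_mul 2) (fun x => ?_) ?_ hvar⟩
  · have h1 : |∫ z, f z ∂G| ≤ M := by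
      rw [← Real.norm_eq_abs]
      exact (norm_integral_le_of_norm_le_const (Eventually.of_forall hf.abs_le)).trans (by simp)
    have h2 := abs_sub (f x) (∫ z, f z ∂G)
    have h3 := hf.abs_le x
    rw [abs_mul, abs_of_pos (by norm_num : (0 : ℝ) < 2)]
    linarith
  · rw [integral_const_mul, integral_sub (hf.bddMeas.integrable _) ((BddMeas.const _).integrable _)]
    simp

end Clt

section Bootstrap

variable {f : E d → ℝ} {k : E d × E d → ℝ} {n : ℕ}

theorem integral_integral_empirical (x : Fin n → E d) (g : E d × E d → ℝ) :
    ∫ s, ∫ t, g (s, t) ∂(empirical x) ∂(empirical x)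
      = 1 / (n : ℝ) * ∑ i, 1 / (n : ℝ) * ∑ j, g (x i, x j) := by
  simp only [integral_empirical]

/-- The projection bound with `G` the empirical law. The function projected on is still the true
`f`, so that its second term is the error of the density estimator at the sample points. -/
theorem integral_projectionError_empirical_le {C : ℝ} {a : Fin n → Fin n → ℝ}
    (ha : AlmostUniformWeights n C a) (hn : 0 < n) (hk : BddMeas k)
    (hsymm : ∀ x y, k (x, y) = k (y, x)) (hf : BddMeas f) (x : Fin n → E d) :
    ∫ y, projectionError (empirical x) a k f y ^ 2 ∂(Measure.pi fun _ => empirical x)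
      ≤ (99 * C ^ 2 + 12) * empiricalError k f x := by
  have := isProbabilityMeasure_empirical hn x
  refine (integral_projectionError_sq_le (G := empirical x) ha hn hk hsymm hf).trans ?_
  rw [integral_integral_empirical x fun p => k p ^ 2]
  simp only [integral_empirical]
  have e : 1 / (n : ℝ) * ∑ i, 1 / (n : ℝ) * ∑ j, k (x i, x j) ^ 2
      = 1 / (n : ℝ) ^ 2 * ∑ i, ∑ j, k (x i, x j) ^ 2 := by
    rw [← Finset.mul_sum]; ring
  rw [e, empiricalError]
  have h1 : 0 ≤ (1 / (n : ℝ) ^ 2 * ∑ i, ∑ j, k (x i, x j) ^ 2) / n := by positivity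
  have h2 : 0 ≤ 1 / (n : ℝ) * ∑ i, (1 / (n : ℝ) * (∑ j, k (x i, x j)) - f (x i)) ^ 2 := by
    positivity
  nlinarith [sq_nonneg C, mul_nonneg (sq_nonneg C) h2]

/-- Cauchy–Schwarz over the `n²` pairs. It lets `empiricalError` also control the plug-in value,
which need not be bounded, once divided by `√n`. -/
theorem mean_mean_sq_le (x : Fin n → E d) :
    (1 / (n : ℝ) * ∑ i, 1 / (n : ℝ) * ∑ j, k (x i, x j)) ^ 2 / n ≤ empiricalError k f x := by
  rcases Nat.eq_zero_or_pos n with rfl | hn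
  · simp [empiricalError]
  have hn' : (0 : ℝ) < n := by exact_mod_cast hn
  have h1 : (∑ i, ∑ j, k (x i, x j)) ^ 2 ≤ (n : ℝ) ^ 2 * ∑ i, ∑ j, k (x i, x j) ^ 2 := by
    have h := sq_sum_le_card_mul_sum_sq (s := (Finset.univ : Finset (Fin n × Fin n)))
      (f := fun p => k (x p.1, x p.2))
    rw [Fintype.sum_prod_type, Fintype.sum_prod_type] at h
    refine h.trans (le_of_eq ?_)
    rw [Finset.card_univ, Fintype.card_prod, Fintype.card_fin]
    push_cast
    ring
  have e : (1 / (n : ℝ) * ∑ i, 1 / (n : ℝ) * ∑ j, k (x i, x j)) ^ 2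
      = 1 / (n : ℝ) ^ 4 * (∑ i, ∑ j, k (x i, x j)) ^ 2 := by
    rw [← Finset.mul_sum]; ring
  have h2 : (1 / (n : ℝ) * ∑ i, 1 / (n : ℝ) * ∑ j, k (x i, x j)) ^ 2
      ≤ 1 / (n : ℝ) ^ 2 * ∑ i, ∑ j, k (x i, x j) ^ 2 := by
    rw [e]
    refine (mul_le_mul_of_nonneg_left h1 (by positivity)).trans (le_of_eq ?_)
    field_simp
  rw [empiricalError]
  have h3 : 0 ≤ 1 / (n : ℝ) * ∑ i, (1 / (n : ℝ) * (∑ j, k (x i, x j)) - f (x i)) ^ 2 := by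
    positivity
  exact (div_le_div_of_nonneg_right h2 hn'.le).trans (le_add_of_nonneg_right h3)

/-- The bootstrap centering of a pair sum, compared with its value at the sample. -/
theorem abs_bootstrap_centering_le {C : ℝ} (hC : 0 ≤ C) {a : Fin n → Fin n → ℝ}
    (ha : AlmostUniformWeights n C a) (hn : 0 < n) {k₀ : ℝ} (hdiag : ∀ x, k (x, x) = k₀)
    (G : Measure (E d)) (x : Fin n → E d) (κ : ℝ) {η : ℝ} (hη : 0 ≤ η)
    (hx : empiricalError k f x ≤ η ^ 2) :
    |√(n : ℝ) * ((∑ i, ∑ j, a i j) * (∫ s, ∫ t, k (s, t) ∂(empirical x) ∂(empirical x))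
        - (κ + pairSum a k x))|
      ≤ C / 2 * η + |√(n : ℝ) * (κ - k₀ / n)| + |projectionError G (uniformWeights n) k f x|
        + |projectionError G a k f x| + |√(n : ℝ) * (((∑ i, ∑ j, uniformWeights n i j)
          - ∑ i, ∑ j, a i j) * ∫ s, ∫ t, k (s, t) ∂G ∂G)| := by
  have hn' : (0 : ℝ) < n := by exact_mod_cast hn
  rw [integral_integral_empirical]
  set V := 1 / (n : ℝ) * ∑ i, 1 / (n : ℝ) * ∑ j, k (x i, x j) with hV
  have hV2 : V ^ 2 / n ≤ η ^ 2 := (mean_mean_sq_le x).trans hx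
  have hVe := mean_mean_eq_pairSum hn hdiag x
  rw [← hV] at hVe
  set A := ∑ i, ∑ j, a i j with hA
  have h1 : |√(n : ℝ) * ((A - 1) * V)| ≤ C / 2 * η := by
    refine abs_le_of_sq_le_sq ?_ (by positivity)
    have h2 := ha.abs_sum_sub_one_le hn
    rw [← hA] at h2
    have h3 : (A - 1) ^ 2 ≤ (C / 2 / n) ^ 2 := by
      rw [← sq_abs (A - 1)]; exact pow_le_pow_left₀ (abs_nonneg _) h2 2
    rw [mul_pow, mul_pow, Real.sq_sqrt hn'.le]
    calc (n : ℝ) * ((A - 1) ^ 2 * V ^ 2) ≤ n * ((C / 2 / n) ^ 2 * V ^ 2) := by gcongr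
      _ = (C / 2) ^ 2 * (V ^ 2 / n) := by field_simp
      _ ≤ (C / 2) ^ 2 * η ^ 2 := by gcongr
      _ = (C / 2 * η) ^ 2 := by ring
  -- `V` is the diagonal plus the uniformly weighted pair sum. That pair sum and the one with
  -- weights `a` share their linear projection under `G`, so their difference reduces to projection
  -- errors and total weights.
  have e : √(n : ℝ) * (A * V - (κ + pairSum a k x))
      = √(n : ℝ) * ((A - 1) * V) + (-(√(n : ℝ) * (κ - k₀ / n)))
        + projectionError G (uniformWeights n) k f x + (-projectionError G a k f x)
        + √(n : ℝ) * (((∑ i, ∑ j, uniformWeights n i j) - A) * ∫ s, ∫ t, k (s, t) ∂G ∂G) := by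
    have e1 : A * V = (A - 1) * V + (k₀ / n + pairSum (uniformWeights n) k x) := by
      rw [← hVe]; ring
    rw [e1, projectionError, projectionError, ← hA]
    ring
  rw [e]
  refine (abs_add_le _ _).trans (add_le_add ((abs_add_le _ _).trans (add_le_add
    ((abs_add_le _ _).trans (add_le_add ((abs_add_le _ _).trans (add_le_add h1 ?_)) le_rfl)) ?_))
    le_rfl)
  · rw [abs_neg]
  · rw [abs_neg]

end Bootstrap

/-! ### Bootstrap consistency of weighted pair sums -/

theorem tendsto_measureReal_lt_abs {β : ℕ → Type*} [∀ n, MeasurableSpace (β n)]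
    {Q : (n : ℕ) → Measure (β n)} [∀ n, IsProbabilityMeasure (Q n)] {Y : (n : ℕ) → β n → ℝ}
    (hY : ∀ n, BddMeas (Y n)) (h : Tendsto (fun n => ∫ x, Y n x ^ 2 ∂(Q n)) atTop (𝓝 0))
    {τ : ℝ} (hτ : 0 < τ) : Tendsto (fun n => (Q n).real {x | τ < |Y n x|}) atTop (𝓝 0) := by
  have h1 := h.div_const (τ ^ 2)
  rw [zero_div] at h1
  exact squeeze_zero (fun n => measureReal_nonneg) (fun n => measureReal_lt_abs_le (hY n) hτ) h1

theorem tendsto_measureReal_lt {β : ℕ → Type*} [∀ n, MeasurableSpace (β n)]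
    {Q : (n : ℕ) → Measure (β n)} [∀ n, IsProbabilityMeasure (Q n)] {Y : (n : ℕ) → β n → ℝ}
    (hY : ∀ n, BddMeas (Y n)) (h0 : ∀ n x, 0 ≤ Y n x)
    (h : Tendsto (fun n => ∫ x, Y n x ∂(Q n)) atTop (𝓝 0))
    {τ : ℝ} (hτ : 0 < τ) : Tendsto (fun n => (Q n).real {x | τ < Y n x}) atTop (𝓝 0) := by
  have h1 := h.div_const τ
  rw [zero_div] at h1
  exact squeeze_zero (fun n => measureReal_nonneg) (fun n => measureReal_lt_le (hY n) (h0 n) hτ) h1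

theorem tendsto_measureReal_lt_abs_mean {α : Type*} [MeasurableSpace α] {G : Measure α}
    [IsProbabilityMeasure G] {φ : α → ℝ} (hφ : BddMeas φ) (h0 : ∫ t, φ t ∂G = 0) {τ : ℝ}
    (hτ : 0 < τ) :
    Tendsto (fun n : ℕ => (Measure.pi fun _ : Fin n => G).real
      {x | τ < |1 / (n : ℝ) * ∑ i, φ (x i)|}) atTop (𝓝 0) := by
  refine tendsto_measureReal_lt_abs (fun n => bddMeas_mean hφ) ?_ hτ
  refine (tendsto_const_div_atTop_nhds_zero_nat (∫ t, φ t ^ 2 ∂G)).congr' ?_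
  filter_upwards [eventually_gt_atTop 0] with n hn
  rw [integral_mean_sq hn hφ h0]

theorem bootstrapDist_le {Ω : Type*} [MeasurableSpace Ω] {μ : Measure Ω} {X : ℕ → Ω → E d}
    {θ₀ : ℝ} {T : (n : ℕ) → (Fin n → E d) → ℝ} {n : ℕ} {ω : Ω} {F : ℝ → ℝ} {D₁ D₂ : ℝ}
    (h1 : ∀ t, |μ.real {ω' | √(n : ℝ) * (T n (sample X n ω') - θ₀) ≤ t} - F t| ≤ D₁)
    (h2 : ∀ t, |(bootstrapLaw (sample X n ω)).real
      {y | √(n : ℝ) * (T n y - T n (sample X n ω)) ≤ t} - F t| ≤ D₂) :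
    |bootstrapDist μ X θ₀ T n ω| ≤ D₁ + D₂ := by
  rw [bootstrapDist, abs_of_nonneg (Real.iSup_nonneg fun t => abs_nonneg _)]
  refine ciSup_le fun t => ?_
  have e := abs_sub_le (μ.real {ω' | √(n : ℝ) * (T n (sample X n ω') - θ₀) ≤ t}) (F t)
    ((bootstrapLaw (sample X n ω)).real {y | √(n : ℝ) * (T n y - T n (sample X n ω)) ≤ t})
  refine e.trans (add_le_add (h1 t) ?_)
  rw [abs_sub_comm]
  exact h2 t

namespace RegularProblem

variable {f : E d → ℝ} {M : ℝ} {K : E d → ℝ} {P s : ℝ} {h : ℕ → ℝ}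

/-- The normal approximation of a weighted pair sum. -/
theorem eventually_abs_sub_normalCdf_le (R : RegularProblem f M K P s h)
    (hv : 0 < varianceBound f) {C : ℝ} {a : (n : ℕ) → Fin n → Fin n → ℝ}
    (ha : ∀ᶠ n in atTop, AlmostUniformWeights n C (a n)) {ε : ℝ} (hε : 0 < ε) :
    ∀ᶠ n : ℕ in atTop, ∀ t, |(Measure.pi fun _ : Fin n => densityLaw f).real
      {x | √(n : ℝ) * (pairSum (a n) (pairKernel K (h n)) x - avgDensity f) ≤ t}
        - normalCdf (varianceBound f) t| ≤ ε := by
  have := R.density.isProbabilityMeasure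
  set L := (√(2 * Real.pi * varianceBound f))⁻¹ with hL
  have hL0 : 0 < L := by positivity
  obtain ⟨δ₁, hδ₁, N, hN⟩ := R.density.exists_uniform_clt hv (ε := ε / 3) (by positivity)
  -- Two displacements of size `δ`, one for the projection error and one for the centring, then move
  -- the normal distribution function by at most `ε / 3`.
  set δ := ε / (6 * L) with hδ
  have hδ0 : 0 < δ := by positivity
  have hLδ : L * (δ + δ) = ε / 3 := by
    rw [hδ]; field_simp; ring
  have hcen := R.tendsto_centering (C := C / 2) (w := fun n => ∑ i, ∑ j, a n i j) (by
    filter_upwards [ha, eventually_gt_atTop 0] with n hn hn0 using hn.abs_sum_sub_one_le hn0)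
  filter_upwards [eventually_ge_atTop N,
    (R.tendsto_projectionError ha).eventually (gt_mem_nhds (show 0 < ε / 3 * δ ^ 2 by positivity)),
    hcen.abs.eventually (gt_mem_nhds (show |(0 : ℝ)| < δ by simpa using hδ0))] with n hn h1 h2 t
  have h3 := abs_measureReal_pairSum_sub_normalCdf_le (a := a n)
    (bddMeas_pairKernel R.kernel.bddMeas (h n)) R.density.bddMeas hv (c := avgDensity f) hδ0
    (hN n hn (densityLaw f) this (by
      rw [R.density.varianceBound_eq]; simpa [avgDensity] using hδ₁)) t
  refine h3.trans ?_
  rw [← hL]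
  have h4 : (∫ x, projectionError (densityLaw f) (a n) (pairKernel K (h n)) f x ^ 2
      ∂(Measure.pi fun _ => densityLaw f)) / δ ^ 2 ≤ ε / 3 :=
    (div_le_iff₀ (by positivity)).2 h1.le
  have h5 := mul_le_mul_of_nonneg_left (add_le_add_right h2.le δ) hL0.le
  linarith

/-- The bootstrap distribution of a weighted pair sum is close to the normal distribution when the
data are typical. -/
theorem exists_typical (R : RegularProblem f M K P s h)
    (hv : 0 < varianceBound f) {C : ℝ} (hC : 0 ≤ C) {a : (n : ℕ) → Fin n → Fin n → ℝ}
    (ha : ∀ᶠ n in atTop, AlmostUniformWeights n C (a n)) {κ : ℕ → ℝ}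
    (hκ : Tendsto (fun n : ℕ => √(n : ℝ) * (κ n - K 0 / h n ^ d / n)) atTop (𝓝 0))
    {ε : ℝ} (hε : 0 < ε) :
    ∃ A : (n : ℕ) → Set (Fin n → E d), (∀ n, MeasurableSet (A n)) ∧
      Tendsto (fun n => (Measure.pi fun _ : Fin n => densityLaw f).real (A n)) atTop (𝓝 0) ∧
      ∀ᶠ n : ℕ in atTop, ∀ x ∉ A n, ∀ t, |(Measure.pi fun _ : Fin n => empirical x).real
        {y | √(n : ℝ) * (pairSum (a n) (pairKernel K (h n)) y
          - (κ n + pairSum (a n) (pairKernel K (h n)) x)) ≤ t}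
          - normalCdf (varianceBound f) t| ≤ ε := by
  have hG := R.density.isProbabilityMeasure
  set v := varianceBound f with hv_def
  set L := (√(2 * Real.pi * v))⁻¹ with hL
  have hL0 : 0 < L := by positivity
  obtain ⟨δ₁, hδ₁, N, hN⟩ := R.density.exists_uniform_clt hv (ε := ε / 3) (by positivity)
  set δ := ε / (6 * L) with hδ
  have hδ0 : 0 < δ := by positivity
  have hLδ : L * (δ + δ) = ε / 3 := by
    rw [hδ]; field_simp; ring
  -- The first bound makes Chebyshev's inequality under the bootstrap law cost at most `ε / 3`; the
  -- second keeps the effect of total weight different from one below `δ / 8`.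
  obtain ⟨η, hη0, hη1, hη2⟩ : ∃ η : ℝ, 0 < η ∧ (99 * C ^ 2 + 12) * η ^ 2 ≤ ε / 3 * δ ^ 2 ∧
      C / 2 * η ≤ δ / 8 := by
    have e1 : Tendsto (fun η : ℝ => (99 * C ^ 2 + 12) * η ^ 2) (𝓝[>] 0) (𝓝 0) :=
      ((by fun_prop : Continuous fun η : ℝ => (99 * C ^ 2 + 12) * η ^ 2).tendsto' 0 0
        (by simp)).mono_left nhdsWithin_le_nhds
    have e2 : Tendsto (fun η : ℝ => C / 2 * η) (𝓝[>] 0) (𝓝 0) :=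
      ((by fun_prop : Continuous fun η : ℝ => C / 2 * η).tendsto' 0 0
        (by simp)).mono_left nhdsWithin_le_nhds
    obtain ⟨η, h1, h2, h3⟩ := ((e1.eventually
      (gt_mem_nhds (show 0 < ε / 3 * δ ^ 2 by positivity))).and ((e2.eventually
      (gt_mem_nhds (show 0 < δ / 8 by positivity))).and self_mem_nhdsWithin)).exists
    exact ⟨η, h3, h1.le, h2.le⟩
  -- The averages of `φ` and `ψ` are the two that govern the empirical variance in
  -- `empirical_variance_sub`.
  set φ : E d → ℝ := fun y => (2 * (f y - avgDensity f)) ^ 2 - v with hφ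
  set ψ : E d → ℝ := fun y => f y - avgDensity f with hψ
  have hψb : BddMeas ψ := R.density.bddMeas.sub (BddMeas.const _)
  have hφb : BddMeas φ := (hψb.const_mul 2).sq.sub (BddMeas.const _)
  have hψ0 : ∫ y, ψ y ∂(densityLaw f) = 0 := by
    rw [hψ, integral_sub (R.density.bddMeas.integrable _) ((BddMeas.const _).integrable _)]
    simp [avgDensity]
  have hφ0 : ∫ y, φ y ∂(densityLaw f) = 0 := by
    rw [hφ, integral_sub ((hψb.const_mul 2).sq.integrable _) ((BddMeas.const _).integrable _),
      ← R.density.varianceBound_eq]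
    simp [hv_def]
  have hk := fun n => bddMeas_pairKernel R.kernel.bddMeas (h n)
  have hU : ∀ᶠ n in atTop, AlmostUniformWeights n 2 (uniformWeights n) := by
    filter_upwards [eventually_gt_atTop 0] with n hn using almostUniformWeights_uniform hn
  have hE := fun n => bddMeas_empiricalError (n := n) (hk n) R.density.bddMeas
  have hR := fun n => bddMeas_projectionError (G := densityLaw f) (hk n) (a n) R.density.bddMeas
  have hRU := fun n => bddMeas_projectionError (G := densityLaw f) (hk n) (uniformWeights n)
    R.density.bddMeas
  have hm1 := fun n => bddMeas_mean (n := n) hφb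
  have hm2 := fun n => bddMeas_mean (n := n) hψb
  -- Then `4 * τ ^ 2 = δ₁ / 4`, which with `δ₁ / 4` for the average of `φ` stays below `δ₁`.
  set τ := √δ₁ / 4 with hτ
  have hτ0 : 0 < τ := by positivity
  have t1 := tendsto_measureReal_lt hE (fun n x => empiricalError_nonneg _ _ x)
    R.tendsto_empiricalError (show 0 < η ^ 2 by positivity)
  have t2 := tendsto_measureReal_lt_abs hR (R.tendsto_projectionError ha)
    (show 0 < δ / 8 by positivity)
  have t3 := tendsto_measureReal_lt_abs hRU (R.tendsto_projectionError hU)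
    (show 0 < δ / 8 by positivity)
  have t4 := tendsto_measureReal_lt_abs_mean hφb hφ0 (show 0 < δ₁ / 4 by positivity)
  have t5 := tendsto_measureReal_lt_abs_mean hψb hψ0 hτ0
  -- The exceptional data form a union of five events whose probabilities vanish under the true law.
  -- Off it, every bound on the bootstrap law is deterministic.
  refine ⟨fun n => {x | η ^ 2 < empiricalError (pairKernel K (h n)) f x} ∪
    ({x | δ / 8 < |projectionError (densityLaw f) (a n) (pairKernel K (h n)) f x|} ∪
    ({x | δ / 8 < |projectionError (densityLaw f) (uniformWeights n) (pairKernel K (h n)) f x|} ∪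
    ({x | δ₁ / 4 < |1 / (n : ℝ) * ∑ i, φ (x i)|} ∪ {x | τ < |1 / (n : ℝ) * ∑ i, ψ (x i)|}))),
    fun n => ?_, ?_, ?_⟩
  · have habs : Measurable fun r : ℝ => |r| := measurable_norm
    exact (measurableSet_lt measurable_const (hE n).measurable).union
      ((measurableSet_lt measurable_const (habs.comp (hR n).measurable)).union
      ((measurableSet_lt measurable_const (habs.comp (hRU n).measurable)).union
      ((measurableSet_lt measurable_const (habs.comp (hm1 n).measurable)).union
      (measurableSet_lt measurable_const (habs.comp (hm2 n).measurable)))))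
  · have t := t1.add (t2.add (t3.add (t4.add t5)))
    simp only [add_zero] at t
    refine squeeze_zero (fun n => measureReal_nonneg) (fun n => ?_) t
    refine (measureReal_union_le _ _).trans (add_le_add le_rfl ?_)
    refine (measureReal_union_le _ _).trans (add_le_add le_rfl ?_)
    refine (measureReal_union_le _ _).trans (add_le_add le_rfl ?_)
    exact measureReal_union_le _ _
  have hw : ∀ᶠ n : ℕ in atTop, |(∑ i, ∑ j, uniformWeights n i j) - ∑ i, ∑ j, a n i j|
      ≤ (1 + C / 2) / n := by
    filter_upwards [ha, hU, eventually_gt_atTop 0] with n h1 h2 hn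
    have h3 := h1.abs_sum_sub_one_le hn
    have h4 := h2.abs_sum_sub_one_le hn
    have h5 := abs_sub_le (∑ i, ∑ j, uniformWeights n i j) 1 (∑ i, ∑ j, a n i j)
    rw [abs_sub_comm 1] at h5
    refine h5.trans ((add_le_add h4 h3).trans (le_of_eq ?_))
    ring
  have hz : |(0 : ℝ)| < δ / 8 := by rw [abs_zero]; positivity
  filter_upwards [ha, eventually_ge_atTop N, eventually_gt_atTop 0,
    hκ.abs.eventually (gt_mem_nhds hz),
    (R.tendsto_weight_error hw).abs.eventually (gt_mem_nhds hz)] with n han hn hn0 hκn hwn x hx t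
  simp only [Set.mem_union, Set.mem_ofPred_eq, not_or, not_lt] at hx
  obtain ⟨x1, x2, x3, x4, x5⟩ := hx
  have hP := isProbabilityMeasure_empirical hn0 x
  have hcl := hN n hn (empirical x) hP (by
    rw [empirical_variance_sub hn0 x]
    have e1 : (1 / (n : ℝ) * ∑ i, ψ (x i)) ^ 2 ≤ τ ^ 2 := by
      rw [← sq_abs]; exact pow_le_pow_left₀ (abs_nonneg _) x5 2
    have e2 : τ ^ 2 = δ₁ / 16 := by
      rw [hτ, div_pow, Real.sq_sqrt hδ₁.le]; norm_num
    have e3 := abs_le.1 x4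
    have e4 := sq_nonneg (1 / (n : ℝ) * ∑ i, ψ (x i))
    rw [abs_lt]
    constructor <;> linarith [e3.1, e3.2])
  have hmain := abs_measureReal_pairSum_sub_normalCdf_le (a := a n) (hk n) R.density.bddMeas hv
    (c := κ n + pairSum (a n) (pairKernel K (h n)) x) hδ0 hcl t
  refine hmain.trans ?_
  rw [← hL]
  have hb := abs_bootstrap_centering_le hC han hn0 (pairKernel_diag K (h n)) (densityLaw f) x (κ n)
    hη0.le x1
  have h4 : (∫ y, projectionError (empirical x) (a n) (pairKernel K (h n)) f y ^ 2
      ∂(Measure.pi fun _ => empirical x)) / δ ^ 2 ≤ ε / 3 := by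
    rw [div_le_iff₀ (by positivity)]
    refine (integral_projectionError_empirical_le han hn0 (hk n) (pairKernel_symm R.kernel.even _)
      R.density.bddMeas x).trans (le_trans ?_ hη1)
    exact mul_le_mul_of_nonneg_left x1 (by positivity)
  -- The bootstrap centring has five contributions of size at most `δ / 8` each.
  have h5 := mul_le_mul_of_nonneg_left (add_le_add_right (hb.trans
    (show _ ≤ δ by linarith)) δ) hL0.le
  linarith

/-- Bootstrap consistency of weighted pair sums with almost uniform weights. -/
theorem bootstrapConsistent {Ω : Type*} [MeasurableSpace Ω] {μ : Measure Ω}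
    [IsProbabilityMeasure μ] {X : ℕ → Ω → E d} (hX : IsIIDSample μ X f)
    (R : RegularProblem f M K P s h) (hv : 0 < varianceBound f) {C : ℝ} (hC : 0 ≤ C)
    {a : (n : ℕ) → Fin n → Fin n → ℝ} (ha : ∀ᶠ n in atTop, AlmostUniformWeights n C (a n))
    {κ : ℕ → ℝ} (hκ : Tendsto (fun n : ℕ => √(n : ℝ) * (κ n - K 0 / h n ^ d / n)) atTop (𝓝 0))
    {T : (n : ℕ) → (Fin n → E d) → ℝ}
    (hT : ∀ᶠ n in atTop, ∀ x, T n x = κ n + pairSum (a n) (pairKernel K (h n)) x) :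
    BootstrapConsistent μ X (avgDensity f) T := by
  rw [BootstrapConsistent, tendstoInMeasure_iff_measureReal_norm]
  intro ε hε
  obtain ⟨A, hA, hA0, hAt⟩ := R.exists_typical hv hC ha hκ (ε := ε / 3) (by positivity)
  refine squeeze_zero' (Eventually.of_forall fun n => measureReal_nonneg) ?_ hA0
  filter_upwards [hAt, hT, R.eventually_abs_sub_normalCdf_le hv ha (ε := ε / 3) (by positivity)]
    with n h1 hTn h2
  rw [← hX.measureReal_sample (hA n)]
  refine measureReal_mono fun ω hω => ?_
  simp only [Set.mem_ofPred_eq] at hω ⊢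
  by_contra hx
  -- Both laws are compared with the same normal law shifted by `√n * κ n`. The shift may diverge,
  -- but it is common to both and drops out of the distance.
  have h3 := bootstrapDist_le (μ := μ) (X := X) (θ₀ := avgDensity f) (T := T) (n := n) (ω := ω)
    (F := fun t => normalCdf (varianceBound f) (t - √(n : ℝ) * κ n)) (D₁ := ε / 3) (D₂ := ε / 3)
    (fun t => ?_) (fun t => ?_)
  · rw [sub_zero, Real.norm_eq_abs] at hω
    linarith
  · have e : {ω' | √(n : ℝ) * (T n (sample X n ω') - avgDensity f) ≤ t}
        = {ω' | sample X n ω' ∈ {x : Fin n → E d | √(n : ℝ) *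
          (pairSum (a n) (pairKernel K (h n)) x - avgDensity f) ≤ t - √(n : ℝ) * κ n}} := by
      ext ω'
      simp only [Set.mem_ofPred_eq, hTn]
      rw [le_sub_iff_add_le, ← mul_add]
      ring_nf
    rw [e, hX.measureReal_sample (measurableSet_le (((bddMeas_pairSum
      (bddMeas_pairKernel R.kernel.bddMeas (h n)) (a n)).sub (BddMeas.const _)).const_mul
        _).measurable measurable_const)]
    exact h2 _
  · have e : {y | √(n : ℝ) * (T n y - T n (sample X n ω)) ≤ t}
        = {y | √(n : ℝ) * (pairSum (a n) (pairKernel K (h n)) y - (κ n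
          + pairSum (a n) (pairKernel K (h n)) (sample X n ω))) ≤ t - √(n : ℝ) * κ n} := by
      ext y
      simp only [Set.mem_ofPred_eq, hTn]
      rw [le_sub_iff_add_le, ← mul_add]
      ring_nf
    rw [e]
    exact h1 _ hx _

end RegularProblem

end AvgDensity

namespace AvgDensity

variable {d : ℕ}

/-! ### The bandwidth conditions -/

section Bandwidth

variable {P s : ℝ} {h : ℕ → ℝ}

theorem tendsto_bandwidth (hS : 0 < expS P s) (hh : ∀ n, 0 < h n)
    (hu : Tendsto (fun n : ℕ => (n : ℝ) * h n ^ (4 * expS P s)) atTop (𝓝 0)) :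
    Tendsto h atTop (𝓝 0) := by
  have h1 : Tendsto (fun n : ℕ => h n ^ (4 * expS P s)) atTop (𝓝 0) := by
    refine squeeze_zero' (Eventually.of_forall fun n => Real.rpow_nonneg (hh n).le _) ?_ hu
    filter_upwards [eventually_ge_atTop 1] with n hn
    exact le_mul_of_one_le_left (Real.rpow_nonneg (hh n).le _) (by exact_mod_cast hn)
  have h2 := h1.rpow_const (p := (4 * expS P s)⁻¹) (Or.inr (by positivity))
  rw [Real.zero_rpow (by positivity)] at h2
  refine h2.congr fun n => ?_
  rw [← Real.rpow_mul (hh n).le, mul_inv_cancel₀ (by positivity), Real.rpow_one]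

theorem ConditionBPlus.conditionB (hB : ConditionBPlus d P s h) (hS : 0 < expS P s)
    (hh : ∀ n, 0 < h n) : ConditionB d P s h := by
  refine ⟨hB.upper, tendsto_atTop_mono' _ ?_ hB.lower⟩
  filter_upwards [(tendsto_bandwidth hS hh hB.upper).eventually (gt_mem_nhds one_pos)] with n hn
  exact mul_le_mul_of_nonneg_left (pow_le_pow_of_le_one (hh n).le hn.le (by omega))
    (Nat.cast_nonneg n)

/-- The scaled diagonal `√n κ / (n h^d)` is `κ` divided by the square root of `n h^(2d)`. -/
theorem ConditionBPlus.tendsto_diag (hB : ConditionBPlus d P s h) (hh : ∀ n, 0 < h n) (κ : ℝ) :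
    Tendsto (fun n : ℕ => √(n : ℝ) * (0 - κ / h n ^ d / n)) atTop (𝓝 0) := by
  have h1 := ((tendsto_inv_atTop_zero.comp (Real.tendsto_sqrt_atTop.comp hB.lower)).const_mul (-κ))
  rw [mul_zero] at h1
  refine h1.congr' ?_
  filter_upwards [eventually_gt_atTop 0] with n hn
  have hn' : (0 : ℝ) < n := by exact_mod_cast hn
  have hp : 0 < h n ^ d := pow_pos (hh n) d
  simp only [Function.comp_apply]
  rw [Real.sqrt_mul hn'.le, mul_comm 2 d, pow_mul, Real.sqrt_sq hp.le]
  have h2 : √(n : ℝ) * √(n : ℝ) = n := Real.mul_self_sqrt hn'.le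
  have h3 : √(n : ℝ) ≠ 0 := (Real.sqrt_pos.2 hn').ne'
  field_simp
  rw [pow_two, h2]
  ring

end Bandwidth

/-! ### The jackknife kernel -/

/-- The kernel of the generalized jackknife. -/
noncomputable def jackknifeKernel (K : E d → ℝ) (c : ℝ) (u : E d) : ℝ :=
  1 / (1 - c ^ d) * (K u - K (c⁻¹ • u))

theorem scaledKernel_jackknifeKernel (K : E d → ℝ) {c : ℝ} (hc : 0 < c) (h : ℝ) (x : E d) :
    scaledKernel (jackknifeKernel K c) h x
      = 1 / (1 - c ^ d) * scaledKernel K h x - c ^ d / (1 - c ^ d) * scaledKernel K (c * h) x := by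
  have hp : c ^ d ≠ 0 := (pow_pos hc d).ne'
  simp only [scaledKernel, jackknifeKernel, mul_inv, smul_smul, mul_pow]
  have e : c ^ d / (1 - c ^ d) * (1 / (c ^ d * h ^ d) * K ((c⁻¹ * h⁻¹) • x))
      = 1 / (1 - c ^ d) * (1 / h ^ d * K ((c⁻¹ * h⁻¹) • x)) := by
    have : 1 / (c ^ d * h ^ d) = 1 / c ^ d * (1 / h ^ d) := by rw [one_div_mul_one_div]
    rw [this]
    field_simp
  rw [e]
  ring

/-- The plug-in estimator is linear in its scaled kernel, so two bandwidths amount to one kernel.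
That kernel vanishes at zero, hence the jackknife has no diagonal term. -/
theorem thetaGJ_eq (K : E d → ℝ) {c : ℝ} (hc : 0 < c) (h : ℝ) {n : ℕ} (x : Fin n → E d) :
    thetaGJ K c h x = thetaAD (jackknifeKernel K c) h x := by
  simp only [thetaGJ, thetaAD, kde, scaledKernel_jackknifeKernel K hc, Finset.sum_sub_distrib,
    ← Finset.mul_sum]
  ring

/-- Dilation by `c` multiplies a moment of degree `|l|` by `c^(|l|+d)`. The mass becomes `(1 -
c^d)/(1 - c^d)`, with `c^d ≠ 1` since `d > 0` and `c ≠ 1`, and vanishing moments still vanish. -/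
theorem ConditionK.jackknifeKernel {K : E d → ℝ} {P : ℝ} (hK : ConditionK K P) (hd : 0 < d)
    {c : ℝ} (hc : 0 < c) (hc1 : c ≠ 1) : ConditionK (jackknifeKernel K c) P := by
  have hc' : c⁻¹ ≠ 0 := inv_ne_zero hc.ne'
  have hcd : 1 - c ^ d ≠ 0 := sub_ne_zero.2 fun h =>
    hc1 ((pow_eq_one_iff_of_nonneg hc.le hd.ne').1 h.symm)
  have hP : 0 < P := lt_of_le_of_lt (by positivity) hK.order
  have hmom : ∀ l : Fin d → ℕ, ∫ u : E d, (∏ i, u i ^ l i) * K (c⁻¹ • u)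
      = c ^ (∑ i, l i) * (c ^ d * ∫ u : E d, (∏ i, u i ^ l i) * K u) := by
    intro l
    rw [← integral_scaled hc (fun u : E d => (∏ i, u i ^ l i) * K u), ← integral_const_mul]
    refine integral_congr_ae (Eventually.of_forall fun u => ?_)
    have e : ∏ i, c⁻¹ ^ l i = (c ^ ∑ i, l i)⁻¹ := by rw [Finset.prod_pow_eq_pow_sum, inv_pow]
    simp only [PiLp.smul_apply, smul_eq_mul, mul_pow, Finset.prod_mul_distrib, e]
    rw [mul_assoc (c ^ ∑ i, l i)⁻¹, mul_inv_cancel_left₀ (pow_pos hc _).ne']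
  have hw : Measurable fun u : E d => (∑ i, |u i|) ^ P := by
    have : Measurable fun u : E d => ∑ i, |u i| := by fun_prop
    exact this.pow_const P
  have hnn : ∀ u : E d, 0 ≤ (∑ i, |u i|) ^ P := fun u =>
    Real.rpow_nonneg (Finset.sum_nonneg fun i _ => abs_nonneg _) P
  have hint2 : Integrable (fun u : E d => |K (c⁻¹ • u)| * (1 + (∑ i, |u i|) ^ P)) volume := by
    have h1 : Integrable (fun u : E d => |K u| * (1 + c ^ P * (∑ i, |u i|) ^ P)) volume := by
      refine Integrable.mono' (hK.integrable.const_mul (1 + c ^ P))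
        ((hK.measurable.norm.mul ((hw.const_mul _).const_add 1)).aestronglyMeasurable)
        (Eventually.of_forall fun u => ?_)
      have hcP : 0 ≤ c ^ P := Real.rpow_nonneg hc.le P
      have := hnn u
      rw [Real.norm_eq_abs, abs_of_nonneg (by positivity)]
      nlinarith [abs_nonneg (K u), mul_nonneg (abs_nonneg (K u)) this,
        mul_nonneg (abs_nonneg (K u)) hcP]
    refine (h1.comp_smul hc').congr (Eventually.of_forall fun u => ?_)
    simp only [PiLp.smul_apply, smul_eq_mul, abs_mul, abs_of_pos (inv_pos.2 hc), ← Finset.mul_sum]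
    rw [Real.mul_rpow (inv_pos.2 hc).le (Finset.sum_nonneg fun i _ => abs_nonneg _), ← mul_assoc,
      ← Real.mul_rpow hc.le (inv_pos.2 hc).le, mul_inv_cancel₀ hc.ne', Real.one_rpow, one_mul]
  have hms : Measurable fun u : E d => K (c⁻¹ • u) :=
    hK.measurable.comp (measurable_const_smul c⁻¹)
  have hdom : ∀ {g : E d → ℝ}, Measurable g →
      Integrable (fun u : E d => |g u| * (1 + (∑ i, |u i|) ^ P)) volume →
      ∀ l : Fin d → ℕ, ((∑ i, l i : ℕ) : ℝ) < P →
      Integrable (fun u : E d => (∏ i, u i ^ l i) * g u) volume := by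
    intro g hg hgi l hl
    have hpm : Measurable fun u : E d => ∏ i, u i ^ l i := by fun_prop
    refine Integrable.mono' hgi (hpm.mul hg).aestronglyMeasurable (Eventually.of_forall fun u => ?_)
    rw [norm_mul, Real.norm_eq_abs, Real.norm_eq_abs, mul_comm]
    refine mul_le_mul_of_nonneg_left ?_ (abs_nonneg _)
    set r := ∑ i, |u i| with hr
    have hr0 : 0 ≤ r := Finset.sum_nonneg fun i _ => abs_nonneg _
    have h1 : |∏ i, u i ^ l i| ≤ r ^ (∑ i, l i) := by
      rw [Finset.abs_prod, ← Finset.prod_pow_eq_pow_sum]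
      refine Finset.prod_le_prod (fun i _ => abs_nonneg _) fun i _ => ?_
      rw [abs_pow]
      exact pow_le_pow_left₀ (abs_nonneg _)
        (Finset.single_le_sum (f := fun i => |u i|) (fun j _ => abs_nonneg _) (Finset.mem_univ i)) _
    refine h1.trans ?_
    rcases le_total r 1 with h2 | h2
    · exact (pow_le_one₀ hr0 h2).trans (le_add_of_nonneg_right (Real.rpow_nonneg hr0 P))
    · rw [← Real.rpow_natCast]
      exact (Real.rpow_le_rpow_of_exponent_le h2 hl.le).trans (by linarith)
  have hmoment : ∀ l : Fin d → ℕ, ((∑ i, l i : ℕ) : ℝ) < P →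
      ∫ u : E d, (∏ i, u i ^ l i) * AvgDensity.jackknifeKernel K c u
        = 1 / (1 - c ^ d) * ((∫ u : E d, (∏ i, u i ^ l i) * K u)
          - c ^ (∑ i, l i) * (c ^ d * ∫ u : E d, (∏ i, u i ^ l i) * K u)) := by
    intro l hl
    rw [← hmom, ← integral_sub (hdom hK.measurable hK.integrable l hl) (hdom hms hint2 l hl),
      ← integral_const_mul]
    refine integral_congr_ae (Eventually.of_forall fun u => ?_)
    simp only [AvgDensity.jackknifeKernel]
    ring
  have hmeas : Measurable (AvgDensity.jackknifeKernel K c) := (hK.measurable.sub hms).const_mul _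
  refine ⟨hK.order, hmeas, fun u => ?_, ?_, ?_, ?_, fun l hl0 hl => ?_⟩
  · simp only [AvgDensity.jackknifeKernel, smul_neg, hK.even]
  · obtain ⟨M, hM⟩ := hK.bounded
    refine ⟨|1 / (1 - c ^ d)| * (M + M), fun u => ?_⟩
    rw [AvgDensity.jackknifeKernel, abs_mul]
    exact mul_le_mul_of_nonneg_left ((abs_sub _ _).trans (add_le_add (hM _) (hM _))) (abs_nonneg _)
  · refine Integrable.mono' ((hK.integrable.add hint2).const_mul |1 / (1 - c ^ d)|)
      ((hmeas.norm.mul (hw.const_add 1)).aestronglyMeasurable) (Eventually.of_forall fun u => ?_)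
    have h1 := hnn u
    rw [Real.norm_eq_abs, abs_mul, abs_abs, abs_of_nonneg (by positivity : 0 ≤ 1 + (∑ i, |u i|) ^ P),
      AvgDensity.jackknifeKernel, abs_mul, Pi.add_apply, ← add_mul, mul_assoc]
    exact mul_le_mul_of_nonneg_left (mul_le_mul_of_nonneg_right (abs_sub _ _) (by positivity))
      (abs_nonneg _)
  · have h1 := hmoment 0 (by simpa using hP)
    simp only [Pi.zero_apply, pow_zero, Finset.prod_const_one, one_mul, Finset.sum_const_zero,
      hK.integral_one, mul_one] at h1
    rw [h1, one_div, inv_mul_cancel₀ hcd]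
  · rw [hmoment l hl, hK.moments l hl0 hl]
    simp

/-! ### The leave-out weights -/

section LeaveOut

variable {n B : ℕ}

/-- The observation number is `k + 1`, and it lies in `(b n / B, (b + 1) n / B]`; passing to floors
gives a half-open interval for the zero-based `k`. -/
theorem block_eq_iff (hn : 0 < n) (hB : 0 < B) (b : ℕ) (k : Fin n) :
    block B k = b + 1 ↔ b * n / B ≤ k ∧ (k : ℕ) < (b + 1) * n / B := by
  have hn' : (0 : ℝ) < n := by exact_mod_cast hn
  rw [block, Nat.ceil_eq_iff (by omega), lt_div_iff₀ hn', div_le_iff₀ hn', Nat.add_sub_cancel,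
    Nat.div_le_iff_le_mul_add_pred hB, Nat.lt_iff_add_one_le, Nat.le_div_iff_mul_le hB]
  have e1 : ((b : ℝ) * n < ((k : ℕ) + 1 : ℝ) * B) ↔ b * n < (k + 1) * B := by exact_mod_cast Iff.rfl
  have e2 : (((k : ℕ) + 1 : ℝ) * B ≤ ((b + 1 : ℕ) : ℝ) * n) ↔ (k + 1) * B ≤ (b + 1) * n := by
    exact_mod_cast Iff.rfl
  rw [e1, e2]
  refine and_congr_left fun _ => ?_
  rw [add_mul, one_mul, mul_comm B]
  omega

/-- A block size is the difference of the floors of two numbers that are `n / B` apart. -/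
theorem abs_card_block_sub_le (hn : 0 < n) (hB : 0 < B) (i : Fin n) :
    |((Finset.univ.filter fun k : Fin n => block B i = block B k).card : ℝ) - n / B| ≤ 1 := by
  have hn' : (0 : ℝ) < n := by exact_mod_cast hn
  have hB' : (0 : ℝ) < B := by exact_mod_cast hB
  have hpos : 0 < block B i := Nat.ceil_pos.2 (by positivity)
  have hle : block B i ≤ B := by
    refine Nat.ceil_le.2 ((div_le_iff₀ hn').2 ?_)
    rw [mul_comm]
    refine mul_le_mul_of_nonneg_left ?_ hB'.le
    exact_mod_cast i.2
  obtain ⟨b, hb⟩ : ∃ b, block B i = b + 1 := ⟨block B i - 1, by omega⟩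
  have hq : (b + 1) * n / B ≤ n := by
    refine Nat.div_le_of_le_mul ?_
    exact Nat.mul_le_mul_right n (by omega)
  have hcard : (Finset.univ.filter fun k : Fin n => block B i = block B k).card
      = (b + 1) * n / B - b * n / B := by
    rw [← Nat.card_Ico, ← Finset.card_map Fin.valEmbedding]
    congr 1
    ext m
    simp only [Finset.mem_map, Finset.mem_filter, Finset.mem_univ, true_and, Fin.valEmbedding_apply,
      Finset.mem_Ico]
    constructor
    · rintro ⟨k, hk, rfl⟩
      exact (block_eq_iff hn hB b k).1 (by rw [← hk, hb])
    · intro hm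
      refine ⟨⟨m, by omega⟩, ?_, rfl⟩
      rw [hb]
      exact ((block_eq_iff hn hB b _).2 hm).symm
  have hmono : b * n / B ≤ (b + 1) * n / B := Nat.div_le_div_right (Nat.mul_le_mul_right n (by omega))
  rw [hcard, Nat.cast_sub hmono]
  have f1 : (((b + 1) * n / B : ℕ) : ℝ) ≤ (((b + 1) * n : ℕ) : ℝ) / B := Nat.cast_div_le
  have f2 : ((b * n / B : ℕ) : ℝ) ≤ ((b * n : ℕ) : ℝ) / B := Nat.cast_div_le
  have f3 : (((b + 1) * n : ℕ) : ℝ) / B < (((b + 1) * n / B : ℕ) : ℝ) + 1 := by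
    rw [div_lt_iff₀ hB']
    exact_mod_cast Nat.lt_mul_of_div_lt (Nat.lt_succ_self _) hB
  have f4 : ((b * n : ℕ) : ℝ) / B < ((b * n / B : ℕ) : ℝ) + 1 := by
    rw [div_lt_iff₀ hB']
    exact_mod_cast Nat.lt_mul_of_div_lt (Nat.lt_succ_self _) hB
  have e : (((b + 1) * n : ℕ) : ℝ) / B = ((b * n : ℕ) : ℝ) / B + n / B := by
    push_cast; ring
  rw [abs_le]
  constructor <;> linarith

/-- The denominators are `n` minus a block size, hence at least `n - n/2 - 1 ≥ n/4`, and any two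
differ by at most `2`. Before division by `n`, rows sum exactly to one, and each column sum is off
by at most `n * 2 * (4/n)² = 32/n`. -/
theorem almostUniformWeights_leaveOut (hn : 4 ≤ n) (hB : 2 ≤ B) :
    AlmostUniformWeights n 32 fun i j : Fin n => leaveOutWeight B i j / n := by
  have hn0 : 0 < n := by omega
  have hn' : (0 : ℝ) < n := by exact_mod_cast hn0
  have hn4 : (4 : ℝ) ≤ n := by exact_mod_cast hn
  have hB' : (2 : ℝ) ≤ B := by exact_mod_cast hB
  set D : Fin n → ℝ := fun i => ∑ k : Fin n, (if block B i ≠ block B k then 1 else 0) with hD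
  have hDN : ∀ i, D i
      = n - ((Finset.univ.filter fun k : Fin n => block B i = block B k).card : ℝ) := by
    intro i
    have h1 : ∀ k : Fin n, (if block B i ≠ block B k then (1 : ℝ) else 0)
        = 1 - if block B i = block B k then 1 else 0 := by
      intro k
      split_ifs <;> simp_all
    simp only [hD, h1]
    rw [Finset.sum_sub_distrib, Finset.sum_boole]
    simp
  have hNB : (n : ℝ) / B ≤ n / 2 := by gcongr
  have hDle : ∀ i, (n : ℝ) / 4 ≤ D i := by
    intro i
    have h1 := (abs_le.1 (abs_card_block_sub_le hn0 (by omega : 0 < B) i)).2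
    rw [hDN]
    linarith
  have hDpos : ∀ i, 0 < D i := fun i => lt_of_lt_of_le (by positivity) (hDle i)
  have hDsub : ∀ i j, |D i - D j| ≤ 2 := by
    intro i j
    have h1 := abs_le.1 (abs_card_block_sub_le hn0 (by omega : 0 < B) i)
    have h2 := abs_le.1 (abs_card_block_sub_le hn0 (by omega : 0 < B) j)
    rw [hDN, hDN, abs_le]
    constructor <;> linarith [h1.1, h1.2, h2.1, h2.2]
  have hw : ∀ i j, leaveOutWeight B i j = (if block B i ≠ block B j then 1 else 0) / D i :=
    fun i j => rfl
  have hinv : ∀ i, 1 / D i ≤ 4 / n := by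
    intro i
    rw [div_le_div_iff₀ (hDpos i) hn']
    linarith [hDle i]
  refine ⟨fun i => by simp [leaveOutWeight], fun i j => ?_, fun i => ?_⟩
  · have h1 : |leaveOutWeight B i j| ≤ 4 / n := by
      rw [hw, abs_div, abs_of_pos (hDpos i)]
      refine le_trans (div_le_div_of_nonneg_right ?_ (hDpos i).le) (hinv i)
      split_ifs <;> simp
    rw [abs_div, abs_of_pos hn', div_le_div_iff₀ hn' (by positivity)]
    have h2 := mul_le_mul_of_nonneg_right h1 (show 0 ≤ (n : ℝ) ^ 2 by positivity)
    refine h2.trans ?_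
    have : 4 / (n : ℝ) * n ^ 2 = 4 * n := by field_simp
    rw [this]
    nlinarith
  · rw [← Finset.sum_div, ← Finset.sum_div]
    have h1 : ∑ j, leaveOutWeight B i j = 1 := by
      simp only [hw]
      rw [← Finset.sum_div]
      exact div_self (hDpos i).ne'
    have h2 : |(∑ j, leaveOutWeight B j i) - 1| ≤ 32 / n := by
      rw [← h1, ← Finset.sum_sub_distrib]
      refine (Finset.abs_sum_le_sum_abs _ _).trans ((Finset.sum_le_card_nsmul _ _ (32 / (n : ℝ) ^ 2)
        fun j _ => ?_).trans (le_of_eq ?_))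
      · rw [hw, hw]
        simp only [ne_comm (a := block B j)]
        split_ifs
        · rw [div_sub_div _ _ (hDpos j).ne' (hDpos i).ne', one_mul, mul_one, abs_div,
            abs_of_pos (mul_pos (hDpos j) (hDpos i)),
            div_le_div_iff₀ (mul_pos (hDpos j) (hDpos i)) (by positivity)]
          have h3 := hDsub i j
          have h4 : (n : ℝ) / 4 * (n / 4) ≤ D j * D i :=
            mul_le_mul (hDle j) (hDle i) (by positivity) (hDpos j).le
          nlinarith [mul_le_mul_of_nonneg_right h3 (show 0 ≤ (n : ℝ) ^ 2 by positivity)]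
        · simp
          positivity
      · rw [Finset.card_univ, Fintype.card_fin, nsmul_eq_mul]
        field_simp
    have e : (∑ j, leaveOutWeight B i j) / n + (∑ j, leaveOutWeight B j i) / n - 2 / (n : ℝ)
        = ((∑ j, leaveOutWeight B j i) - 1) / n := by
      rw [h1]; ring
    rw [e, abs_div, abs_of_pos hn']
    refine (div_le_div_of_nonneg_right h2 hn'.le).trans (le_of_eq ?_)
    field_simp

end LeaveOut

/-! ### The estimators as weighted pair sums -/

section Estimators

variable {n : ℕ}

theorem thetaAD_eq (hn : 0 < n) (K : E d → ℝ) (h : ℝ) (x : Fin n → E d) :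
    thetaAD K h x = K 0 / h ^ d / n + pairSum (uniformWeights n) (pairKernel K h) x :=
  mean_mean_eq_pairSum hn (pairKernel_diag K h) x

theorem thetaBC_eq (hn : 0 < n) (K : E d → ℝ) (h : ℝ) (x : Fin n → E d) :
    thetaBC K h x = 0 + pairSum (uniformWeights n) (pairKernel K h) x := by
  rw [thetaBC, thetaAD_eq hn, div_div, mul_comm (n : ℝ)]
  ring

theorem thetaLO_eq (K : E d → ℝ) (B : ℕ) (h : ℝ) (x : Fin n → E d) :
    thetaLO K B h x = 0 + pairSum (fun i j => leaveOutWeight B i j / n) (pairKernel K h) x := by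
  rw [zero_add, thetaLO, pairSum, Finset.mul_sum]
  refine Finset.sum_congr rfl fun i _ => ?_
  rw [kdeLO, Finset.mul_sum]
  refine Finset.sum_congr rfl fun j _ => ?_
  rw [pairKernel]
  ring

end Estimators

end AvgDensity

/-! ### The four estimators. -/

theorem theorem2 {d : ℕ} (hd : 0 < d)
    {Ω : Type*} [MeasurableSpace Ω] (μ : Measure Ω) [IsProbabilityMeasure μ]
    (X : ℕ → Ω → AvgDensity.E d) (f₀ : AvgDensity.E d → ℝ)
    (hX : AvgDensity.IsIIDSample μ X f₀)
    (K : AvgDensity.E d → ℝ) (s P : ℝ)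
    (hD : AvgDensity.ConditionD f₀ s)
    (hσ : 0 < AvgDensity.varianceBound f₀)
    (hK : AvgDensity.ConditionK K P)
    (h : ℕ → ℝ) (hh : ∀ n, 0 < h n)
    (c : ℝ) (hc : 0 < c) (hc1 : c ≠ 1)
    (B : ℕ → ℕ) (hB : ∀ n, 2 ≤ n → 2 ≤ B n ∧ B n ≤ n) :
    (AvgDensity.ConditionB d P s h →
      AvgDensity.BootstrapConsistent μ X (AvgDensity.avgDensity f₀)
          (fun n x => AvgDensity.thetaAD K (h n) x) ∧
        AvgDensity.BootstrapConsistent μ X (AvgDensity.avgDensity f₀)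
          (fun n x => AvgDensity.thetaGJ K c (h n) x)) ∧
    (AvgDensity.ConditionBPlus d P s h →
      AvgDensity.BootstrapConsistent μ X (AvgDensity.avgDensity f₀)
          (fun n x => AvgDensity.thetaBC K (h n) x) ∧
        AvgDensity.BootstrapConsistent μ X (AvgDensity.avgDensity f₀)
          (fun n x => AvgDensity.thetaLO K (B n) (h n) x)) := by
  obtain ⟨M, hM⟩ := hD.bounded
  have hs : 0 < s := lt_of_le_of_lt (by positivity) hD.smooth
  have hP : 0 < P := lt_of_le_of_lt (by positivity) hK.order
  have hS : 0 < AvgDensity.expS P s := lt_min (by positivity) hs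
  have hreg : ∀ {L : AvgDensity.E d → ℝ}, AvgDensity.ConditionK L P →
      AvgDensity.ConditionB d P s h → AvgDensity.RegularProblem f₀ M L P s h := fun hL hb =>
    ⟨hX.boundedDensity hM, hL, hs, hD.two_mul_not_nat, hD.besov, hh, hb,
      AvgDensity.tendsto_bandwidth hS hh hb.upper⟩
  have hU : ∀ᶠ n in atTop, AvgDensity.AlmostUniformWeights n 2 (AvgDensity.uniformWeights n) := by
    filter_upwards [eventually_gt_atTop 0] with n hn
    exact AvgDensity.almostUniformWeights_uniform hn
  have hAD : ∀ {L : AvgDensity.E d → ℝ}, AvgDensity.ConditionK L P →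
      AvgDensity.ConditionB d P s h →
      AvgDensity.BootstrapConsistent μ X (AvgDensity.avgDensity f₀)
        (fun n x => AvgDensity.thetaAD L (h n) x) := by
    intro L hL hb
    -- The constant equals the diagonal term, so the condition on `κ` is trivial and `n h^d → ∞` is
    -- enough.
    refine (hreg hL hb).bootstrapConsistent hX hσ zero_le_two hU
      (κ := fun n => L 0 / h n ^ d / n) (by simp) ?_
    filter_upwards [eventually_gt_atTop 0] with n hn x
    exact AvgDensity.thetaAD_eq hn L (h n) x
  refine ⟨fun hb => ⟨hAD hK hb, ?_⟩, fun hb => ?_⟩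
  · simp only [AvgDensity.thetaGJ_eq K hc]
    exact hAD (hK.jackknifeKernel hd hc hc1) hb
  · have R := hreg hK (hb.conditionB hS hh)
    -- Here `κ = 0`: the diagonal appears in the bootstrap world only and has to be negligible by
    -- itself.
    have hκ := hb.tendsto_diag hh (K 0)
    refine ⟨R.bootstrapConsistent hX hσ zero_le_two hU hκ ?_,
      R.bootstrapConsistent hX hσ (C := 32) (by norm_num) ?_ hκ
        (Eventually.of_forall fun n x => AvgDensity.thetaLO_eq K (B n) (h n) x)⟩
    · filter_upwards [eventually_gt_atTop 0] with n hn x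
      exact AvgDensity.thetaBC_eq hn K (h n) x
    · filter_upwards [eventually_ge_atTop 4] with n hn
      exact AvgDensity.almostUniformWeights_leaveOut hn (hB n (by omega)).1
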